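/- Let $k \ge 2$ and $\Delta \ge 2$ be integer constants with $\Delta \le \frac{1}{\sqrt{8e}\,k^2}\cdot 2^{k/2}$. Then there is a deterministic fully polynomial-time approximation scheme (FPTAS) for the number of independent sets in $k$-uniform hypergraphs of maximum degree at most $\Delta$. In detail: a hypergraph $H=(V,\mathcal E)$ consists of a finite set $V$ and a set $\mathcal E$ of subsets of $V$; it is $k$-uniform if $|e|=k$ for all $e\in\mathcal E$, its maximum degree is the largest number of hyperedges that contain a common vertex, a set $S\subseteq V$ is independent if $S\cap e\ne e$ for all $e\in\mathcal E$, and $Z_H$ is the number of independent sets of $H$. There is a deterministic algorithm (which may depend on $k$ and $\Delta$) that, given any $k$-uniform hypergraph $H$ of maximum degree at most $\Delta$ with $n$ vertices (as lists of the vertices of its hyperedges) and any rational $\varepsilon=p/q$ with integers $0<p<q$, outputs a rational number $\widehat Z$ with $$(1-\varepsilon)\,Z_H \;\le\; \widehat Z \;\le\; (1+\varepsilon)\,Z_H ,$$ and whose running time is bounded by a polynomial (depending only on $k$ and $\Delta$) in $n$, in $1/\varepsilon$ and in the bit length of $q$. The running time is measured on a random access machine with logarithmic cost. -/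

import Mathlib

/-! ### Random access machines with the logarithmic cost criterion -/

namespace LogRAM

/-- The memory: cell `i` holds the natural number `M i`. -/
abbrev Memory := ℕ → ℕ

/-- Arithmetic expressions over the memory; `cell e` is the content of the cell whose address is
the value of `e` (indirect addressing). -/
inductive Expr
  | lit (n : ℕ)
  | cell (e : Expr)
  | add (e f : Expr)
  | sub (e f : Expr)
  | mul (e f : Expr)
  | div (e f : Expr)

/-- The value of an expression. Subtraction is truncated at `0`, division rounds down, and
division by `0` gives `0`. -/
def Expr.eval (M : Memory) : Expr → ℕ
  | lit n => n
  | cell e => M (e.eval M)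
  | add e f => e.eval M + f.eval M
  | sub e f => e.eval M - f.eval M
  | mul e f => e.eval M * f.eval M
  | div e f => e.eval M / f.eval M

/-- The cost of evaluating an expression: every operation and every memory access costs one plus
the number of bits of its result, on top of the costs of its operands (so that the bit lengths of
all operands, addresses and results are paid for). -/
def Expr.cost (M : Memory) : Expr → ℕ
  | lit n => 1 + n.size
  | cell e => e.cost M + (1 + (M (e.eval M)).size)
  | add e f => e.cost M + f.cost M + (1 + (e.eval M + f.eval M).size)
  | sub e f => e.cost M + f.cost M + (1 + (e.eval M - f.eval M).size)
  | mul e f => e.cost M + f.cost M + (1 + (e.eval M * f.eval M).size)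
  | div e f => e.cost M + f.cost M + (1 + (e.eval M / f.eval M).size)

/-- Deterministic programs. `store a e` writes the value of `e` into the cell whose address is the
value of `a`; `ite e` and `while e` test whether the value of `e` is nonzero. -/
inductive Program
  | skip
  | store (a e : Expr)
  | seq (P Q : Program)
  | ite (e : Expr) (P Q : Program)
  | while (e : Expr) (P : Program)

/-- `Exec P M M' t`: started on memory `M`, the program `P` halts with memory `M'`, and the cost of
the whole run is `t`. -/
inductive Exec : Program → Memory → Memory → ℕ → Prop
  | skip (M : Memory) : Exec .skip M M 1
  | store (a e : Expr) (M : Memory) :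
      Exec (.store a e) M (Function.update M (a.eval M) (e.eval M)) (a.cost M + e.cost M + 1)
  | seq {P Q : Program} {M M₁ M₂ : Memory} {s t : ℕ} :
      Exec P M M₁ s → Exec Q M₁ M₂ t → Exec (.seq P Q) M M₂ (s + t + 1)
  | ite_true {e : Expr} {P Q : Program} {M M₁ : Memory} {t : ℕ} :
      e.eval M ≠ 0 → Exec P M M₁ t → Exec (.ite e P Q) M M₁ (e.cost M + t + 1)
  | ite_false {e : Expr} {P Q : Program} {M M₁ : Memory} {t : ℕ} :
      e.eval M = 0 → Exec Q M M₁ t → Exec (.ite e P Q) M M₁ (e.cost M + t + 1)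
  | while_true {e : Expr} {P : Program} {M M₁ M₂ : Memory} {s t : ℕ} :
      e.eval M ≠ 0 → Exec P M M₁ s → Exec (.while e P) M₁ M₂ t →
        Exec (.while e P) M M₂ (e.cost M + s + t + 1)
  | while_false {e : Expr} {P : Program} {M : Memory} :
      e.eval M = 0 → Exec (.while e P) M M (e.cost M + 1)

/-- A program has at most one terminating run on a given memory. -/
theorem Exec.unique {P : Program} {M M₁ M₂ : Memory} {s t : ℕ}
    (h₁ : Exec P M M₁ s) (h₂ : Exec P M M₂ t) : M₁ = M₂ ∧ s = t := by
  induction h₁ generalizing M₂ t with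
  | skip | store => cases h₂; exact ⟨rfl, rfl⟩
  | seq _ _ ih₁ ih₂ =>
    cases h₂ with
    | seq h₁ h₂ =>
      obtain ⟨rfl, rfl⟩ := ih₁ h₁
      obtain ⟨rfl, rfl⟩ := ih₂ h₂
      exact ⟨rfl, rfl⟩
  | ite_true he _ ih | ite_false he _ ih =>
    cases h₂ with
    | ite_true he' h => first | exact absurd he he' | (obtain ⟨rfl, rfl⟩ := ih h; exact ⟨rfl, rfl⟩)
    | ite_false he' h => first | exact absurd he' he | (obtain ⟨rfl, rfl⟩ := ih h; exact ⟨rfl, rfl⟩)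
  | while_true he _ _ ih₁ ih₂ =>
    cases h₂ with
    | while_true _ h₁ h₂ =>
      obtain ⟨rfl, rfl⟩ := ih₁ h₁
      obtain ⟨rfl, rfl⟩ := ih₂ h₂
      exact ⟨rfl, rfl⟩
    | while_false he' => exact absurd he' he
  | while_false he =>
    cases h₂ with
    | while_true he' => exact absurd he he'
    | while_false => exact ⟨rfl, rfl⟩

/-- The initial memory: the input words in the cells `0, 1, 2, …`, and `0` everywhere else. -/
def initial (w : List ℕ) : Memory := fun i => w.getD i 0

end LogRAM

/-- A deterministic fully polynomial-time approximation scheme for the quantity `Z x`, over the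
instances `x` that satisfy `valid`. The input consists of `ε = p / q ∈ (0, 1)`, given by `p` and `q`,
and of the words `enc x`. The output is the fraction `a / b` in the cells `0` and `1`. The running
time is bounded by a polynomial in the size of `x`, in `1 / ε`, and in the bit length of `q` (hence
of `ε`). -/
def HasFPTAS {I : Type} (valid : I → Prop) (size : I → ℕ) (enc : I → List ℕ) (Z : I → ℕ) : Prop :=
  ∃ (P : LogRAM.Program) (c : ℕ), ∀ x : I, valid x → ∀ p q : ℕ, 0 < p → p < q →
    ∃ (M : LogRAM.Memory) (t : ℕ),
      LogRAM.Exec P (LogRAM.initial (p :: q :: enc x)) M t ∧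
      M 1 ≠ 0 ∧
      (1 - (p : ℚ) / q) * Z x ≤ (M 0 : ℚ) / M 1 ∧
      (M 0 : ℚ) / M 1 ≤ (1 + (p : ℚ) / q) * Z x ∧
      (t : ℚ) ≤ c * ((size x : ℚ) + (q : ℚ) / p + (q.size : ℚ)) ^ c

/-! ### Hypergraphs -/

namespace Hypergraph

variable {α : Type*}

/-- Every hyperedge has exactly `k` vertices. -/
def IsUniform (H : Hypergraph α) (k : ℕ) : Prop := ∀ e ∈ H.edgeSet, e.ncard = k

/-- The number of hyperedges that contain `v`. -/
noncomputable def degree (H : Hypergraph α) (v : α) : ℕ := {e ∈ H.edgeSet | v ∈ e}.ncard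

/-- `S` is a (weak) independent set: a set of vertices that contains no hyperedge entirely. -/
def IsIndepSet (H : Hypergraph α) (S : Set α) : Prop :=
  S ⊆ H.vertexSet ∧ ∀ e ∈ H.edgeSet, S ∩ e ≠ e

/-- The number of independent sets. -/
noncomputable def numIndepSets (H : Hypergraph α) : ℕ := {S | H.IsIndepSet S}.ncard

end Hypergraph

/-- A presentation of a finite hypergraph on the vertices `0, …, n - 1`: its hyperedges, listed in
some order and without repetition, each one as a list of its vertices, in some order and without
repetition. -/
structure HypergraphData where
  n : ℕ
  edges : List (List (Fin n))
  nodup : ∀ e ∈ edges, e.Nodup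
  distinct : edges.Pairwise fun e f => e.toFinset ≠ f.toFinset

namespace HypergraphData

/-- The hypergraph that is presented. -/
def toHypergraph (D : HypergraphData) : Hypergraph (Fin D.n) where
  vertexSet := Set.univ
  edgeSet := {s | ∃ e ∈ D.edges, s = {v | v ∈ e}}
  subset_vertexSet_of_mem_edgeSet' := fun _ _ => Set.subset_univ _

/-- The presentation as input words: the number of vertices, the number of hyperedges, and for each
hyperedge its cardinality followed by its vertices. -/
def encode (D : HypergraphData) : List ℕ :=
  D.n :: D.edges.length :: D.edges.flatMap fun e => e.length :: e.map Fin.val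

end HypergraphData

/-! The systematic scan visits the vertices cyclically. At each visit a fair coin is thrown: on zero
the vertex leaves the set, on one it enters unless that would complete a hyperedge. Each update
preserves the uniform distribution on independent sets (`sum_glauber`, `sum_scan`), so the marginal
of a vertex can be read off from a scan with a uniform start. Updates are indexed by their age: age
`0` is the last one, and age `a` updates the vertex `a % n`.

A zero coin decides an update whatever the past was. With a one coin, the result depends only on
whether some hyperedge through the vertex was fully occupied elsewhere at the latest updates of its
other vertices. Looking backwards from the last update of `v`, one therefore reveals coins only on
demand. `IsTable` describes what partially revealed coins determine and which coin to ask for next;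
determined values are right for every initial set (`IsTable.sound`).

If `L` coins do not determine the value, the queries have spread along hyperedges in space-time all
of whose coins are one, and from these one can select `M` disjoint ones, with `L` linear in `M`
(`Tabulates.hasLargeCluster`). A given selected hyperedge costs probability `2 ^ (-k)`, and leads to
at most `d = k³Δ²` candidates for the next. Since `(1 + 1 / d) ^ d ≤ e`, the assumption on `Δ`, in
the form `2 * d * e ≤ 2 ^ k`, bounds the failure probability by `4 / 2 ^ M`
(`card_hasLargeCluster_le`). With `M` logarithmic in `n + 1 / ε`, all `2 ^ L` outcomes of the coins
can be enumerated, which removes the randomness (`Tabulates.zeroCount_spec`).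

Counting reduces to marginals by dropping the hyperedges in the order of their least vertices. If `Z
i` counts the independent sets for the hyperedges without vertices below `i`, then `Z (i + 1)` is
twice the number of sets counted by `Z i` that avoid `i` (`card_indep_above_succ`). As `Z n = 2 ^
n`, the number sought is the product of the inverse probabilities that `i` is absent
(`prod_approx`).

The remainder is an explicit program. Large products are formed by repeated addition, so a step
lengthens the numbers by a bounded number of bits, and a polynomial bound on the number of steps
yields one on the logarithmic cost (`Steps.exec`). -/

namespace HypergraphFPTAS

open Finset

/-! ### Cyclic visiting times -/

/-- The least `b ≥ a` with `b % n = x`. -/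
def nextVisit (n x a : ℕ) : ℕ := a + (x + (n - a % n)) % n

/-- The greatest `b ≤ s` with `b % n = x`, when there is one. -/
def prevVisit (n x s : ℕ) : ℕ := s - (s % n + (n - x)) % n

theorem le_nextVisit (n x a : ℕ) : a ≤ nextVisit n x a := Nat.le_add_right _ _

theorem nextVisit_lt {n : ℕ} (hn : 0 < n) (x a : ℕ) : nextVisit n x a < a + n :=
  Nat.add_lt_add_left (Nat.mod_lt _ hn) _

theorem nextVisit_mod {n x : ℕ} (hx : x < n) (a : ℕ) : nextVisit n x a % n = x := by
  have hn : 0 < n := by omega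
  have h1 : a % n < n := Nat.mod_lt _ hn
  unfold nextVisit
  rw [Nat.add_mod, Nat.mod_mod, ← Nat.add_mod a, ← Nat.mod_add_mod]
  have : a % n + (x + (n - a % n)) = x + n := by omega
  rw [this, Nat.add_mod_right, Nat.mod_eq_of_lt hx]

theorem eq_of_mod_eq {n a b c : ℕ} (h : b % n = c % n) (hb : a ≤ b) (hb' : b < a + n)
    (hc : a ≤ c) (hc' : c < a + n) : b = c := by
  have key : ∀ {b c : ℕ}, b % n = c % n → a ≤ b → c < a + n → b ≤ c → b = c := by
    intro b c h hb hc hbc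
    have h2 : n ∣ c - b := (Nat.modEq_iff_dvd' hbc).1 h
    have h3 : c - b = 0 := Nat.eq_zero_of_dvd_of_lt h2 (by omega)
    omega
  rcases le_total b c with h' | h'
  · exact key h hb hc' h'
  · exact (key h.symm hc hb' h').symm

theorem eq_nextVisit {n x a s : ℕ} (hx : x < n) (hs : s % n = x) (h : a ≤ s) (h' : s < a + n) :
    s = nextVisit n x a :=
  eq_of_mod_eq (hs.trans (nextVisit_mod hx a).symm) h h' (le_nextVisit _ _ _)
    (nextVisit_lt (by omega) _ _)

theorem nextVisit_self {n : ℕ} (hn : 0 < n) (a : ℕ) : nextVisit n (a % n) a = a :=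
  (eq_nextVisit (Nat.mod_lt _ hn) rfl le_rfl (by omega)).symm

theorem nextVisit_eq_self_iff {n x : ℕ} (hx : x < n) (a : ℕ) :
    nextVisit n x a = a ↔ x = a % n := by
  constructor
  · intro h
    rw [← nextVisit_mod hx a, h]
  · rintro rfl
    exact nextVisit_self (by omega) a

theorem lt_nextVisit {n x a : ℕ} (hx : x < n) (h : x ≠ a % n) : a < nextVisit n x a :=
  lt_of_le_of_ne (le_nextVisit _ _ _) fun h' => h ((nextVisit_eq_self_iff hx a).1 h'.symm)

theorem nextVisit_succ {n x a : ℕ} (hx : x < n) (h : x ≠ a % n) :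
    nextVisit n x (a + 1) = nextVisit n x a :=
  (eq_nextVisit hx (nextVisit_mod hx a) (lt_nextVisit hx h)
    (by have := nextVisit_lt (by omega : 0 < n) x a; omega)).symm

theorem nextVisit_zero {n x : ℕ} (hx : x < n) : nextVisit n x 0 = x :=
  (eq_nextVisit hx (Nat.mod_eq_of_lt hx) (Nat.zero_le _) (by omega)).symm

/-- A hyperedge in space-time that contains `s` can be recovered from `s`, the underlying hyperedge
and the vertex at which it starts. Hence at most `Δ * k` of them pass through `s`. -/
theorem prevVisit_nextVisit {n x : ℕ} (hx : x < n) (a : ℕ) :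
    prevVisit n (a % n) (nextVisit n x a) = a := by
  have hn : 0 < n := by omega
  have h1 : a % n < n := Nat.mod_lt _ hn
  unfold prevVisit
  rw [nextVisit_mod hx]
  unfold nextVisit
  omega

/-! ### Hyperedges in space-time -/

/-- The latest updates, seen from age `a`, of the vertices of `e`. -/
def timed (n : ℕ) (e : Finset ℕ) (a : ℕ) : Finset ℕ := e.image fun x => nextVisit n x a

theorem mem_timed {n : ℕ} {e : Finset ℕ} {a s : ℕ} :
    s ∈ timed n e a ↔ ∃ x ∈ e, nextVisit n x a = s := by
  simp [timed]

theorem card_timed {n : ℕ} {e : Finset ℕ} (he : ∀ x ∈ e, x < n) (a : ℕ) :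
    (timed n e a).card = e.card :=
  card_image_of_injOn fun x hx y hy h => by
    rw [← nextVisit_mod (he x hx) a, ← nextVisit_mod (he y hy) a]
    exact congrArg (· % n) h

/-- A finite family of `k`-element subsets of `{0, …, n - 1}` with at most `Δ` of them through any
point. -/
structure IsBounded (n k Δ : ℕ) (F : Finset (Finset ℕ)) : Prop where
  lt : ∀ e ∈ F, ∀ x ∈ e, x < n
  card : ∀ e ∈ F, e.card = k
  degree : ∀ x, (F.filter (x ∈ ·)).card ≤ Δ

/-- The members of `F` in space-time that contain `s`. -/
def through (n : ℕ) (F : Finset (Finset ℕ)) (s : ℕ) : Finset (Finset ℕ) :=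
  (F.filter (s % n ∈ ·)).biUnion fun f => f.image fun x => timed n f (prevVisit n x s)

/-- The members of `F` in space-time that start at `a`. -/
def starting (n : ℕ) (F : Finset (Finset ℕ)) (a : ℕ) : Finset (Finset ℕ) :=
  (F.filter (a % n ∈ ·)).image fun e => timed n e a

/-- The members of `F` in space-time that start in a member through `s`. -/
def nbrs (n : ℕ) (F : Finset (Finset ℕ)) (s : ℕ) : Finset (Finset ℕ) :=
  (through n F s).biUnion fun T => T.biUnion (starting n F)

section

variable {n k Δ : ℕ} {F : Finset (Finset ℕ)}

theorem IsBounded.mono (hF : IsBounded n k Δ F) {G : Finset (Finset ℕ)} (h : G ⊆ F) :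
    IsBounded n k Δ G :=
  ⟨fun e he => hF.lt e (h he), fun e he => hF.card e (h he),
    fun x => (card_le_card (filter_subset_filter _ h)).trans (hF.degree x)⟩

theorem IsBounded.card_starting (hF : IsBounded n k Δ F) (a : ℕ) : (starting n F a).card ≤ Δ :=
  card_image_le.trans (hF.degree _)

theorem IsBounded.card_of_mem_starting (hF : IsBounded n k Δ F) {a : ℕ} {c : Finset ℕ}
    (hc : c ∈ starting n F a) : c.card = k := by
  simp only [starting, mem_image, mem_filter] at hc
  obtain ⟨e, ⟨he, -⟩, rfl⟩ := hc
  rw [card_timed (hF.lt e he), hF.card e he]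

theorem IsBounded.card_of_mem_through (hF : IsBounded n k Δ F) {a : ℕ} {c : Finset ℕ}
    (hc : c ∈ through n F a) : c.card = k := by
  simp only [through, mem_biUnion, mem_image, mem_filter] at hc
  obtain ⟨e, ⟨he, -⟩, x, -, rfl⟩ := hc
  rw [card_timed (hF.lt e he), hF.card e he]

theorem IsBounded.card_through (hF : IsBounded n k Δ F) (s : ℕ) :
    (through n F s).card ≤ Δ * k :=
  (card_biUnion_le_card_mul _ _ k fun f hf =>
    card_image_le.trans (hF.card f (mem_filter.1 hf).1).le).trans
      (Nat.mul_le_mul_right _ (hF.degree _))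

/-- At most `Δ * k` members pass through `s`, each has `k` ages, and at most `Δ` members start at
each age. Summed over the `k` elements of a set this gives the branching number `k ^ 3 * Δ ^ 2`. -/
theorem IsBounded.card_nbrs (hF : IsBounded n k Δ F) (s : ℕ) :
    (nbrs n F s).card ≤ Δ * k * (k * Δ) :=
  (card_biUnion_le_card_mul _ _ (k * Δ) fun T hT =>
    (card_biUnion_le_card_mul _ _ Δ fun a _ => hF.card_starting a).trans
      (by rw [hF.card_of_mem_through hT])).trans
      (Nat.mul_le_mul_right _ (hF.card_through s))

theorem IsBounded.card_of_mem_nbrs (hF : IsBounded n k Δ F) {s : ℕ} {c : Finset ℕ}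
    (hc : c ∈ nbrs n F s) : c.card = k := by
  simp only [nbrs, mem_biUnion] at hc
  obtain ⟨T, -, a, -, h⟩ := hc
  exact hF.card_of_mem_starting h

theorem IsBounded.mem_through (hF : IsBounded n k Δ F) {e : Finset ℕ} (he : e ∈ F) {a s : ℕ}
    (ha : a % n ∈ e) (hs : s ∈ timed n e a) : timed n e a ∈ through n F s := by
  obtain ⟨x, hx, rfl⟩ := mem_timed.1 hs
  have hxn := hF.lt e he x hx
  simp only [through, mem_biUnion, mem_image, mem_filter]
  exact ⟨e, ⟨he, by rwa [nextVisit_mod hxn]⟩, a % n, ha, by rw [prevVisit_nextVisit hxn]⟩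

end

/-! ### Large clusters are rare -/

/-- Among the sets `cs`, and the sets that `nb` adds for the elements of the sets that are chosen, one
can choose `M` sets contained in `r`, disjoint from each other and from `U`. -/
def HasLargeCluster (nb : ℕ → Finset (Finset ℕ)) (r : Finset ℕ) :
    ℕ → Finset ℕ → List (Finset ℕ) → Prop
  | 0, _, _ => True
  | _ + 1, _, [] => False
  | M + 1, U, c :: cs =>
    (Disjoint c U ∧ c ⊆ r ∧ HasLargeCluster nb r M (U ∪ c) ((c.biUnion nb).toList ++ cs)) ∨
      HasLargeCluster nb r (M + 1) U cs
termination_by M _ cs => (M, cs.length)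

/-- Each prescribed one among the coins costs a factor of two; this is the base case of the
recursive count below. -/
theorem card_superset_mul_le (N : ℕ) (U : Finset ℕ) :
    ((range N).powerset.filter (U ⊆ ·)).card * 2 ^ U.card ≤ 2 ^ N := by
  by_cases hU : U ⊆ range N
  · have h1 : ((range N).powerset.filter (U ⊆ ·)) ⊆ ((range N \ U).powerset).image (U ∪ ·) := by
      intro r hr
      simp only [mem_filter, mem_powerset] at hr
      refine mem_image.2 ⟨r \ U, mem_powerset.2 (sdiff_subset_sdiff hr.1 subset_rfl), ?_⟩
      exact union_sdiff_of_subset hr.2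
    calc _ ≤ ((range N \ U).powerset).card * 2 ^ U.card :=
          Nat.mul_le_mul_right _ ((card_le_card h1).trans card_image_le)
      _ = 2 ^ N := by
          rw [card_powerset, ← pow_add, card_sdiff_add_card_eq_card hU, card_range]
  · have : ((range N).powerset.filter (U ⊆ ·)) = ∅ := by
      refine filter_eq_empty_iff.2 fun r hr h => hU (h.trans (mem_powerset.1 hr))
    simp [this]

-- A union bound over all explorations, arranged as a recursion on the list. Every listed set
-- carries the weight `1 + x`: the `1` pays for skipping it, the `x` for choosing it. Choosing it
-- fixes `k` new coins (a gain of `2 ^ k`), lists at most `d` further sets (a factor `(1 + x) ^ d`)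
-- and uses up one factor `y`; `hxy` says that `x` covers this.
open Classical in
theorem card_hasLargeCluster_le {nb : ℕ → Finset (Finset ℕ)} {k d N : ℕ} {x y : ℝ} (hx : 0 ≤ x)
    (hy : 0 ≤ y) (hxy : y * (1 + x) ^ d ≤ x * 2 ^ k) (hnb : ∀ s, ∀ c ∈ nb s, c.card = k)
    (hd : ∀ c : Finset ℕ, c.card = k → (c.biUnion nb).card ≤ d) :
    ∀ (M : ℕ) (U : Finset ℕ) (cs : List (Finset ℕ)), (∀ c ∈ cs, c.card = k) →
      (((range N).powerset.filter fun r => U ⊆ r ∧ HasLargeCluster nb r M U cs).card : ℝ) *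
        2 ^ U.card * y ^ M ≤ 2 ^ N * (1 + x) ^ cs.length
  | 0, U, cs, _ => by
    have h1 : (1 : ℝ) ≤ (1 + x) ^ cs.length := one_le_pow₀ (by linarith)
    have h2 := card_superset_mul_le N U
    have h3 : (((range N).powerset.filter (U ⊆ ·)).card : ℝ) * 2 ^ U.card ≤ 2 ^ N := by
      exact_mod_cast h2
    simp only [HasLargeCluster, and_true, pow_zero, mul_one]
    exact h3.trans (le_mul_of_one_le_right (by positivity) h1)
  | M + 1, U, [], _ => by
    simp [HasLargeCluster]
  | M + 1, U, c :: cs, hcs => by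
    have hc : c.card = k := hcs c (by simp)
    have ih2 := card_hasLargeCluster_le hx hy hxy hnb hd (N := N) (M + 1) U cs
      fun c' hc' => hcs c' (by simp [hc'])
    set A := (range N).powerset.filter fun r => U ⊆ r ∧ HasLargeCluster nb r (M + 1) U cs
    have hx1 : (1 : ℝ) ≤ 1 + x := by linarith
    have key : (((range N).powerset.filter fun r =>
        U ⊆ r ∧ HasLargeCluster nb r (M + 1) U (c :: cs)).card : ℝ) * 2 ^ U.card * y ^ (M + 1)
        ≤ 2 ^ N * (x * (1 + x) ^ cs.length) + A.card * 2 ^ U.card * y ^ (M + 1) := by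
      by_cases hdis : Disjoint c U
      · have ih1 := card_hasLargeCluster_le hx hy hxy hnb hd (N := N) M (U ∪ c)
          ((c.biUnion nb).toList ++ cs) (by
            intro c' hc'
            rcases List.mem_append.1 hc' with h | h
            · obtain ⟨s, -, h⟩ := mem_biUnion.1 (mem_toList.1 h)
              exact hnb s c' h
            · exact hcs c' (by simp [h]))
        set B := (range N).powerset.filter fun r =>
          U ∪ c ⊆ r ∧ HasLargeCluster nb r M (U ∪ c) ((c.biUnion nb).toList ++ cs)
        have hsub : ((range N).powerset.filter fun r =>
            U ⊆ r ∧ HasLargeCluster nb r (M + 1) U (c :: cs)) ⊆ B ∪ A := by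
          intro r hr
          simp only [mem_filter, HasLargeCluster] at hr
          obtain ⟨h0, hU, ⟨-, h2, h3⟩ | h2⟩ := hr
          · exact mem_union_left _ (mem_filter.2 ⟨h0, union_subset hU h2, h3⟩)
          · exact mem_union_right _ (mem_filter.2 ⟨h0, hU, h2⟩)
        have hcard : (((range N).powerset.filter fun r =>
            U ⊆ r ∧ HasLargeCluster nb r (M + 1) U (c :: cs)).card : ℝ) ≤ B.card + A.card := by
          exact_mod_cast (card_le_card hsub).trans (card_union_le _ _)
        rw [card_union_of_disjoint hdis.symm, hc, List.length_append, length_toList] at ih1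
        have h1 : (1 + x) ^ ((c.biUnion nb).card + cs.length) ≤ (1 + x) ^ (d + cs.length) :=
          pow_le_pow_right₀ hx1 (by have := hd c hc; omega)
        have h2 : ((B.card : ℝ) * 2 ^ U.card * y ^ (M + 1)) * 2 ^ k ≤
            2 ^ N * (x * (1 + x) ^ cs.length) * 2 ^ k := by
          calc ((B.card : ℝ) * 2 ^ U.card * y ^ (M + 1)) * 2 ^ k
              = y * (B.card * 2 ^ (U.card + k) * y ^ M) := by rw [pow_add, pow_succ]; ring
            _ ≤ y * (2 ^ N * (1 + x) ^ (d + cs.length)) :=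
                mul_le_mul_of_nonneg_left (ih1.trans
                  (mul_le_mul_of_nonneg_left h1 (by positivity))) hy
            _ = 2 ^ N * (1 + x) ^ cs.length * (y * (1 + x) ^ d) := by rw [pow_add]; ring
            _ ≤ 2 ^ N * (1 + x) ^ cs.length * (x * 2 ^ k) :=
                mul_le_mul_of_nonneg_left hxy (by positivity)
            _ = _ := by ring
        have h3 := le_of_mul_le_mul_right h2 (by positivity)
        calc _ ≤ ((B.card : ℝ) + A.card) * 2 ^ U.card * y ^ (M + 1) := by gcongr
          _ = (B.card : ℝ) * 2 ^ U.card * y ^ (M + 1) + A.card * 2 ^ U.card * y ^ (M + 1) := by ring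
          _ ≤ _ := by gcongr
      · have hsub : ((range N).powerset.filter fun r =>
            U ⊆ r ∧ HasLargeCluster nb r (M + 1) U (c :: cs)) ⊆ A := by
          intro r hr
          simp only [mem_filter, HasLargeCluster] at hr
          obtain ⟨h0, hU, ⟨h1, -, -⟩ | h2⟩ := hr
          · exact absurd h1 hdis
          · exact mem_filter.2 ⟨h0, hU, h2⟩
        calc _ ≤ (A.card : ℝ) * 2 ^ U.card * y ^ (M + 1) := by gcongr
          _ ≤ _ := le_add_of_nonneg_left (by positivity)
    refine key.trans ((add_le_add le_rfl ih2).trans_eq ?_)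
    rw [List.length_cons]
    ring
termination_by M _ cs _ => (M, cs.length)

/-- Explore greedily, choosing every admissible set. Without a large cluster fewer than `M` sets get
chosen, and `V` is their union with `U`. A listed set inside `r` that was skipped must have met the
union at that moment. -/
theorem exists_dominating {nb : ℕ → Finset (Finset ℕ)} {k : ℕ} {r : Finset ℕ} (hk : 0 < k)
    (hnb : ∀ s, ∀ c ∈ nb s, c.card = k) :
    ∀ (M : ℕ) (U : Finset ℕ) (cs : List (Finset ℕ)), (∀ c ∈ cs, c.card = k) →
      ¬ HasLargeCluster nb r M U cs →
      ∃ V : Finset ℕ, U ⊆ V ∧ V.card ≤ U.card + k * M ∧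
        (∀ c ∈ cs, c ⊆ r → ¬ Disjoint c V) ∧
        ∀ s ∈ V, s ∉ U → ∀ c ∈ nb s, c ⊆ r → ¬ Disjoint c V
  | 0, U, cs, _, h => by simp [HasLargeCluster] at h
  | M + 1, U, [], _, _ => ⟨U, subset_rfl, by omega, by simp, fun s hs h => absurd hs h⟩
  | M + 1, U, c :: cs, hcs, h => by
    have hc : c.card = k := hcs c (by simp)
    simp only [HasLargeCluster, not_or, not_and] at h
    by_cases hcr : Disjoint c U ∧ c ⊆ r
    · obtain ⟨V, hUV, hcard, h1, h2⟩ := exists_dominating hk hnb M (U ∪ c)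
        ((c.biUnion nb).toList ++ cs) (by
          intro c' hc'
          rcases List.mem_append.1 hc' with h | h
          · obtain ⟨s, -, h⟩ := mem_biUnion.1 (mem_toList.1 h)
            exact hnb s c' h
          · exact hcs c' (by simp [h])) (h.1 hcr.1 hcr.2)
      have hcV : c ⊆ V := subset_union_right.trans hUV
      refine ⟨V, subset_union_left.trans hUV, ?_, ?_, ?_⟩
      · have := card_union_le U c
        rw [hc] at this
        rw [mul_add, mul_one]
        omega
      · intro c' hc' hr hdis
        rcases List.mem_cons.1 hc' with rfl | hc'
        -- The chosen set lies in `V`, so it could only be disjoint from `V` if it were empty, which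
        -- `hk` excludes.
        · have : c' = ∅ := by simpa using hdis.mono_right hcV
          simp [this] at hc
          omega
        · exact h1 c' (by simp [hc']) hr hdis
      · intro s hs hsU c' hc' hr
        by_cases hsc : s ∈ c
        · exact h1 c' (by simp only [List.mem_append, mem_toList, mem_biUnion]
                          exact Or.inl ⟨s, hsc, hc'⟩) hr
        · exact h2 s hs (by simp [hsU, hsc]) c' hc' hr
    · obtain ⟨V, hUV, hcard, h1, h2⟩ := exists_dominating hk hnb (M + 1) U cs
        (fun c' hc' => hcs c' (by simp [hc'])) h.2
      refine ⟨V, hUV, hcard, ?_, h2⟩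
      intro c' hc' hr hdis
      rcases List.mem_cons.1 hc' with rfl | hc'
      · exact hcr ⟨hdis.mono_right hUV, hr⟩
      · exact h1 c' hc' hr hdis
termination_by M _ cs _ _ => (M, cs.length)

end HypergraphFPTAS

namespace HypergraphFPTAS

open Finset

/-! ### Iteration that counts down -/

/-- `step 0 (step 1 (… (step (j - 1) x)))`. -/
def down {α : Type*} (step : ℕ → α → α) : ℕ → α → α
  | 0, x => x
  | j + 1, x => down step j (step j x)

theorem down_induction {α : Type*} {step : ℕ → α → α} (P : ℕ → α → Prop) :
    ∀ (N : ℕ) (x : α), P N x → (∀ j < N, ∀ x, P (j + 1) x → P j (step j x)) → P 0 (down step N x)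
  | 0, _, h, _ => h
  | N + 1, x, h, hs =>
    down_induction P N (step N x) (hs N (Nat.lt_succ_self _) x h) fun j hj => hs j (by omega)

theorem down_congr {α : Type*} {step step' : ℕ → α → α} :
    ∀ (N : ℕ) (x : α), (∀ j < N, step j = step' j) → down step N x = down step' N x
  | 0, _, _ => rfl
  | N + 1, x, h => by
    rw [down, down, h N (Nat.lt_succ_self _)]
    exact down_congr N _ fun j hj => h j (by omega)

/-! ### Independent sets and the Glauber dynamics -/

section

variable {n : ℕ} {F : Finset (Finset ℕ)}

/-- The independent subsets of `{0, …, n - 1}`. -/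
def indep (n : ℕ) (F : Finset (Finset ℕ)) : Finset (Finset ℕ) :=
  (range n).powerset.filter fun S => ∀ e ∈ F, ¬ e ⊆ S

theorem mem_indep {S : Finset ℕ} : S ∈ indep n F ↔ S ⊆ range n ∧ ∀ e ∈ F, ¬ e ⊆ S := by
  simp [indep]

/-- The update of the vertex `v` with a fair coin. -/
def glauber (F : Finset (Finset ℕ)) (v : ℕ) (coin : Prop) [Decidable coin] (S : Finset ℕ) :
    Finset ℕ :=
  if coin ∧ ∀ e ∈ F, ¬ e ⊆ insert v S then insert v S else S.erase v

theorem mem_glauber_of_ne {v u : ℕ} (h : u ≠ v) (coin : Prop) [Decidable coin] (S : Finset ℕ) :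
    u ∈ glauber F v coin S ↔ u ∈ S := by
  unfold glauber
  split_ifs <;> simp [h]

theorem mem_glauber_self {v : ℕ} {coin : Prop} [Decidable coin] {S : Finset ℕ} :
    v ∈ glauber F v coin S ↔ coin ∧ ∀ e ∈ F, ¬ e ⊆ insert v S := by
  unfold glauber
  split_ifs with h
  · simp only [mem_insert_self, true_iff]
    exact h
  · simpa using h

theorem erase_mem_indep {S : Finset ℕ} (hS : S ∈ indep n F) (v : ℕ) : S.erase v ∈ indep n F := by
  rw [mem_indep] at hS ⊢
  exact ⟨(erase_subset _ _).trans hS.1, fun e he h => hS.2 e he (h.trans (erase_subset _ _))⟩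

theorem insert_mem_indep_iff {v : ℕ} (hv : v < n) {S : Finset ℕ} (hS : S ∈ indep n F) :
    insert v S ∈ indep n F ↔ ∀ e ∈ F, ¬ e ⊆ insert v S := by
  rw [mem_indep] at hS ⊢
  simp [insert_subset_iff, hv, hS.1]

/-- Toggling `v` whenever the result is independent is an involution of the independent sets. For
each `S` the two outcomes of the coin are, in some order, `S` and its toggled version. -/
theorem sum_glauber {v : ℕ} (hv : v < n) (g : Finset ℕ → ℕ) :
    ∑ S ∈ indep n F, (g (glauber F v False S) + g (glauber F v True S)) =
      2 * ∑ S ∈ indep n F, g S := by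
  let flip : Finset ℕ → Finset ℕ := fun S =>
    if v ∈ S then S.erase v else if insert v S ∈ indep n F then insert v S else S
  have hflip : ∀ S ∈ indep n F, flip S ∈ indep n F := by
    intro S hS
    simp only [flip]
    split_ifs with h1 h2
    exacts [erase_mem_indep hS v, h2, hS]
  have hinv : ∀ S ∈ indep n F, flip (flip S) = S := by
    intro S hS
    by_cases h1 : v ∈ S
    · simp [flip, h1, insert_erase h1, hS]
    · by_cases h2 : insert v S ∈ indep n F
      · simp [flip, h1, h2]
      · simp [flip, h1, h2]
  have h1 : ∑ S ∈ indep n F, g (flip S) = ∑ S ∈ indep n F, g S :=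
    sum_bij' (fun S _ => flip S) (fun S _ => flip S) hflip hflip hinv hinv fun _ _ => rfl
  rw [two_mul]
  nth_rewrite 2 [← h1]
  rw [← sum_add_distrib]
  refine sum_congr rfl fun S hS => ?_
  have h0 : glauber F v False S = S.erase v := by simp [glauber]
  rw [h0]
  by_cases hvS : v ∈ S
  · have : glauber F v True S = S := by
      have := (mem_indep.1 hS).2
      simp [glauber, insert_eq_of_mem hvS]
      intro e he h
      exact absurd h (this e he)
    rw [this, add_comm]
    simp [flip, hvS]
  · rw [erase_eq_of_notMem hvS]
    congr 2
    simp only [glauber, flip, hvS, if_false, true_and, insert_mem_indep_iff hv hS,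
      erase_eq_of_notMem hvS]

/-- The systematic scan from age `N` down to age `0`, with the coins `r`. -/
def scan (n : ℕ) (F : Finset (Finset ℕ)) (r : Finset ℕ) (N : ℕ) (S : Finset ℕ) : Finset ℕ :=
  down (fun a => glauber F (a % n) (a ∈ r)) N S

theorem scan_insert (r : Finset ℕ) (N : ℕ) (S : Finset ℕ) :
    scan n F (insert N r) N S = scan n F r N S := by
  refine down_congr N S fun j hj => ?_
  have : (j ∈ insert N r) = (j ∈ r) := by
    simp [mem_insert, hj.ne]
  funext S
  simp only [glauber, this]

/-- The earliest update is split off: for fixed later coins, the rest of the scan followed by `g` is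
just another test function, to which `sum_glauber` applies. -/
theorem sum_scan (hn : 0 < n) (g : Finset ℕ → ℕ) : ∀ N,
    ∑ r ∈ (range N).powerset, ∑ S ∈ indep n F, g (scan n F r N S) =
      2 ^ N * ∑ S ∈ indep n F, g S
  | 0 => by simp [scan, down]
  | N + 1 => by
    rw [range_add_one, sum_powerset_insert notMem_range_self, ← sum_add_distrib]
    calc _ = ∑ r ∈ (range N).powerset, ∑ S ∈ indep n F,
          (g (scan n F r N (glauber F (N % n) False S)) +
            g (scan n F r N (glauber F (N % n) True S))) := by
          refine sum_congr rfl fun r hr => ?_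
          rw [← sum_add_distrib]
          have hN : N ∉ r := fun h => notMem_range_self (mem_powerset.1 hr h)
          refine sum_congr rfl fun S _ => ?_
          have h1 : scan n F r (N + 1) S = scan n F r N (glauber F (N % n) False S) := by
            simp only [scan, down, glauber, hN]
          have h2 : scan n F (insert N r) (N + 1) S = scan n F r N (glauber F (N % n) True S) := by
            rw [← scan_insert r]
            simp only [scan, down, glauber, mem_insert_self]
          rw [h1, h2]
      _ = ∑ r ∈ (range N).powerset, 2 * ∑ S ∈ indep n F, g (scan n F r N S) :=
          sum_congr rfl fun r _ => sum_glauber (Nat.mod_lt _ hn) fun S => g (scan n F r N S)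
      _ = _ := by rw [← mul_sum, sum_scan hn g N]; ring

/-! ### The hypergraph that remains when small vertices are removed -/

/-- The hyperedges without vertices below `i`. -/
def above (F : Finset (Finset ℕ)) (i : ℕ) : Finset (Finset ℕ) := F.filter fun e => ∀ x ∈ e, i ≤ x

theorem above_zero : above F 0 = F := by simp [above]

theorem above_eq_empty (hF : ∀ e ∈ F, ∀ x ∈ e, x < n) (hne : ∅ ∉ F) : above F n = ∅ := by
  refine filter_eq_empty_iff.2 fun e he h => ?_
  obtain ⟨x, hx⟩ : e.Nonempty := nonempty_iff_ne_empty.2 fun h => hne (h ▸ he)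
  have := hF e he x hx
  have := h x hx
  omega

theorem card_indep_empty : (indep n ∅).card = 2 ^ n := by
  simp [indep]

/-- For sets that avoid `i`, the hyperedges with least vertex `i` impose nothing, so both families
give the same sets. Without those hyperedges `i` is a free vertex, hence the factor two. -/
theorem card_indep_above_succ {i : ℕ} (hi : i < n) :
    (indep n (above F (i + 1))).card = 2 * ((indep n (above F i)).filter (i ∉ ·)).card := by
  set A := (indep n (above F i)).filter (i ∉ ·)
  have hA : ∀ S, S ∈ A ↔ S ∈ indep n (above F (i + 1)) ∧ i ∉ S := by
    intro S
    simp only [A, mem_filter, mem_indep, above, and_assoc, and_congr_right_iff]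
    intro _
    constructor
    · rintro ⟨h1, h2⟩
      exact ⟨fun e he => h1 e ⟨he.1, fun x hx => (Nat.le_succ i).trans (he.2 x hx)⟩, h2⟩
    · rintro ⟨h1, h2⟩
      refine ⟨fun e he h => h1 e ⟨he.1, fun x hx => ?_⟩ h, h2⟩
      have : x ≠ i := fun hxi => h2 (hxi ▸ h hx)
      have := he.2 x hx
      omega
  have hB : indep n (above F (i + 1)) = A ∪ A.image (insert i) := by
    ext S
    simp only [mem_union, mem_image, hA]
    constructor
    · intro hS
      by_cases h : i ∈ S
      · exact Or.inr ⟨S.erase i, ⟨erase_mem_indep hS i, by simp⟩, insert_erase h⟩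
      · exact Or.inl ⟨hS, h⟩
    · rintro (h | ⟨S, ⟨hS, -⟩, rfl⟩)
      · exact h.1
      · refine (insert_mem_indep_iff hi hS).2 fun e he h => (mem_indep.1 hS).2 e he ?_
        refine (subset_insert_iff_of_notMem fun hie => ?_).1 h
        have := (mem_filter.1 he).2 i hie
        omega
  have hdis : Disjoint A (A.image (insert i)) := by
    rw [disjoint_left]
    rintro S hS h
    obtain ⟨T, -, rfl⟩ := mem_image.1 h
    exact ((hA _).1 hS).2 (mem_insert_self _ _)
  rw [hB, card_union_of_disjoint hdis, card_image_of_injOn, two_mul]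
  intro S hS T hT h
  rw [← erase_insert ((hA S).1 hS).2, ← erase_insert ((hA T).1 hT).2]
  exact congrArg (·.erase i) h

/-- Removing `v` is injective on the independent sets that contain it. Thus the probability that `v`
is absent is at least one half, which later turns additive errors into relative ones. -/
theorem card_indep_le {v : ℕ} : (indep n F).card ≤ 2 * ((indep n F).filter (v ∉ ·)).card := by
  have h1 := card_filter_add_card_filter_not (s := indep n F) (v ∉ ·)
  have h2 : ((indep n F).filter (¬ v ∉ ·)).card ≤ ((indep n F).filter (v ∉ ·)).card := by
    refine card_le_card_of_injOn (fun S => S.erase v) ?_ ?_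
    · intro S hS
      simp only [coe_filter, Set.mem_ofPred_eq] at hS ⊢
      exact ⟨erase_mem_indep hS.1 v, by simp⟩
    · intro S hS T hT h
      simp only [coe_filter, Set.mem_ofPred_eq, not_not] at hS hT
      rw [← insert_erase hS.2, ← insert_erase hT.2]
      exact congrArg (insert v) h
  omega

end

end HypergraphFPTAS

namespace HypergraphFPTAS

open Finset

/-! ### Evaluating the dynamics with partially revealed coins -/

/-- `σ a` tells the coin of age `a`: unknown (`0`), zero (`1`) or one (`2`). Then `X a` tells the value
that the update of age `a` produces: unknown together with the coin (`0`), zero (`1`), one (`2`), or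
unknown although the coin is one (`3`). If the value is unknown, `Q a` is the age of an unknown coin
on which it depends. -/
structure IsTable (n B : ℕ) (F : Finset (Finset ℕ)) (σ X Q : ℕ → ℕ) : Prop where
  unset : ∀ a < B, σ a = 0 → X a = 0 ∧ Q a = a
  zero : ∀ a < B, σ a = 1 → X a = 1
  one : ∀ a < B, σ a = 2 →
    (X a = 1 ∧ ∃ e ∈ F, a % n ∈ e ∧ ∀ x ∈ e, x ≠ a % n → X (nextVisit n x a) = 2) ∨
    (X a = 2 ∧ ∀ e ∈ F, a % n ∈ e → ∃ x ∈ e, x ≠ a % n ∧ X (nextVisit n x a) = 1) ∨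
    (X a = 3 ∧ ∃ e ∈ F, a % n ∈ e ∧ (∀ x ∈ e, x ≠ a % n → X (nextVisit n x a) ≠ 1) ∧
      ((∃ x ∈ e, x ≠ a % n ∧ X (nextVisit n x a) = 0 ∧ Q a = nextVisit n x a) ∨
        ((∀ x ∈ e, x ≠ a % n → X (nextVisit n x a) ≠ 0) ∧
          ∃ x ∈ e, x ≠ a % n ∧ X (nextVisit n x a) = 3 ∧ Q a = Q (nextVisit n x a))))

/-- The coins at the ages in `D` are known, and no others. -/
structure IsPartial (N : ℕ) (D : Finset ℕ) (σ : ℕ → ℕ) : Prop where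
  mem_iff : ∀ a, a ∈ D ↔ σ a ≠ 0
  lt : ∀ a ∈ D, a < N
  le : ∀ a, σ a ≤ 2

/-- The coins `r` are as `σ` tells. -/
def Agree (r : Finset ℕ) (σ : ℕ → ℕ) : Prop := ∀ a, (σ a = 1 → a ∉ r) ∧ (σ a = 2 → a ∈ r)

section

variable {n N k Δ : ℕ} {F : Finset (Finset ℕ)} {D r K Y : Finset ℕ} {σ X Q : ℕ → ℕ}

theorem IsTable.value_lt (hT : IsTable n (N + n) F σ X Q) (hσ : IsPartial N D σ) {a : ℕ}
    (ha : a < N + n) : (X a = 0 ∧ Q a = a ∧ σ a = 0) ∨ (X a = 1 ∧ σ a ≠ 0) ∨ (X a = 2 ∧ σ a = 2) ∨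
      (X a = 3 ∧ σ a = 2) := by
  have h2 := hσ.le a
  have h : σ a = 0 ∨ σ a = 1 ∨ σ a = 2 := by omega
  rcases h with h | h | h
  · exact Or.inl ⟨(hT.unset a ha h).1, (hT.unset a ha h).2, h⟩
  · exact Or.inr (Or.inl ⟨hT.zero a ha h, by omega⟩)
  · rcases hT.one a ha h with h' | h' | h'
    · exact Or.inr (Or.inl ⟨h'.1, by omega⟩)
    · exact Or.inr (Or.inr (Or.inl ⟨h'.1, h⟩))
    · exact Or.inr (Or.inr (Or.inr ⟨h'.1, h⟩))

theorem IsTable.nextVisit_lt (hT : IsTable n (N + n) F σ X Q) (hσ : IsPartial N D σ) (hn : 0 < n)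
    {a : ℕ} (ha : a < N + n) (h : X a = 3) (x : ℕ) : a ∈ D ∧ nextVisit n x a < N + n := by
  have h1 : σ a ≠ 0 := by
    rcases hT.value_lt hσ ha with h' | h' | h' | h' <;> omega
  have h2 := (hσ.mem_iff a).2 h1
  have := hσ.lt a h2
  have := HypergraphFPTAS.nextVisit_lt hn x a
  exact ⟨h2, by omega⟩

/-- A query is inherited along a chain of entries with value `3`. Each link moves less than `n` ages
into the past and leaves from a known coin, so the length of the chain is limited by the number of
known coins. -/
theorem IsTable.query_spec (hT : IsTable n (N + n) F σ X Q) (hσ : IsPartial N D σ) (hn : 0 < n)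
    (hF : ∀ e ∈ F, ∀ x ∈ e, x < n) :
    ∀ a < N + n, X a = 0 ∨ X a = 3 →
      σ (Q a) = 0 ∧ Q a < a + n * (1 + (D.filter (a ≤ ·)).card) := by
  intro a
  induction' hm : N + n - a using Nat.strong_induction_on with m ih generalizing a
  intro ha hX
  rcases hT.value_lt hσ ha with h | h | h | h
  · rw [h.2.1]
    refine ⟨h.2.2, ?_⟩
    have : 0 < n * (1 + (D.filter (a ≤ ·)).card) := by positivity
    omega
  · omega
  · omega
  have hσa := h.2
  obtain ⟨haD, hlt⟩ := hT.nextVisit_lt hσ hn ha h.1 0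
  rcases hT.one a ha hσa with h' | h' | ⟨-, e, he, -, -, h1 | h1⟩
  · omega
  · omega
  · obtain ⟨x, hx, hxa, hx0, hQ⟩ := h1
    have hb := (hT.nextVisit_lt hσ hn ha h.1 x).2
    rw [hQ]
    refine ⟨?_, ?_⟩
    · rcases hT.value_lt hσ hb with h | h | h | h <;> omega
    · have := HypergraphFPTAS.nextVisit_lt hn x a
      have h2 : n * 1 ≤ n * (1 + (D.filter (a ≤ ·)).card) := Nat.mul_le_mul_left _ (by omega)
      omega
  · obtain ⟨-, x, hx, hxa, hx3, hQ⟩ := h1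
    have hb := (hT.nextVisit_lt hσ hn ha h.1 x).2
    have hab := lt_nextVisit (hF e he x hx) hxa
    obtain ⟨h2, h3⟩ := ih (N + n - nextVisit n x a) (by omega) _ rfl hb (Or.inr hx3)
    rw [hQ]
    refine ⟨h2, h3.trans_le ?_⟩
    have h4 : (D.filter (nextVisit n x a ≤ ·)).card + 1 ≤ (D.filter (a ≤ ·)).card := by
      rw [Nat.succ_le_iff]
      refine card_lt_card ⟨fun b hb => ?_, fun h => ?_⟩
      · simp only [mem_filter] at hb ⊢
        exact ⟨hb.1, hab.le.trans hb.2⟩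
      · have := (mem_filter.1 (h (mem_filter.2 ⟨haD, le_rfl⟩))).2
        omega
    have h5 := HypergraphFPTAS.nextVisit_lt hn x a
    have h6 : n * (1 + (D.filter (nextVisit n x a ≤ ·)).card) ≤ n * (D.filter (a ≤ ·)).card :=
      Nat.mul_le_mul_left _ (by omega)
    have h7 : n * (1 + (D.filter (a ≤ ·)).card) = n + n * (D.filter (a ≤ ·)).card := by ring
    omega

/-- Unknown coins in a hyperedge are asked for before queries are inherited. A chain therefore
crosses only hyperedges whose coins are all one and so stays in `K`; only its last link may use
another hyperedge, which is still covered by `Y`. -/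
theorem IsTable.query_mem (hT : IsTable n (N + n) F σ X Q) (hσ : IsPartial N D σ) (hn : 0 < n)
    (hF : ∀ e ∈ F, ∀ x ∈ e, x < n) (hr : Agree r σ)
    (hK : ∀ a ∈ K, ∀ e ∈ F, a % n ∈ e → timed n e a ⊆ r → timed n e a ⊆ K)
    (hY : ∀ a ∈ K, ∀ e ∈ F, a % n ∈ e → timed n e a ⊆ Y) :
    ∀ a < N + n, a ∈ K → X a = 0 ∨ X a = 3 → Q a = a ∨ Q a ∈ Y := by
  intro a
  induction' hm : N + n - a using Nat.strong_induction_on with m ih generalizing a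
  intro ha haK hX
  rcases hT.value_lt hσ ha with h | h | h | h
  · exact Or.inl h.2.1
  · omega
  · omega
  refine Or.inr ?_
  have hσa := h.2
  rcases hT.one a ha hσa with h' | h' | ⟨-, e, he, hae, hne, h1 | h1⟩
  · omega
  · omega
  · obtain ⟨x, hx, hxa, hx0, hQ⟩ := h1
    exact hQ ▸ hY a haK e he hae (mem_timed.2 ⟨x, hx, rfl⟩)
  · obtain ⟨h0, x, hx, hxa, hx3, hQ⟩ := h1
    have hb := (hT.nextVisit_lt hσ hn ha h.1 x).2
    have hab := lt_nextVisit (hF e he x hx) hxa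
    have hmem : nextVisit n x a ∈ timed n e a := mem_timed.2 ⟨x, hx, rfl⟩
    -- In this branch no other entry of `e` is `0` or `1`. Entries `2` and `3` both require that the
    -- coin is known to be one.
    have hsub : timed n e a ⊆ r := by
      intro s hs
      obtain ⟨y, hy, rfl⟩ := mem_timed.1 hs
      by_cases hya : y = a % n
      · rw [hya, nextVisit_self hn]
        exact (hr a).2 hσa
      · have h3 := hne y hy hya
        have h4 := h0 y hy hya
        have hb := (hT.nextVisit_lt hσ hn ha h.1 y).2
        refine (hr _).2 ?_
        rcases hT.value_lt hσ hb with h | h | h | h <;> omega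
    rcases ih (N + n - nextVisit n x a) (by omega) _ rfl hb (hK a haK e he hae hsub hmem)
      (Or.inr hx3) with h2 | h2
    · rw [hQ, h2]
      exact hY a haK e he hae hmem
    · rwa [hQ]

/-- Induction from the oldest update to the newest. The set reached just after the update of age `a`
agrees with the table at the latest update of every vertex, and it stays independent, so that only
hyperedges through the updated vertex can block it. -/
theorem IsTable.sound (hT : IsTable n (N + n) F σ X Q) (hσ : IsPartial N D σ) (hn : 0 < n)
    (hF : ∀ e ∈ F, ∀ x ∈ e, x < n) (hr : Agree r σ) {S : Finset ℕ} (hS₀ : S ∈ indep n F)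
    {v : ℕ} (hv : v < n) :
    (X v = 1 → v ∉ scan n F r N S) ∧ (X v = 2 → v ∈ scan n F r N S) := by
  have key := down_induction (step := fun a => glauber F (a % n) (a ∈ r))
    (fun a S => a ≤ N ∧ (∀ e ∈ F, ¬ e ⊆ S) ∧
      ∀ x < n, (X (nextVisit n x a) = 1 → x ∉ S) ∧ (X (nextVisit n x a) = 2 → x ∈ S))
    N S ?_ ?_
  · have := key.2.2 v hv
    rwa [nextVisit_zero hv] at this
  -- Before the first update nothing is claimed: no coin of age `N` or more is known, so all these
  -- entries are `0`.
  · refine ⟨le_rfl, (mem_indep.1 hS₀).2, fun x hx => ?_⟩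
    have h1 := le_nextVisit n x N
    have h2 := HypergraphFPTAS.nextVisit_lt hn x N
    have h3 : σ (nextVisit n x N) = 0 := by
      by_contra h
      have := hσ.lt _ ((hσ.mem_iff _).2 h)
      omega
    have := (hT.unset _ (by omega) h3).1
    omega
  · rintro a haN S ⟨-, hind, hS⟩
    refine ⟨haN.le, fun e he h => ?_, fun x hx => ?_⟩
    · unfold glauber at h
      split_ifs at h with h'
      · exact h'.2 e he h
      · exact hind e he (h.trans (erase_subset _ _))
    by_cases hxa : x = a % n
    · have hmem : ∀ e ∈ F, a % n ∈ e →
          (e ⊆ insert (a % n) S ↔ ∀ y ∈ e, y ≠ a % n → y ∈ S) := by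
        intro e _ _
        constructor
        · intro h y hy hya
          exact mem_of_mem_insert_of_ne (h hy) hya
        · intro h y hy
          by_cases hya : y = a % n
          · simp [hya]
          · exact mem_insert_of_mem (h y hy hya)
      have hnext : ∀ e ∈ F, ∀ y ∈ e, y ≠ a % n →
          (X (nextVisit n y a) = 1 → y ∉ S) ∧ (X (nextVisit n y a) = 2 → y ∈ S) := by
        intro e he y hy hya
        have := hS y (hF e he y hy)
        rwa [nextVisit_succ (hF e he y hy) hya] at this
      subst hxa
      rw [nextVisit_self hn, mem_glauber_self]
      rcases hT.value_lt hσ (by omega : a < N + n) with h | h | h | h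
      · omega
      · refine ⟨fun _ ⟨har, hall⟩ => ?_, by omega⟩
        have h2 : σ a = 2 := by
          have := hσ.le a
          have : σ a ≠ 1 := fun h => (hr a).1 h har
          omega
        rcases hT.one a (by omega) h2 with ⟨-, e, he, hae, h'⟩ | h' | h'
        · exact hall e he ((hmem e he hae).2 fun y hy hya => (hnext e he y hy hya).2 (h' y hy hya))
        · omega
        · omega
      · refine ⟨by omega, fun _ => ⟨(hr a).2 h.2, fun e he hsub => ?_⟩⟩
        have hae : a % n ∈ e ∨ a % n ∉ e := em _
        rcases hT.one a (by omega) h.2 with h' | ⟨-, h'⟩ | h'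
        · omega
        · rcases hae with hae | hae
          · obtain ⟨y, hy, hya, hy1⟩ := h' e he hae
            exact (hnext e he y hy hya).1 hy1 ((hmem e he hae).1 hsub y hy hya)
          · exact hind e he ((subset_insert_iff_of_notMem hae).1 hsub)
        · omega
      · omega
    · have := hS x hx
      rw [nextVisit_succ hx hxa] at this
      rwa [mem_glauber_of_ne hxa]

end

/-! ### Revealing the coins one by one -/

section

variable {n N k Δ : ℕ} {F : Finset (Finset ℕ)} {D r K Y : Finset ℕ} {σ : ℕ → ℕ}
  {T : (ℕ → ℕ) → (ℕ → ℕ) × (ℕ → ℕ)} {v : ℕ}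

/-- The value at `v` is not determined. -/
def Undetermined (T : (ℕ → ℕ) → (ℕ → ℕ) × (ℕ → ℕ)) (v : ℕ) (σ : ℕ → ℕ) : Prop :=
  (T σ).1 v = 0 ∨ (T σ).1 v = 3

instance : Decidable (Undetermined T v σ) := inferInstanceAs (Decidable (_ ∨ _))

/-- Reveal another coin, if the value at `v` is not determined. -/
def reveal (T : (ℕ → ℕ) → (ℕ → ℕ) × (ℕ → ℕ)) (v b : ℕ) (σ : ℕ → ℕ) : ℕ → ℕ :=
  if Undetermined T v σ then Function.update σ ((T σ).2 v) (1 + b) else σ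

/-- The coins are the binary digits of `s`. -/
def revealBits (T : (ℕ → ℕ) → (ℕ → ℕ) × (ℕ → ℕ)) (v : ℕ) : ℕ → ℕ → (ℕ → ℕ) → ℕ → ℕ
  | 0, _, σ => σ
  | L + 1, s, σ => revealBits T v L (s / 2) (reveal T v (s % 2) σ)

/-- The coins are those of `r`. -/
def revealCoins (T : (ℕ → ℕ) → (ℕ → ℕ) × (ℕ → ℕ)) (v : ℕ) (r : Finset ℕ) :
    ℕ → (ℕ → ℕ) → ℕ → ℕ
  | 0, σ => σ
  | L + 1, σ => revealCoins T v r L (reveal T v (if (T σ).2 v ∈ r then 1 else 0) σ)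

theorem revealBits_of_not (h : ¬ Undetermined T v σ) : ∀ L s, revealBits T v L s σ = σ
  | 0, _ => rfl
  | L + 1, s => by rw [revealBits, reveal, if_neg h, revealBits_of_not h L]

theorem revealCoins_of_not (h : ¬ Undetermined T v σ) : ∀ L, revealCoins T v r L σ = σ
  | 0 => rfl
  | L + 1 => by rw [revealCoins, reveal, if_neg h, revealCoins_of_not h L]

theorem IsPartial.update (hσ : IsPartial N D σ) {q b : ℕ} (hq : q < N) (hb : b < 2) :
    IsPartial N (insert q D) (Function.update σ q (1 + b)) := by
  refine ⟨fun a => ?_, fun a ha => ?_, fun a => ?_⟩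
  · by_cases h : a = q
    · simp [h]
    · simp [h, hσ.mem_iff]
  · rcases mem_insert.1 ha with rfl | ha
    exacts [hq, hσ.lt a ha]
  · by_cases h : a = q
    · simp [h]
      omega
    · simp [h, hσ.le]

theorem isPartial_zero (N : ℕ) : IsPartial N ∅ fun _ => 0 := ⟨by simp, by simp, by simp⟩

theorem agree_zero (r : Finset ℕ) : Agree r fun _ => 0 := by simp [Agree]

theorem agree_update {q : ℕ} (hq : σ q = 0) (r : Finset ℕ) :
    (Agree r (Function.update σ q 1) ↔ Agree r σ ∧ q ∉ r) ∧
      (Agree r (Function.update σ q 2) ↔ Agree r σ ∧ q ∈ r) := by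
  have key : ∀ b, Agree r (Function.update σ q b) ↔
      Agree r σ ∧ (b = 1 → q ∉ r) ∧ (b = 2 → q ∈ r) := by
    intro b
    constructor
    · intro h
      refine ⟨fun a => ?_, by simpa using h q⟩
      by_cases haq : a = q
      · simp [haq, hq]
      · simpa [haq] using h a
    · rintro ⟨h1, h2⟩ a
      by_cases haq : a = q
      · simpa [haq] using h2
      · simpa [haq] using h1 a
  exact ⟨by simp [key], by simp [key]⟩

open Classical in
/-- The coins that agree with `σ`. -/
noncomputable def agreeing (N : ℕ) (σ : ℕ → ℕ) : Finset (Finset ℕ) :=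
  (range N).powerset.filter (Agree · σ)

theorem mem_agreeing : r ∈ agreeing N σ ↔ r ⊆ range N ∧ Agree r σ := by simp [agreeing]

theorem agreeing_update {q : ℕ} (hq : σ q = 0) :
    agreeing N (Function.update σ q 1) = (agreeing N σ).filter (q ∉ ·) ∧
      agreeing N (Function.update σ q 2) = (agreeing N σ).filter (q ∈ ·) := by
  constructor <;> ext r <;> simp only [mem_agreeing, mem_filter, agree_update hq, and_assoc]

/-- An unrevealed coin is fair: toggling `q` matches the two ways to extend `σ`. -/
theorem card_agreeing_update {q : ℕ} (hqN : q < N) (hq : σ q = 0) :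
    2 * (agreeing N (Function.update σ q 1)).card = (agreeing N σ).card ∧
      2 * (agreeing N (Function.update σ q 2)).card = (agreeing N σ).card := by
  have h1 : (agreeing N (Function.update σ q 1)).card =
      (agreeing N (Function.update σ q 2)).card := by
    have hag : ∀ {r r' : Finset ℕ}, (∀ a, a ≠ q → (a ∈ r ↔ a ∈ r')) → Agree r σ → Agree r' σ := by
      intro r r' h hr a
      by_cases haq : a = q
      · simp [haq, hq]
      · rw [← h a haq]
        exact hr a
    refine card_bij' (fun r _ => insert q r) (fun r _ => r.erase q) ?_ ?_ ?_ ?_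
    · intro r hr
      rw [mem_agreeing, (agree_update hq r).1] at hr
      rw [mem_agreeing, (agree_update hq _).2]
      exact ⟨insert_subset (mem_range.2 hqN) hr.1,
        hag (fun a ha => by simp [ha]) hr.2.1, mem_insert_self _ _⟩
    · intro r hr
      rw [mem_agreeing, (agree_update hq r).2] at hr
      rw [mem_agreeing, (agree_update hq _).1]
      exact ⟨(erase_subset _ _).trans hr.1,
        hag (fun a ha => by simp [ha]) hr.2.1, notMem_erase _ _⟩
    · intro r hr
      rw [mem_agreeing, (agree_update hq r).1] at hr
      exact erase_insert hr.2.2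
    · intro r hr
      rw [mem_agreeing, (agree_update hq r).2] at hr
      exact insert_erase hr.2.2
  have h2 : (agreeing N (Function.update σ q 2)).card +
      (agreeing N (Function.update σ q 1)).card = (agreeing N σ).card := by
    rw [(agreeing_update hq).1, (agreeing_update hq).2]
    exact card_filter_add_card_filter_not _
  omega

theorem card_filter_range_two_mul (p : ℕ → Prop) [DecidablePred p] : ∀ m,
    ((range (2 * m)).filter p).card =
      ((range m).filter fun s => p (2 * s)).card + ((range m).filter fun s => p (2 * s + 1)).card
  | 0 => by simp
  | m + 1 => by
    rw [show 2 * (m + 1) = 2 * m + 1 + 1 by ring, range_add_one, range_add_one, range_add_one,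
      filter_insert, filter_insert, filter_insert, filter_insert]
    have ih := card_filter_range_two_mul p m
    have h1 : 2 * m + 1 ∉ (range (2 * m)).filter p := by simp
    have h2 : 2 * m ∉ (range (2 * m)).filter p := by simp
    have h3 : ∀ q : ℕ → Prop, [DecidablePred q] → m ∉ (range m).filter q := by simp
    split_ifs <;> simp_all <;> omega

/-- As long as at most `L` coins are known, the next query is a new coin. -/
def QueriesFresh (N L : ℕ) (T : (ℕ → ℕ) → (ℕ → ℕ) × (ℕ → ℕ)) (v : ℕ) : Prop :=
  ∀ D σ, IsPartial N D σ → D.card < L → Undetermined T v σ → (T σ).2 v < N ∧ σ ((T σ).2 v) = 0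

/-- Revealing coins is a binary decision tree of depth at most `L`. A leaf reached after `j` new
queries receives the fraction `2 ^ (-j)` of the coin sets agreeing with `σ`, and the same fraction
of the strings, since bits after the decision are ignored. -/
theorem card_revealBits_mul {L₀ : ℕ} (hT : QueriesFresh N L₀ T v) (p : (ℕ → ℕ) → Prop)
    [DecidablePred p] : ∀ (L : ℕ) (D : Finset ℕ) (σ : ℕ → ℕ), IsPartial N D σ → D.card + L ≤ L₀ →
      ((range (2 ^ L)).filter fun s => p (revealBits T v L s σ)).card * (agreeing N σ).card =
        ((agreeing N σ).filter fun r => p (revealCoins T v r L σ)).card * 2 ^ L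
  | 0, D, σ, _, _ => by
    by_cases h : p σ <;> simp [revealBits, revealCoins, h]
  | L + 1, D, σ, hσ, hD => by
    by_cases hu : Undetermined T v σ
    · obtain ⟨hqN, hq⟩ := hT D σ hσ (by omega) hu
      set q := (T σ).2 v
      have hD' : (insert q D).card + L ≤ L₀ := by
        have := card_insert_le q D
        omega
      have ih1 := card_revealBits_mul hT p L _ _ (hσ.update hqN (by norm_num : 0 < 2)) hD'
      have ih2 := card_revealBits_mul hT p L _ _ (hσ.update hqN (by norm_num : 1 < 2)) hD'
      have hc := card_agreeing_update hqN hq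
      have hl : ((range (2 ^ (L + 1))).filter fun s => p (revealBits T v (L + 1) s σ)).card =
          ((range (2 ^ L)).filter fun s =>
            p (revealBits T v L s (Function.update σ q (1 + 0)))).card +
          ((range (2 ^ L)).filter fun s =>
            p (revealBits T v L s (Function.update σ q (1 + 1)))).card := by
        rw [pow_succ', card_filter_range_two_mul]
        congr 2
        · refine filter_congr fun s _ => ?_
          rw [revealBits, reveal, if_pos hu, Nat.mul_mod_right, Nat.mul_div_cancel_left _ two_pos]
        · refine filter_congr fun s _ => ?_
          rw [revealBits, reveal, if_pos hu, Nat.mul_add_mod, Nat.mul_add_div two_pos]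
          rfl
      have hr : ((agreeing N σ).filter fun r => p (revealCoins T v r (L + 1) σ)).card =
          ((agreeing N (Function.update σ q (1 + 0))).filter fun r =>
            p (revealCoins T v r L (Function.update σ q (1 + 0)))).card +
          ((agreeing N (Function.update σ q (1 + 1))).filter fun r =>
            p (revealCoins T v r L (Function.update σ q (1 + 1)))).card := by
        simp only [show 1 + 0 = 1 from rfl, show 1 + 1 = 2 from rfl]
        rw [(agreeing_update hq).1, (agreeing_update hq).2, filter_filter, filter_filter,
          ← card_filter_add_card_filter_not (q ∈ ·), filter_filter, filter_filter]
        refine (Nat.add_comm _ _).trans ?_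
        congr 2
        · refine filter_congr fun r _ => ?_
          rw [and_comm, and_congr_right_iff]
          intro h
          rw [revealCoins, reveal, if_pos hu, if_neg h]
        · refine filter_congr fun r _ => ?_
          rw [and_comm, and_congr_right_iff]
          intro h
          rw [revealCoins, reveal, if_pos hu, if_pos h]
      rw [hl, hr, add_mul, add_mul, pow_succ']
      simp only [show 1 + 0 = 1 from rfl, show 1 + 1 = 2 from rfl] at ih1 ih2 ⊢
      nth_rewrite 1 [← hc.1]
      rw [← hc.2]
      linear_combination 2 * ih1 + 2 * ih2
    · simp only [revealBits_of_not hu, revealCoins_of_not hu]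
      by_cases h : p σ <;> simp [h, mul_comm]

/-- An undetermined value means that every round revealed a new coin, and all of these lie in `Y`.
-/
theorem card_add_le_of_undetermined (hr : r ⊆ range N)
    (hY : ∀ D σ, IsPartial N D σ → Agree r σ → Undetermined T v σ →
      (T σ).2 v < N → (T σ).2 v ∈ Y) {L₀ : ℕ} (hT : QueriesFresh N L₀ T v) :
    ∀ (L : ℕ) (D : Finset ℕ) (σ : ℕ → ℕ), IsPartial N D σ → Agree r σ → D ⊆ Y → D.card + L ≤ L₀ →
      Undetermined T v (revealCoins T v r L σ) → D.card + L ≤ Y.card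
  | 0, D, σ, _, _, hDY, _, _ => card_le_card hDY
  | L + 1, D, σ, hσ, hag, hDY, hL, hund => by
    by_cases hu : Undetermined T v σ
    · obtain ⟨hqN, hq⟩ := hT D σ hσ (by omega) hu
      have hqY := hY D σ hσ hag hu hqN
      rw [revealCoins, reveal, if_pos hu] at hund
      set q := (T σ).2 v
      have hqD : q ∉ D := fun h => (hσ.mem_iff q).1 h hq
      have hcard := card_insert_of_notMem hqD
      have hb : (if q ∈ r then 1 else 0) < 2 := by split_ifs <;> norm_num
      have := card_add_le_of_undetermined hr hY hT L (insert q D) _ (hσ.update hqN hb) ?_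
        (insert_subset hqY hDY) (by omega) hund
      · omega
      · split_ifs with h
        · exact (agree_update hq r).2.2 ⟨hag, h⟩
        · exact (agree_update hq r).1.2 ⟨hag, h⟩
    · rw [revealCoins_of_not hu] at hund
      exact absurd hund hu

theorem revealCoins_spec {L₀ : ℕ} (hT : QueriesFresh N L₀ T v) :
    ∀ (L : ℕ) (D : Finset ℕ) (σ : ℕ → ℕ), IsPartial N D σ → Agree r σ → D.card + L ≤ L₀ →
      ∃ D', IsPartial N D' (revealCoins T v r L σ) ∧ Agree r (revealCoins T v r L σ)
  | 0, D, σ, hσ, hag, _ => ⟨D, hσ, hag⟩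
  | L + 1, D, σ, hσ, hag, hL => by
    by_cases hu : Undetermined T v σ
    · obtain ⟨hqN, hq⟩ := hT D σ hσ (by omega) hu
      rw [revealCoins, reveal, if_pos hu]
      set q := (T σ).2 v
      have hb : (if q ∈ r then 1 else 0) < 2 := by split_ifs <;> norm_num
      refine revealCoins_spec hT L (insert q D) _ (hσ.update hqN hb) ?_
        (by have := card_insert_le q D; omega)
      split_ifs with h
      · exact (agree_update hq r).2.2 ⟨hag, h⟩
      · exact (agree_update hq r).1.2 ⟨hag, h⟩
    · rw [revealCoins_of_not hu]
      exact ⟨D, hσ, hag⟩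

end

end HypergraphFPTAS

namespace HypergraphFPTAS

open Finset

/-! ### Approximate marginals -/

section

variable {n N L M k Δ : ℕ} {F : Finset (Finset ℕ)} {r : Finset ℕ} {σ : ℕ → ℕ}
  {T : (ℕ → ℕ) → (ℕ → ℕ) × (ℕ → ℕ)} {v : ℕ}

/-- `T` tabulates the dynamics for all partially revealed coins. -/
def Tabulates (n N : ℕ) (F : Finset (Finset ℕ)) (T : (ℕ → ℕ) → (ℕ → ℕ) × (ℕ → ℕ)) : Prop :=
  ∀ D σ, IsPartial N D σ → IsTable n (N + n) F σ (T σ).1 (T σ).2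

/-- With fewer than `L` known coins a query chain from `v < n` cannot leave the `n * (L + 2)` ages
that are simulated. -/
theorem Tabulates.queriesFresh (hT : Tabulates n N F T) (hF : IsBounded n k Δ F) (hv : v < n)
    (hN : n * (L + 2) ≤ N) : QueriesFresh N L T v := by
  intro D σ hσ hD hu
  obtain ⟨h1, h2⟩ := (hT D σ hσ).query_spec hσ (by omega) hF.lt v (by omega) hu
  refine ⟨h2.trans_le ?_, h1⟩
  have h3 : (D.filter (v ≤ ·)).card ≤ D.card := card_filter_le _ _
  have h4 : n * (1 + (D.filter (v ≤ ·)).card) ≤ n * (L + 1) := Nat.mul_le_mul_left _ (by omega)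
  have h5 : n * (L + 2) = n * (L + 1) + n := by ring
  omega

theorem card_biUnion_id_le {A : Finset (Finset ℕ)} {b : ℕ} (h : ∀ c ∈ A, c.card ≤ b) :
    (A.biUnion id).card ≤ A.card * b :=
  card_biUnion_le_card_mul _ _ _ h

/-- Contrapositive: without a large cluster, the small dominating set `V` confines all queries to a
set `Y` with fewer than `L` elements, so `L` rounds must determine the value. -/
theorem Tabulates.hasLargeCluster (hT : Tabulates n N F T) (hF : IsBounded n k Δ F) (hk : 0 < k)
    (hv : v < n) (hN : n * (L + 2) ≤ N) (hL : 2 + (1 + k * M * (Δ * k * k)) * (Δ * k) ≤ L)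
    (hr : r ⊆ range N) (hu : Undetermined T v (revealCoins T v r L fun _ => 0)) :
    HasLargeCluster (nbrs n F) r M ∅ (starting n F v).toList := by
  by_contra hcl
  have hn : 0 < n := by omega
  obtain ⟨V, -, hVcard, hV1, hV2⟩ := exists_dominating hk (fun s c => hF.card_of_mem_nbrs) M ∅
    (starting n F v).toList (fun c hc => hF.card_of_mem_starting (mem_toList.1 hc)) hcl
  -- `K` absorbs every hyperedge inside `r` that starts in it: such a hyperedge starts at `v` or in
  -- a member through an element of `V`, hence it meets `V`, hence it is itself a member through an
  -- element of `V`. `Y` adds whatever a last query may touch.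
  set K := insert v (V.biUnion fun s => (through n F s).biUnion id)
  set Y := insert v (K.biUnion fun a => (starting n F a).biUnion id)
  have hK : ∀ a ∈ K, ∀ e ∈ F, a % n ∈ e → timed n e a ⊆ r → timed n e a ⊆ K := by
    intro a ha e he hae her
    have hmeet : ¬ Disjoint (timed n e a) V := by
      rcases mem_insert.1 ha with rfl | ha
      · refine hV1 _ ?_ her
        simp only [starting, mem_toList, mem_image, mem_filter]
        exact ⟨e, ⟨he, hae⟩, rfl⟩
      · simp only [mem_biUnion, id] at ha
        obtain ⟨s, hs, S, hS, haS⟩ := ha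
        refine hV2 s hs (by simp) _ ?_ her
        simp only [nbrs, mem_biUnion]
        refine ⟨S, hS, a, haS, ?_⟩
        simp only [starting, mem_image, mem_filter]
        exact ⟨e, ⟨he, hae⟩, rfl⟩
    obtain ⟨s, hs, hsV⟩ := not_disjoint_iff.1 hmeet
    intro b hb
    refine mem_insert_of_mem (mem_biUnion.2 ⟨s, hsV, mem_biUnion.2 ⟨_, ?_, hb⟩⟩)
    exact hF.mem_through he hae hs
  have hY : ∀ a ∈ K, ∀ e ∈ F, a % n ∈ e → timed n e a ⊆ Y := by
    intro a ha e he hae b hb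
    refine mem_insert_of_mem (mem_biUnion.2 ⟨a, ha, mem_biUnion.2 ⟨_, ?_, hb⟩⟩)
    simp only [starting, mem_image, mem_filter]
    exact ⟨e, ⟨he, hae⟩, rfl⟩
  have hKcard : K.card ≤ 1 + k * M * (Δ * k * k) := by
    have h1 : (V.biUnion fun s => (through n F s).biUnion id).card ≤ V.card * (Δ * k * k) :=
      card_biUnion_le_card_mul _ _ _ fun s _ =>
        (card_biUnion_id_le fun c hc => (hF.card_of_mem_through hc).le).trans
          (Nat.mul_le_mul_right _ (hF.card_through s))
    have h3 : V.card * (Δ * k * k) ≤ k * M * (Δ * k * k) :=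
      Nat.mul_le_mul_right _ (by simpa using hVcard)
    refine (card_insert_le _ _).trans ?_
    omega
  have hYcard : Y.card ≤ 1 + (1 + k * M * (Δ * k * k)) * (Δ * k) := by
    have h1 : (K.biUnion fun a => (starting n F a).biUnion id).card ≤ K.card * (Δ * k) :=
      card_biUnion_le_card_mul _ _ _ fun a _ =>
        (card_biUnion_id_le fun c hc => (hF.card_of_mem_starting hc).le).trans
          (Nat.mul_le_mul_right _ (hF.card_starting a))
    have h3 : K.card * (Δ * k) ≤ (1 + k * M * (Δ * k * k)) * (Δ * k) :=
      Nat.mul_le_mul_right _ hKcard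
    refine (card_insert_le _ _).trans ?_
    omega
  have hq : ∀ D σ, IsPartial N D σ → Agree r σ → Undetermined T v σ →
      (T σ).2 v < N → (T σ).2 v ∈ Y := by
    intro D σ hσ hag hu _
    rcases (hT D σ hσ).query_mem hσ hn hF.lt hag hK hY v (by omega) (mem_insert_self _ _) hu
      with h | h
    · rw [h]
      exact mem_insert_self _ _
    · exact h
  have := card_add_le_of_undetermined hr hq (hT.queriesFresh hF hv hN) L ∅ _ (isPartial_zero N)
    (agree_zero r) (empty_subset _) (by simp) hu
  rw [card_empty] at this
  omega

theorem Tabulates.card_undetermined_le (hT : Tabulates n N F T) (hF : IsBounded n k Δ F)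
    (hk : 0 < k) (hΔ : 0 < Δ) (hkΔ : 2 * ((k ^ 3 * Δ ^ 2 : ℕ) : ℝ) * Real.exp 1 ≤ 2 ^ k)
    (hv : v < n) (hN : n * (L + 2) ≤ N) (hL : 2 + (1 + k * M * (Δ * k * k)) * (Δ * k) ≤ L) :
    ((range N).powerset.filter fun r =>
      Undetermined T v (revealCoins T v r L fun _ => 0)).card * 2 ^ M ≤ 4 * 2 ^ N := by
  classical
  set d := k ^ 3 * Δ ^ 2 with hd
  have hd0 : 0 < d := by positivity
  have hdR : (0 : ℝ) < d := by exact_mod_cast hd0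
  have hexp : (1 + 1 / (d : ℝ)) ^ d ≤ Real.exp 1 := by
    calc (1 + 1 / (d : ℝ)) ^ d ≤ (Real.exp (1 / d)) ^ d := by
          refine pow_le_pow_left₀ (by positivity) ?_ d
          rw [add_comm]
          exact Real.add_one_le_exp _
      _ = Real.exp 1 := by
          rw [← Real.exp_nat_mul]
          congr 1
          field_simp
  -- The weight `x = 1 / d` minimises `(1 + x) ^ d / x` up to constants, the value being at most `e
  -- * d`; the spare factor two in `hkΔ` allows `y = 2`, so that the probability halves with each
  -- further set.
  have h1 := card_hasLargeCluster_le (nb := nbrs n F) (k := k) (d := d) (N := N)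
    (x := 1 / (d : ℝ)) (y := 2) (by positivity) (by norm_num) (by
      rw [div_mul_eq_mul_div, le_div_iff₀ hdR, one_mul]
      calc 2 * (1 + 1 / (d : ℝ)) ^ d * d ≤ 2 * Real.exp 1 * d := by gcongr
        _ = 2 * d * Real.exp 1 := by ring
        _ ≤ _ := hkΔ) (fun s c => hF.card_of_mem_nbrs) (by
      intro c hc
      refine (card_biUnion_le_card_mul _ _ _ fun s _ => hF.card_nbrs s).trans ?_
      rw [hc, hd]
      exact le_of_eq (by ring)) M ∅ (starting n F v).toList
      (fun c hc => hF.card_of_mem_starting (mem_toList.1 hc))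
  -- The initial list has at most `Δ ≤ d` sets, so its weight is at most `e < 4`.
  have hlen : (starting n F v).toList.length ≤ d := by
    rw [length_toList]
    refine (hF.card_starting v).trans ?_
    rw [hd, pow_two, ← mul_assoc]
    exact Nat.le_mul_of_pos_left _ (by positivity)
  have h2 : (1 + 1 / (d : ℝ)) ^ (starting n F v).toList.length ≤ 4 := by
    refine (pow_le_pow_right₀ (le_add_of_nonneg_right (by positivity)) hlen).trans
      (hexp.trans ?_)
    have := Real.exp_one_lt_d9
    linarith
  have h3 : ((range N).powerset.filter fun r =>
      Undetermined T v (revealCoins T v r L fun _ => 0)).card ≤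
      ((range N).powerset.filter fun r =>
        ∅ ⊆ r ∧ HasLargeCluster (nbrs n F) r M ∅ (starting n F v).toList).card := by
    refine card_le_card fun r hr => ?_
    rw [mem_filter] at hr ⊢
    exact ⟨hr.1, empty_subset _,
      hT.hasLargeCluster hF hk hv hN hL (mem_powerset.1 hr.1) hr.2⟩
  rw [card_empty, pow_zero, mul_one] at h1
  have h4 : (((range N).powerset.filter fun r =>
      Undetermined T v (revealCoins T v r L fun _ => 0)).card : ℝ) * 2 ^ M ≤ 4 * 2 ^ N := by
    calc _ ≤ (((range N).powerset.filter fun r =>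
        ∅ ⊆ r ∧ HasLargeCluster (nbrs n F) r M ∅ (starting n F v).toList).card : ℝ) * 2 ^ M := by
          gcongr
      _ ≤ _ := h1
      _ ≤ 2 ^ N * 4 := by gcongr
      _ = _ := mul_comm _ _
  exact_mod_cast h4

/-- The number of strings of `L` bits for which the value at `v` is zero. -/
def zeroCount (T : (ℕ → ℕ) → (ℕ → ℕ) × (ℕ → ℕ)) (v L : ℕ) : ℕ :=
  ((range (2 ^ L)).filter fun s => (T (revealBits T v L s fun _ => 0)).1 v = 1).card

/-- The coins that force `v` out bound the marginal from below; together with the undetermined coins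
they bound it from above. Stationarity identifies the average over coins and initial sets with the
true marginal. -/
theorem Tabulates.zeroCount_spec (hT : Tabulates n N F T) (hF : IsBounded n k Δ F)
    (hk : 0 < k) (hΔ : 0 < Δ) (hkΔ : 2 * ((k ^ 3 * Δ ^ 2 : ℕ) : ℝ) * Real.exp 1 ≤ 2 ^ k)
    (hv : v < n) (hN : n * (L + 2) ≤ N) (hL : 2 + (1 + k * M * (Δ * k * k)) * (Δ * k) ≤ L) :
    zeroCount T v L * (indep n F).card ≤ 2 ^ L * ((indep n F).filter (v ∉ ·)).card ∧
    2 ^ M * (2 ^ L * ((indep n F).filter (v ∉ ·)).card) ≤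
      (2 ^ M * zeroCount T v L + 4 * 2 ^ L) * (indep n F).card := by
  have hn : 0 < n := by omega
  have hfresh := hT.queriesFresh hF hv hN
  set A := (range N).powerset.filter fun r => (T (revealCoins T v r L fun _ => 0)).1 v = 1
  set B := (range N).powerset.filter fun r => Undetermined T v (revealCoins T v r L fun _ => 0)
  have hB : B.card * 2 ^ M ≤ 4 * 2 ^ N := hT.card_undetermined_le hF hk hΔ hkΔ hv hN hL
  set I := (indep n F).card
  set I₀ := ((indep n F).filter (v ∉ ·)).card
  have hcount : zeroCount T v L * 2 ^ N = A.card * 2 ^ L := by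
    have h := card_revealBits_mul hfresh (fun σ => (T σ).1 v = 1) L ∅ _ (isPartial_zero N) (by simp)
    have h0 : agreeing N (fun _ => 0) = (range N).powerset := by
      ext r
      simp [mem_agreeing, agree_zero]
    rw [h0, card_powerset, card_range] at h
    exact h
  have hsum := sum_scan (n := n) (F := F) hn (fun S => if v ∉ S then 1 else 0) N
  rw [← card_filter] at hsum
  have hfin : ∀ r ∈ (range N).powerset, ∀ S ∈ indep n F,
      ((T (revealCoins T v r L fun _ => 0)).1 v = 1 → v ∉ scan n F r N S) ∧
      ((T (revealCoins T v r L fun _ => 0)).1 v = 2 → v ∈ scan n F r N S) ∧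
      ((T (revealCoins T v r L fun _ => 0)).1 v = 1 ∨ (T (revealCoins T v r L fun _ => 0)).1 v = 2 ∨
        Undetermined T v (revealCoins T v r L fun _ => 0)) := by
    intro r hr S hS
    obtain ⟨D, hD, hag⟩ := revealCoins_spec hfresh L ∅ _ (isPartial_zero N) (agree_zero r) (by simp)
    have h1 := (hT D _ hD).sound hD hn hF.lt hag hS hv
    refine ⟨h1.1, h1.2, ?_⟩
    unfold Undetermined
    rcases (hT D _ hD).value_lt hD (by omega : v < N + n) with h | h | h | h <;> simp [h.1]
  have hlow : A.card * I ≤ 2 ^ N * I₀ := by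
    rw [← hsum, ← smul_eq_mul, ← sum_const]
    refine (sum_le_sum fun r hr => ?_).trans (sum_le_sum_of_subset (filter_subset _ _))
    rw [← card_filter]
    have hr' := mem_filter.1 hr
    rw [filter_true_of_mem fun S hS => (hfin r hr'.1 S hS).1 hr'.2]
  have hupp : 2 ^ N * I₀ ≤ (A.card + B.card) * I := by
    rw [← hsum]
    calc _ ≤ ∑ r ∈ A ∪ B, ∑ S ∈ indep n F, (if v ∉ scan n F r N S then 1 else 0) := by
          refine (sum_subset (union_subset (filter_subset _ _) (filter_subset _ _))
            fun r hr hr' => sum_eq_zero fun S hS => ?_).ge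
          have h := hfin r hr S hS
          rw [if_neg]
          intro hv'
          refine hr' (mem_union.2 ?_)
          rcases h.2.2 with h' | h' | h'
          · exact Or.inl (mem_filter.2 ⟨hr, h'⟩)
          · exact absurd (h.2.1 h') hv'
          · exact Or.inr (mem_filter.2 ⟨hr, h'⟩)
      _ ≤ (A ∪ B).card • I := by
          refine sum_le_card_nsmul _ _ _ fun r _ => ?_
          rw [← card_filter]
          exact card_filter_le _ _
      _ ≤ _ := Nat.mul_le_mul_right _ (card_union_le _ _)
  have hpos : 0 < 2 ^ N := by positivity
  constructor
  · refine Nat.le_of_mul_le_mul_left ?_ hpos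
    calc 2 ^ N * (zeroCount T v L * I) = (zeroCount T v L * 2 ^ N) * I := by ring
      _ = 2 ^ L * (A.card * I) := by rw [hcount]; ring
      _ ≤ 2 ^ L * (2 ^ N * I₀) := Nat.mul_le_mul_left _ hlow
      _ = _ := by ring
  · refine Nat.le_of_mul_le_mul_left ?_ hpos
    calc 2 ^ N * (2 ^ M * (2 ^ L * I₀)) = 2 ^ M * 2 ^ L * (2 ^ N * I₀) := by ring
      _ ≤ 2 ^ M * 2 ^ L * ((A.card + B.card) * I) := Nat.mul_le_mul_left _ hupp
      _ = (2 ^ M * (A.card * 2 ^ L) + (B.card * 2 ^ M) * 2 ^ L) * I := by ring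
      _ ≤ (2 ^ M * (zeroCount T v L * 2 ^ N) + (4 * 2 ^ N) * 2 ^ L) * I := by
          rw [hcount]
          gcongr
      _ = _ := by ring

end

/-! ### From marginals to the number of independent sets -/

theorem one_sub_mul_le_pow {t : ℝ} (ht : t ≤ 1) (n : ℕ) :
    1 - n * t ≤ (1 - t) ^ n := by
  have := one_add_mul_le_pow (a := -t) (by linarith) n
  calc 1 - n * t = 1 + n * -t := by ring
    _ ≤ (1 + -t) ^ n := this
    _ = _ := by rw [← sub_eq_add_neg]

/-- The relative error is one-sided and at most `8 / 2 ^ M` per vertex; `hM` and Bernoulli's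
inequality keep the total below `ε / 2`. -/
theorem prod_approx {n L M p q : ℕ} {F : Finset (Finset ℕ)} (hp : 0 < p) (hpq : p < q)
    (hF : ∀ e ∈ F, ∀ x ∈ e, x < n) (hne : ∅ ∉ F) {c : ℕ → ℕ}
    (hM : 16 * n * q ≤ 2 ^ M * p)
    (h1 : ∀ i < n, c i * (indep n (above F i)).card ≤
      2 ^ L * ((indep n (above F i)).filter (i ∉ ·)).card)
    (h2 : ∀ i < n, 2 ^ M * (2 ^ L * ((indep n (above F i)).filter (i ∉ ·)).card) ≤
      (2 ^ M * c i + 4 * 2 ^ L) * (indep n (above F i)).card) :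
    0 < ∏ i ∈ range n, c i ∧
    (∏ i ∈ range n, c i) * (indep n F).card ≤ 2 ^ (L * n) ∧
    ((2 : ℝ) ^ (L * n)) * (1 - p / (2 * q)) ≤ (∏ i ∈ range n, c i : ℕ) * (indep n F).card := by
  have hp' : (0 : ℝ) < p := by exact_mod_cast hp
  have hq' : (0 : ℝ) < q := by exact_mod_cast hp.trans hpq
  have hpq' : (p : ℝ) < q := by exact_mod_cast hpq
  have hMR : 16 * (n : ℝ) * q ≤ 2 ^ M * p := by exact_mod_cast hM
  have hM0 : (0 : ℝ) < 2 ^ M := by positivity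
  have hL0 : (0 : ℝ) < 2 ^ L := by positivity
  set Z : ℕ → ℕ := fun i => (indep n (above F i)).card with hZ
  have hZpos : ∀ i, 0 < Z i := by
    intro i
    refine card_pos.2 ⟨∅, mem_indep.2 ⟨empty_subset _, fun e he h => ?_⟩⟩
    rw [subset_empty] at h
    exact hne (h ▸ (mem_filter.1 he).1)
  have hZ0 : Z 0 = (indep n F).card := by simp only [hZ, above_zero]
  have hZn : Z n = 2 ^ n := by simp only [hZ, above_eq_empty hF hne, card_indep_empty]
  have hZs : ∀ i < n, Z (i + 1) = 2 * ((indep n (above F i)).filter (i ∉ ·)).card :=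
    fun i hi => card_indep_above_succ hi
  have hZle : ∀ i < n, Z i ≤ Z (i + 1) := fun i hi => by
    rw [hZs i hi]
    exact card_indep_le
  -- The additive error is `4 / 2 ^ M`, and the marginal is at least one half.
  set t : ℝ := 8 / 2 ^ M with ht
  have ht0 : 0 ≤ t := by positivity
  have htn : (n : ℝ) * t ≤ p / (2 * q) := by
    rw [ht, mul_div_assoc', div_le_div_iff₀ hM0 (by positivity)]
    linarith
  -- one factor
  have hup : ∀ i < n, 2 * (c i : ℝ) * Z i ≤ 2 ^ L * Z (i + 1) := by
    intro i hi
    have h := h1 i hi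
    rw [hZs i hi]
    push_cast
    have h' : (c i : ℝ) * Z i ≤ 2 ^ L * ((indep n (above F i)).filter (i ∉ ·)).card := by
      exact_mod_cast h
    linarith
  have hlo : ∀ i < n, (2 : ℝ) ^ L * Z (i + 1) * (1 - t) ≤ 2 * c i * Z i := by
    intro i hi
    have h := h2 i hi
    have h' : (2 : ℝ) ^ M * (2 ^ L * ((indep n (above F i)).filter (i ∉ ·)).card) ≤
        (2 ^ M * c i + 4 * 2 ^ L) * Z i := by
      exact_mod_cast h
    have hle : (Z i : ℝ) ≤ Z (i + 1) := by exact_mod_cast hZle i hi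
    have hs : (Z (i + 1) : ℝ) = 2 * ((indep n (above F i)).filter (i ∉ ·)).card := by
      rw [hZs i hi]
      push_cast
      ring
    refine le_of_mul_le_mul_left ?_ hM0
    have e1 : (2 : ℝ) ^ M * (2 ^ L * Z (i + 1) * (1 - t)) =
        2 ^ M * (2 ^ L * Z (i + 1)) - 8 * (2 ^ L * Z (i + 1)) := by
      rw [ht]
      field_simp
    rw [e1]
    have e2 : (2 : ℝ) ^ L * Z i ≤ 2 ^ L * Z (i + 1) := by gcongr
    have e3 : (2 : ℝ) ^ M * (2 ^ L * Z (i + 1)) =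
        2 * (2 ^ M * (2 ^ L * ((indep n (above F i)).filter (i ∉ ·)).card)) := by
      rw [hs]
      ring
    nlinarith
  -- products
  have hprodup : ∀ j ≤ n, (2 : ℝ) ^ j * (∏ i ∈ range j, (c i : ℝ)) * Z 0 ≤ 2 ^ (L * j) * Z j := by
    intro j
    induction j with
    | zero => simp
    | succ j ih =>
      intro hj
      have ih' := ih (by omega)
      have hu := hup j (by omega)
      rw [prod_range_succ]
      calc (2 : ℝ) ^ (j + 1) * ((∏ i ∈ range j, (c i : ℝ)) * c j) * Z 0
          = 2 * c j * (2 ^ j * (∏ i ∈ range j, (c i : ℝ)) * Z 0) := by ring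
        _ ≤ 2 * c j * (2 ^ (L * j) * Z j) := by gcongr
        _ = 2 ^ (L * j) * (2 * c j * Z j) := by ring
        _ ≤ 2 ^ (L * j) * (2 ^ L * Z (j + 1)) := by gcongr
        _ = _ := by rw [mul_add, pow_add]; ring
  have hn1 : 0 < n → t ≤ 1 := by
    intro hn
    have h1n : (1 : ℝ) ≤ n := by exact_mod_cast hn
    have : (p : ℝ) / (2 * q) ≤ 1 := by
      rw [div_le_one (by positivity)]
      linarith
    nlinarith
  have hprodlo : ∀ j ≤ n, (2 : ℝ) ^ (L * j) * Z j * (1 - t) ^ j ≤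
      (2 : ℝ) ^ j * (∏ i ∈ range j, (c i : ℝ)) * Z 0 := by
    intro j
    induction j with
    | zero => simp
    | succ j ih =>
      intro hj
      have ih' := ih (by omega)
      have hl := hlo j (by omega)
      have h1t : 0 ≤ 1 - t := by
        have := hn1 (by omega)
        linarith
      rw [prod_range_succ]
      calc (2 : ℝ) ^ (L * (j + 1)) * Z (j + 1) * (1 - t) ^ (j + 1)
          = 2 ^ (L * j) * (1 - t) ^ j * (2 ^ L * Z (j + 1) * (1 - t)) := by
            rw [mul_add, pow_add]; ring
        _ ≤ 2 ^ (L * j) * (1 - t) ^ j * (2 * c j * Z j) := by gcongr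
        _ = 2 * c j * (2 ^ (L * j) * Z j * (1 - t) ^ j) := by ring
        _ ≤ 2 * c j * ((2 : ℝ) ^ j * (∏ i ∈ range j, (c i : ℝ)) * Z 0) := by gcongr
        _ = _ := by ring
  have hup' := hprodup n le_rfl
  have hlo' := hprodlo n le_rfl
  rw [hZn] at hup' hlo'
  rw [← hZ0]
  have h2n : (0 : ℝ) < 2 ^ n := by positivity
  have hbern : 1 - (p : ℝ) / (2 * q) ≤ (1 - t) ^ n := by
    rcases Nat.eq_zero_or_pos n with rfl | hn
    · simp
      positivity
    · exact (by linarith : 1 - (p : ℝ) / (2 * q) ≤ 1 - n * t).trans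
        (one_sub_mul_le_pow (hn1 hn) n)
  have hlow : ((2 : ℝ) ^ (L * n)) * (1 - p / (2 * q)) ≤ (∏ i ∈ range n, c i : ℕ) * Z 0 := by
    refine le_of_mul_le_mul_left ?_ h2n
    push_cast at hlo' ⊢
    calc (2 : ℝ) ^ n * (2 ^ (L * n) * (1 - p / (2 * q)))
        ≤ (2 : ℝ) ^ n * (2 ^ (L * n) * (1 - t) ^ n) := by gcongr
      _ = 2 ^ (L * n) * 2 ^ n * (1 - t) ^ n := by ring
      _ ≤ _ := hlo'
      _ = _ := by ring
  have hhalf : (p : ℝ) / (2 * q) < 1 := by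
    rw [div_lt_one (by positivity)]
    linarith
  refine ⟨?_, ?_, hlow⟩
  · by_contra h0
    have h0' : ∏ i ∈ range n, c i = 0 := by omega
    rw [h0'] at hlow
    have : (0 : ℝ) < 2 ^ (L * n) * (1 - p / (2 * q)) := mul_pos (by positivity) (by linarith)
    simp at hlow
    linarith
  · have : (2 : ℝ) ^ n * ((∏ i ∈ range n, (c i : ℝ)) * Z 0) ≤ 2 ^ n * 2 ^ (L * n) := by
      push_cast at hup'
      linarith
    have := le_of_mul_le_mul_left this h2n
    exact_mod_cast this

end HypergraphFPTAS

/-! ### Counting steps instead of bits -/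

namespace LogRAM

/-- The value of the expression has at most `growth` bits more than the contents of the memory, if the
expression is tame. -/
def Expr.growth : Expr → ℕ
  | lit n => n.size
  | cell _ => 0
  | add e f => max e.growth f.growth + 1
  | sub e _ => e.growth
  | mul e f => e.growth + f.growth
  | div e _ => e.growth

/-- Products may occur only where they cannot make the value large. -/
def Expr.IsTame : Expr → Prop
  | lit _ => True
  | cell _ => True
  | add e f => e.IsTame ∧ f.IsTame
  | sub e _ => e.IsTame
  | mul (lit _) f => f.IsTame
  | mul _ _ => False
  | div e _ => e.IsTame

/-- Only multiplication by literals can contribute to the value, so bit lengths grow by a constant.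
A subtrahend or a divisor may be arbitrary, which admits the product inside a remainder. -/
theorem Expr.eval_lt_of_isTame {M : Memory} {W : ℕ} (hM : ∀ i, M i < 2 ^ W) :
    ∀ e : Expr, e.IsTame → e.eval M < 2 ^ (W + e.growth)
  | lit n, _ => (Nat.lt_size_self n).trans_le (Nat.pow_le_pow_right two_pos (Nat.le_add_left _ _))
  | cell e, _ => hM _
  | add e f, h => by
    have h1 := eval_lt_of_isTame hM e h.1
    have h2 := eval_lt_of_isTame hM f h.2
    have h3 : 2 ^ (W + e.growth) ≤ 2 ^ (W + max e.growth f.growth) :=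
      Nat.pow_le_pow_right two_pos (by omega)
    have h4 : 2 ^ (W + f.growth) ≤ 2 ^ (W + max e.growth f.growth) :=
      Nat.pow_le_pow_right two_pos (by omega)
    simp only [eval, growth, ← add_assoc, pow_succ]
    omega
  | sub e f, h => (Nat.sub_le _ _).trans_lt (eval_lt_of_isTame hM e h)
  | div e f, h => (Nat.div_le_self _ _).trans_lt (eval_lt_of_isTame hM e h)
  | mul (lit n) f, h => by
    have h2 := eval_lt_of_isTame hM f h
    have h1 := Nat.lt_size_self n
    calc n * f.eval M < 2 ^ n.size * 2 ^ (W + f.growth) := Nat.mul_lt_mul'' h1 h2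
      _ = _ := by rw [← pow_add]; simp only [growth]; congr 1; ring
  | mul (cell _) _, h => h.elim
  | mul (add _ _) _, h => h.elim
  | mul (sub _ _) _, h => h.elim
  | mul (mul _ _) _, h => h.elim
  | mul (div _ _) _, h => h.elim

/-- A factor in the bound on the bit length of the value of any expression. -/
def Expr.width : Expr → ℕ
  | lit n => n.size
  | cell _ => 1
  | add e f => e.width + f.width + 1
  | sub e f => e.width + f.width + 1
  | mul e f => e.width + f.width + 1
  | div e f => e.width + f.width + 1

/-- Intermediate products may multiply bit lengths only by a constant that depends on the
expression. Every operation is dominated by the product of the successors of its operands. -/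
theorem Expr.eval_lt {M : Memory} {W : ℕ} (hM : ∀ i, M i < 2 ^ W) :
    ∀ e : Expr, e.eval M < 2 ^ ((W + 1) * e.width) := by
  have key : ∀ e f : Expr, e.eval M < 2 ^ ((W + 1) * e.width) → f.eval M < 2 ^ ((W + 1) * f.width) →
      ∀ x, x ≤ (e.eval M + 1) * (f.eval M + 1) → x < 2 ^ ((W + 1) * (e.width + f.width + 1)) := by
    intro e f he hf x hx
    calc x ≤ (e.eval M + 1) * (f.eval M + 1) := hx
      _ ≤ 2 ^ ((W + 1) * e.width) * 2 ^ ((W + 1) * f.width) := Nat.mul_le_mul he hf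
      _ = 2 ^ ((W + 1) * (e.width + f.width)) := by rw [← pow_add, mul_add]
      _ < 2 ^ ((W + 1) * (e.width + f.width + 1)) :=
          Nat.pow_lt_pow_right one_lt_two ((Nat.mul_lt_mul_left (by omega)).2 (by omega))
  intro e
  induction e with
  | lit n =>
    exact (Nat.lt_size_self n).trans_le
      (Nat.pow_le_pow_right two_pos (Nat.le_mul_of_pos_left _ (Nat.succ_pos W)))
  | cell e =>
    exact (hM _).trans_le (Nat.pow_le_pow_right two_pos (by simp [width]))
  | add e f he hf => exact key e f he hf _ (by simp only [eval]; nlinarith)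
  | sub e f he hf => exact key e f he hf _ ((Nat.sub_le _ _).trans (by nlinarith))
  | mul e f he hf => exact key e f he hf _ (by simp only [eval]; nlinarith)
  | div e f he hf => exact key e f he hf _ ((Nat.div_le_self _ _).trans (by nlinarith))

/-- A factor in the bound on the cost of an expression. -/
def Expr.weight : Expr → ℕ
  | lit n => n.size + 1
  | cell e => e.weight + 1
  | add e f => e.weight + f.weight + (e.width + f.width + 2)
  | sub e f => e.weight + f.weight + (e.width + f.width + 2)
  | mul e f => e.weight + f.weight + (e.width + f.width + 2)
  | div e f => e.weight + f.weight + (e.width + f.width + 2)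

theorem Expr.cost_le {M : Memory} {W : ℕ} (hM : ∀ i, M i < 2 ^ W) (e : Expr) :
    e.cost M ≤ (W + 2) * e.weight := by
  have key : ∀ x w, x < 2 ^ ((W + 1) * w) → 1 + x.size ≤ (W + 2) * (w + 1) := by
    intro x w h
    have := Nat.size_le.2 h
    nlinarith
  induction e with
  | lit n => simp only [cost, weight]; nlinarith [Nat.zero_le (W * n.size)]
  | cell e ih =>
    have := Nat.size_le.2 (hM (e.eval M))
    simp only [cost, weight]
    nlinarith
  | add e f he hf =>
    have := key _ _ (eval_lt hM (add e f))
    simp only [cost, weight, width, eval, mul_add] at *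
    omega
  | sub e f he hf =>
    have := key _ _ (eval_lt hM (sub e f))
    simp only [cost, weight, width, eval, mul_add] at *
    omega
  | mul e f he hf =>
    have := key _ _ (eval_lt hM (mul e f))
    simp only [cost, weight, width, eval, mul_add] at *
    omega
  | div e f he hf =>
    have := key _ _ (eval_lt hM (div e f))
    simp only [cost, weight, width, eval, mul_add] at *
    omega

/-- All values that are stored are tame. -/
def Program.IsTame : Program → Prop
  | skip => True
  | store _ e => e.IsTame
  | seq P Q => P.IsTame ∧ Q.IsTame
  | ite _ P Q => P.IsTame ∧ Q.IsTame
  | .while _ P => P.IsTame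

/-- The number of bits that a single step may add. -/
def Program.growth : Program → ℕ
  | skip => 0
  | store _ e => e.growth
  | seq P Q => max P.growth Q.growth
  | ite _ P Q => max P.growth Q.growth
  | .while _ P => P.growth

/-- A factor in the bound on the cost of a single step. -/
def Program.weight : Program → ℕ
  | skip => 1
  | store a e => a.weight + e.weight + 1
  | seq P Q => max P.weight Q.weight + 1
  | ite e P Q => e.weight + 1 + max P.weight Q.weight
  | .while e P => e.weight + 1 + P.weight

/-- `Steps P M M' n`: the program runs from `M` to `M'` in `n` steps. -/
inductive Steps : Program → Memory → Memory → ℕ → Prop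
  | skip (M : Memory) : Steps .skip M M 1
  | store (a e : Expr) (M : Memory) :
      Steps (.store a e) M (Function.update M (a.eval M) (e.eval M)) 1
  | seq {P Q : Program} {M M₁ M₂ : Memory} {s t : ℕ} :
      Steps P M M₁ s → Steps Q M₁ M₂ t → Steps (.seq P Q) M M₂ (s + t + 1)
  | ite_true {e : Expr} {P Q : Program} {M M₁ : Memory} {t : ℕ} :
      e.eval M ≠ 0 → Steps P M M₁ t → Steps (.ite e P Q) M M₁ (t + 1)
  | ite_false {e : Expr} {P Q : Program} {M M₁ : Memory} {t : ℕ} :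
      e.eval M = 0 → Steps Q M M₁ t → Steps (.ite e P Q) M M₁ (t + 1)
  | while_true {e : Expr} {P : Program} {M M₁ M₂ : Memory} {s t : ℕ} :
      e.eval M ≠ 0 → Steps P M M₁ s → Steps (.while e P) M₁ M₂ t →
        Steps (.while e P) M M₂ (s + t + 1)
  | while_false {e : Expr} {P : Program} {M : Memory} :
      e.eval M = 0 → Steps (.while e P) M M 1

/-- After at most `n` steps every word has at most `W + g * n` bits, so each step costs at most `κ`
times about this length. Counting steps is therefore enough. -/
theorem Steps.exec {P : Program} {M M' : Memory} {n : ℕ} (h : Steps P M M' n) {g κ : ℕ} :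
    ∀ {W : ℕ}, P.IsTame → P.growth ≤ g → P.weight ≤ κ → (∀ i, M i < 2 ^ W) →
      (∀ i, M' i < 2 ^ (W + g * n)) ∧ ∃ t, Exec P M M' t ∧ t ≤ n * (κ * (W + g * n + 2)) := by
  have hcost : ∀ {M : Memory} {W n : ℕ} (e : Expr) {c : ℕ}, (∀ i, M i < 2 ^ W) → e.weight + c ≤ κ →
      e.cost M + c ≤ κ * (W + g * n + 2) := by
    intro M W n e c hM hw
    have h1 := e.cost_le hM
    calc e.cost M + c ≤ (W + 2) * e.weight + (W + 2) * c :=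
          Nat.add_le_add h1 (Nat.le_mul_of_pos_left _ (by omega))
      _ = (W + 2) * (e.weight + c) := by ring
      _ ≤ (W + g * n + 2) * κ := Nat.mul_le_mul (by omega) hw
      _ = _ := mul_comm _ _
  have hup : ∀ {M : Memory} {W n n' : ℕ}, (∀ i, M i < 2 ^ (W + g * n)) → n ≤ n' →
      ∀ i, M i < 2 ^ (W + g * n') := fun h hn i =>
    (h i).trans_le (Nat.pow_le_pow_right two_pos
      (Nat.add_le_add_left (Nat.mul_le_mul_left _ hn) _))
  have hmono : ∀ {W n n' : ℕ}, n ≤ n' → κ * (W + g * n + 2) ≤ κ * (W + g * n' + 2) := fun h =>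
    Nat.mul_le_mul_left _ (by have := Nat.mul_le_mul_left g h; omega)
  induction h with
  | skip M =>
    intro W _ _ hκ hM
    refine ⟨fun i => (hM i).trans_le (Nat.pow_le_pow_right two_pos (by omega)), 1, .skip M, ?_⟩
    simp only [Program.weight] at hκ
    rw [one_mul]
    exact Nat.mul_pos hκ (by omega)
  | store a e M =>
    intro W hT hg hκ hM
    simp only [Program.weight, Program.growth] at hκ hg
    refine ⟨fun i => ?_, _, .store a e M, ?_⟩
    · by_cases hi : i = a.eval M
      · rw [hi, Function.update_self, mul_one]
        exact (Expr.eval_lt_of_isTame hM e hT).trans_le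
          (Nat.pow_le_pow_right two_pos (by omega))
      · rw [Function.update_of_ne hi]
        exact (hM i).trans_le (Nat.pow_le_pow_right two_pos (by omega))
    · rw [one_mul]
      have h1 := a.cost_le hM
      have h2 := e.cost_le hM
      calc a.cost M + e.cost M + 1 ≤ (W + 2) * (a.weight + e.weight + 1) := by
            rw [mul_add, mul_add]
            omega
        _ ≤ (W + g * 1 + 2) * κ := Nat.mul_le_mul (by omega) hκ
        _ = _ := mul_comm _ _
  | @seq P Q M M₁ M₂ s t _ _ ih1 ih2 =>
    intro W hT hg hκ hM
    simp only [Program.weight, Program.growth] at hκ hg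
    obtain ⟨h1, t1, e1, l1⟩ := ih1 (W := W) hT.1 (by omega) (by omega) hM
    obtain ⟨h2, t2, e2, l2⟩ := ih2 (W := W + g * s) hT.2 (by omega) (by omega) h1
    rw [add_assoc W, ← mul_add] at h2 l2
    refine ⟨hup h2 (by omega), _, .seq e1 e2, ?_⟩
    have l1' := l1.trans (Nat.mul_le_mul_left s (hmono (by omega : s ≤ s + t + 1)))
    have l2' := l2.trans (Nat.mul_le_mul_left t (hmono (by omega : s + t ≤ s + t + 1)))
    have : 1 ≤ κ * (W + g * (s + t + 1) + 2) := Nat.mul_pos (by omega) (by omega)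
    rw [add_mul, add_mul, one_mul]
    omega
  | @ite_true e P Q M M₁ t he _ ih =>
    intro W hT hg hκ hM
    simp only [Program.weight, Program.growth] at hκ hg
    obtain ⟨h1, t1, e1, l1⟩ := ih (W := W) hT.1 (by omega) (by omega) hM
    refine ⟨hup h1 (by omega), _, .ite_true he e1, ?_⟩
    have l1' := l1.trans (Nat.mul_le_mul_left t (hmono (by omega : t ≤ t + 1)))
    have := hcost (n := t + 1) e (c := 1) hM (by omega)
    rw [add_mul, one_mul]
    omega
  | @ite_false e P Q M M₁ t he _ ih =>
    intro W hT hg hκ hM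
    simp only [Program.weight, Program.growth] at hκ hg
    obtain ⟨h1, t1, e1, l1⟩ := ih (W := W) hT.2 (by omega) (by omega) hM
    refine ⟨hup h1 (by omega), _, .ite_false he e1, ?_⟩
    have l1' := l1.trans (Nat.mul_le_mul_left t (hmono (by omega : t ≤ t + 1)))
    have := hcost (n := t + 1) e (c := 1) hM (by omega)
    rw [add_mul, one_mul]
    omega
  | @while_true e P M M₁ M₂ s t he _ _ ih1 ih2 =>
    intro W hT hg hκ hM
    have hκ' := hκ
    simp only [Program.weight] at hκ'
    obtain ⟨h1, t1, e1, l1⟩ := ih1 (W := W) hT hg (by omega) hM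
    obtain ⟨h2, t2, e2, l2⟩ := ih2 (W := W + g * s) hT hg hκ h1
    rw [add_assoc W, ← mul_add] at h2 l2
    refine ⟨hup h2 (by omega), _, .while_true he e1 e2, ?_⟩
    have l1' := l1.trans (Nat.mul_le_mul_left s (hmono (by omega : s ≤ s + t + 1)))
    have l2' := l2.trans (Nat.mul_le_mul_left t (hmono (by omega : s + t ≤ s + t + 1)))
    have := hcost (n := s + t + 1) e (c := 1) hM (by omega)
    rw [add_mul, add_mul, one_mul]
    omega
  | @while_false e P M he =>
    intro W hT hg hκ hM
    simp only [Program.weight] at hκ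
    refine ⟨fun i => (hM i).trans_le (Nat.pow_le_pow_right two_pos (by omega)), _,
      .while_false he, ?_⟩
    rw [one_mul]
    exact hcost e hM (by omega)

/-! ### Step bounds for loop-free programs and counting loops -/

/-- The program runs from `M` to `M'` in at most `T` steps. -/
def Runs (P : Program) (M M' : Memory) (T : ℕ) : Prop := ∃ n ≤ T, Steps P M M' n

theorem Runs.seq {P Q : Program} {M M₁ M₂ : Memory} {s t : ℕ} (h₁ : Runs P M M₁ s)
    (h₂ : Runs Q M₁ M₂ t) : Runs (.seq P Q) M M₂ (s + t + 1) := by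
  obtain ⟨n₁, h1, s1⟩ := h₁
  obtain ⟨n₂, h2, s2⟩ := h₂
  exact ⟨_, by omega, .seq s1 s2⟩

theorem Runs.mono {P : Program} {M M' : Memory} {s t : ℕ} (h : Runs P M M' s) (hst : s ≤ t) :
    Runs P M M' t := by
  obtain ⟨n, h1, h2⟩ := h
  exact ⟨n, h1.trans hst, h2⟩

theorem Runs.ite {e : Expr} {P Q : Program} {M M' : Memory} {s : ℕ}
    (h₁ : e.eval M ≠ 0 → Runs P M M' s) (h₂ : e.eval M = 0 → Runs Q M M' s) :
    Runs (.ite e P Q) M M' (s + 1) := by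
  by_cases he : e.eval M = 0
  · obtain ⟨n, h1, h2⟩ := h₂ he
    exact ⟨_, by omega, .ite_false he h2⟩
  · obtain ⟨n, h1, h2⟩ := h₁ he
    exact ⟨_, by omega, .ite_true he h2⟩

/-- The effect of a program without loops. -/
def Program.effect : Program → Memory → Memory
  | skip, M => M
  | store a e, M => Function.update M (a.eval M) (e.eval M)
  | seq P Q, M => Q.effect (P.effect M)
  | ite e P Q, M => if e.eval M = 0 then Q.effect M else P.effect M
  | .while _ _, M => M

/-- The program has no loops. -/
def Program.IsLoopFree : Program → Prop
  | skip => True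
  | store _ _ => True
  | seq P Q => P.IsLoopFree ∧ Q.IsLoopFree
  | ite _ P Q => P.IsLoopFree ∧ Q.IsLoopFree
  | .while _ _ => False

/-- The length of a program. -/
def Program.length : Program → ℕ
  | skip => 1
  | store _ _ => 1
  | seq P Q => P.length + Q.length + 1
  | ite _ P Q => P.length + Q.length + 1
  | .while _ P => P.length + 1

theorem Program.IsLoopFree.runs : ∀ {P : Program}, P.IsLoopFree → ∀ M,
    Runs P M (P.effect M) P.length
  | skip, _, M => ⟨1, le_rfl, .skip M⟩
  | store a e, _, M => ⟨1, le_rfl, .store a e M⟩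
  | seq _ _, h, M => (IsLoopFree.runs h.1 M).seq (IsLoopFree.runs h.2 _)
  | ite e P Q, h, M => by
    by_cases he : e.eval M = 0
    · obtain ⟨n, h1, h2⟩ := IsLoopFree.runs h.2 M
      refine ⟨n + 1, ?_, .ite_false he ?_⟩
      · simp only [length]
        omega
      · rwa [effect, if_pos he]
    · obtain ⟨n, h1, h2⟩ := IsLoopFree.runs h.1 M
      refine ⟨n + 1, ?_, .ite_true he ?_⟩
      · simp only [length]
        omega
      · rwa [effect, if_neg he]

theorem Runs.of_effect {P : Program} {M M' : Memory} (hP : P.IsLoopFree) (h : P.effect M = M') :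
    Runs P M M' P.length := h ▸ hP.runs M

/-- Run `P` with the values `c - 1, …, 0` in the cell `r`, if `c` is the content of that cell. -/
def Program.countdown (r : ℕ) (P : Program) : Program :=
  .while (.cell (.lit r)) (.seq (.store (.lit r) (.sub (.cell (.lit r)) (.lit 1))) P)

open HypergraphFPTAS in
-- The loop is summarised by its action on an abstract state `x` that `g` turns into memory, so each
-- loop of the program becomes an instance of `down`.
theorem Runs.countdown {α : Type*} {r : ℕ} {P : Program} {T : ℕ} (g : ℕ → α → Memory)
    (step : ℕ → α → α) (I : ℕ → α → Prop) (hr : ∀ j x, g j x r = j)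
    (hdec : ∀ j x, Function.update (g (j + 1) x) r j = g j x) :
    ∀ N x, I N x →
      (∀ j < N, ∀ x, I (j + 1) x → Runs P (g j x) (g j (step j x)) T ∧ I j (step j x)) →
      Runs (.countdown r P) (g N x) (g 0 (down step N x)) (N * (T + 3) + 1)
  | 0, x, _, _ => ⟨1, by omega, .while_false (hr 0 x)⟩
  | N + 1, x, hI, hP => by
    obtain ⟨⟨n, hn, hs⟩, hI'⟩ := hP N (Nat.lt_succ_self N) x hI
    obtain ⟨n', hn', hs'⟩ := Runs.countdown g step I hr hdec N (step N x) hI'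
      fun j hj => hP j (by omega)
    refine ⟨1 + n + 1 + n' + 1, ?_,
      .while_true (by simp [Expr.eval, hr]) (.seq (.store _ _ _) ?_) hs'⟩
    · rw [add_mul]
      omega
    · have : (Expr.sub (.cell (.lit r)) (.lit 1)).eval (g (N + 1) x) = N := by
        simp [Expr.eval, hr]
      rw [this]
      simp only [Expr.eval, hdec]
      exact hs

/-- For loops whose invariant leaves part of the memory unspecified. -/
theorem Runs.countdown_exists {r : ℕ} {P : Program} {T : ℕ} (I : ℕ → Memory → Prop)
    (hr : ∀ j M, I j M → M r = j) :
    ∀ N M, I N M →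
      (∀ j < N, ∀ M, I (j + 1) M → ∃ M', Runs P (Function.update M r j) M' T ∧ I j M') →
      ∃ M', Runs (.countdown r P) M M' (N * (T + 3) + 1) ∧ I 0 M'
  | 0, M, hI, _ => ⟨M, ⟨1, by omega, .while_false (hr 0 M hI)⟩, hI⟩
  | N + 1, M, hI, hP => by
    obtain ⟨M', ⟨n, hn, hs⟩, hI'⟩ := hP N (Nat.lt_succ_self N) M hI
    obtain ⟨M'', ⟨n', hn', hs'⟩, hI''⟩ := Runs.countdown_exists I hr N M' hI'
      fun j hj => hP j (by omega)
    have hM := hr _ _ hI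
    refine ⟨M'', ⟨1 + n + 1 + n' + 1, ?_,
      .while_true (by simp [Expr.eval, hM]) (.seq (.store _ _ _) ?_) hs'⟩, hI''⟩
    · rw [add_mul]
      omega
    · have : (Expr.sub (.cell (.lit r)) (.lit 1)).eval M = N := by
        simp [Expr.eval, hM]
      rw [this]
      exact hs

end LogRAM

namespace HypergraphFPTAS

open LogRAM

/-! ### Registers and arrays -/

/-- A memory, seen as `24` registers followed by four interleaved arrays. -/
structure Store where
  (num den n m N L pw x i s j bits a e w c h o q z qq t u b : ℕ)
  (E sig X Q : ℕ → ℕ)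

namespace Store

/-- The content of a register. -/
def reg (S : Store) : ℕ → ℕ
  | 0 => S.num
  | 1 => S.den
  | 2 => S.n
  | 3 => S.m
  | 4 => S.N
  | 5 => S.L
  | 6 => S.pw
  | 7 => S.x
  | 8 => S.i
  | 9 => S.s
  | 10 => S.j
  | 11 => S.bits
  | 12 => S.a
  | 13 => S.e
  | 14 => S.w
  | 15 => S.c
  | 16 => S.h
  | 17 => S.o
  | 18 => S.q
  | 19 => S.z
  | 20 => S.qq
  | 21 => S.t
  | 22 => S.u
  | 23 => S.b
  | _ => 0

/-- Change the content of a register. -/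
def setReg (S : Store) (r v : ℕ) : Store :=
  match r with
  | 0 => { S with num := v }
  | 1 => { S with den := v }
  | 2 => { S with n := v }
  | 3 => { S with m := v }
  | 4 => { S with N := v }
  | 5 => { S with L := v }
  | 6 => { S with pw := v }
  | 7 => { S with x := v }
  | 8 => { S with i := v }
  | 9 => { S with s := v }
  | 10 => { S with j := v }
  | 11 => { S with bits := v }
  | 12 => { S with a := v }
  | 13 => { S with e := v }
  | 14 => { S with w := v }
  | 15 => { S with c := v }
  | 16 => { S with h := v }
  | 17 => { S with o := v }
  | 18 => { S with q := v }
  | 19 => { S with z := v }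
  | 20 => { S with qq := v }
  | 21 => { S with t := v }
  | 22 => { S with u := v }
  | 23 => { S with b := v }
  | _ => S

/-- The memory with the given registers and arrays. -/
def mem (S : Store) : Memory := fun l =>
  if l < 24 then S.reg l
  else if l % 4 = 0 then S.E (l / 4 - 6)
  else if l % 4 = 1 then S.sig (l / 4 - 6)
  else if l % 4 = 2 then S.X (l / 4 - 6)
  else S.Q (l / 4 - 6)

theorem mem_reg (S : Store) {r : ℕ} (hr : r < 24) : S.mem r = S.reg r := if_pos hr

theorem mem_E (S : Store) (i : ℕ) : S.mem (4 * i + 24) = S.E i := by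
  unfold mem
  rw [if_neg (by omega), if_pos (by omega)]
  congr 1
  omega

theorem mem_sig (S : Store) (i : ℕ) : S.mem (4 * i + 25) = S.sig i := by
  unfold mem
  rw [if_neg (by omega), if_neg (by omega), if_pos (by omega)]
  congr 1
  omega

theorem mem_X (S : Store) (i : ℕ) : S.mem (4 * i + 26) = S.X i := by
  unfold mem
  rw [if_neg (by omega), if_neg (by omega), if_neg (by omega), if_pos (by omega)]
  congr 1
  omega

theorem mem_Q (S : Store) (i : ℕ) : S.mem (4 * i + 27) = S.Q i := by
  unfold mem
  rw [if_neg (by omega), if_neg (by omega), if_neg (by omega), if_neg (by omega)]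
  congr 1
  omega

theorem reg_setReg (S : Store) {r l : ℕ} (hr : r < 24) (hl : l < 24) (v : ℕ) :
    (S.setReg r v).reg l = if l = r then v else S.reg l := by
  interval_cases r <;> interval_cases l <;> rfl

theorem arrays_setReg (S : Store) (r v : ℕ) : (S.setReg r v).E = S.E ∧
    (S.setReg r v).sig = S.sig ∧ (S.setReg r v).X = S.X ∧ (S.setReg r v).Q = S.Q := by
  unfold setReg
  split <;> exact ⟨rfl, rfl, rfl, rfl⟩

theorem update_reg (S : Store) {r : ℕ} (hr : r < 24) (v : ℕ) :
    Function.update S.mem r v = (S.setReg r v).mem := by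
  funext l
  obtain ⟨h1, h2, h3, h4⟩ := S.arrays_setReg r v
  by_cases hl : l < 24
  · rw [mem_reg _ hl, reg_setReg S hr hl, Function.update_apply, mem_reg _ hl]
  · rw [Function.update_of_ne (by omega)]
    simp only [mem, if_neg hl, h1, h2, h3, h4]

theorem update_sig (S : Store) (i v : ℕ) :
    Function.update S.mem (4 * i + 25) v = { S with sig := Function.update S.sig i v }.mem := by
  funext l
  by_cases hl : l = 4 * i + 25
  · rw [hl, mem_sig, Function.update_self]
    simp
  · rw [Function.update_of_ne hl]
    simp only [mem, reg]
    split_ifs <;> try rfl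
    rw [Function.update_of_ne (by omega)]

theorem update_X (S : Store) (i v : ℕ) :
    Function.update S.mem (4 * i + 26) v = { S with X := Function.update S.X i v }.mem := by
  funext l
  by_cases hl : l = 4 * i + 26
  · rw [hl, mem_X, Function.update_self]
    simp
  · rw [Function.update_of_ne hl]
    simp only [mem, reg]
    split_ifs <;> try rfl
    rw [Function.update_of_ne (by omega)]

theorem update_Q (S : Store) (i v : ℕ) :
    Function.update S.mem (4 * i + 27) v = { S with Q := Function.update S.Q i v }.mem := by
  funext l
  by_cases hl : l = 4 * i + 27
  · rw [hl, mem_Q, Function.update_self]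
    simp
  · rw [Function.update_of_ne hl]
    simp only [mem, reg]
    split_ifs <;> try rfl
    rw [Function.update_of_ne (by omega)]

/-- The registers and arrays of a memory. -/
def ofMem (M : Memory) : Store where
  num := M 0
  den := M 1
  n := M 2
  m := M 3
  N := M 4
  L := M 5
  pw := M 6
  x := M 7
  i := M 8
  s := M 9
  j := M 10
  bits := M 11
  a := M 12
  e := M 13
  w := M 14
  c := M 15
  h := M 16
  o := M 17
  q := M 18
  z := M 19
  qq := M 20
  t := M 21
  u := M 22
  b := M 23
  E i := M (4 * i + 24)
  sig i := M (4 * i + 25)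
  X i := M (4 * i + 26)
  Q i := M (4 * i + 27)

theorem mem_ofMem (M : Memory) : (ofMem M).mem = M := by
  funext l
  by_cases hl : l < 24
  · rw [mem_reg _ hl]
    interval_cases l <;> rfl
  · obtain ⟨i, h⟩ : ∃ i, l = 4 * i + 24 ∨ l = 4 * i + 25 ∨ l = 4 * i + 26 ∨ l = 4 * i + 27 :=
      ⟨l / 4 - 6, by omega⟩
    rcases h with rfl | rfl | rfl | rfl
    · rw [mem_E]; rfl
    · rw [mem_sig]; rfl
    · rw [mem_X]; rfl
    · rw [mem_Q]; rfl

end Store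

/-! ### The program -/

/-- The content of a register. -/
abbrev rg (r : ℕ) : Expr := .cell (.lit r)

/-- Assign to a register. -/
abbrev assign (r : ℕ) (e : Expr) : Program := .store (.lit r) e

/-- The address of an entry of the array with offset `b`. -/
abbrev entry (b : ℕ) (e : Expr) : Expr := .add (.mul (.lit 4) e) (.lit b)

/-- The remainder. -/
def emod (e f : Expr) : Expr := .sub e (.mul f (.div e f))

theorem eval_emod (e f : Expr) (M : Memory) : (emod e f).eval M = e.eval M % f.eval M :=
  Nat.mod_eq_sub_mul_div.symm

attribute [simp] Store.mem_reg Store.mem_E Store.mem_sig Store.mem_X Store.mem_Q Store.update_reg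
  Store.update_sig Store.update_X Store.update_Q Store.reg Store.setReg eval_emod
  Expr.eval Program.effect Program.IsLoopFree

/-- The expression for `nextVisit n x a`. -/
def enext : Expr := .add (rg 12) (emod (.add (rg 7) (.sub (rg 2) (emod (rg 12) (rg 2)))) (rg 2))

/-- Inspect the vertex number `w` of the hyperedge number `e`. -/
def posProg (k : ℕ) : Program :=
  .seq (assign 7 (.cell (entry 24 (.add (.mul (.lit (k + 1)) (rg 13)) (.add (.lit 1) (rg 14))))))
  (.seq (assign 23 enext)
  (.seq (.ite (.sub (rg 8) (rg 7)) (assign 16 (.lit 1)) .skip)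
  (.seq (.ite (.sub (rg 23) (rg 12)) .skip (assign 15 (.lit 1)))
  (.seq (.ite (.cell (entry 26 (rg 23)))
      (.ite (.sub (.cell (entry 26 (rg 23))) (.lit 1))
        (.ite (.sub (.cell (entry 26 (rg 23))) (.lit 2))
          (.ite (.sub (rg 17) (.lit 1)) .skip
            (.seq (assign 17 (.lit 1)) (assign 18 (.cell (entry 27 (rg 23))))))
          .skip)
        (assign 16 (.lit 1)))
      (.seq (assign 17 (.lit 2)) (assign 18 (rg 23))))
  (.seq (assign 7 (.lit 0)) (assign 23 (.lit 0)))))))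

/-- The effect of `posProg`, for the vertex `x`, on the registers `c`, `h`, `o`, `q`. -/
def posStep (n i a : ℕ) (X Q : ℕ → ℕ) (x : ℕ) (y : ℕ × ℕ × ℕ × ℕ) : ℕ × ℕ × ℕ × ℕ :=
  (if nextVisit n x a - a = 0 then 1 else y.1,
    if X (nextVisit n x a) = 1 then 1 else if i - x = 0 then y.2.1 else 1,
    if X (nextVisit n x a) = 0 then 2
      else if X (nextVisit n x a) - 2 = 0 ∨ y.2.2.1 - 1 ≠ 0 then y.2.2.1 else 1,
    if X (nextVisit n x a) = 0 then nextVisit n x a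
      else if X (nextVisit n x a) - 2 = 0 ∨ y.2.2.1 - 1 ≠ 0 then y.2.2.2 else Q (nextVisit n x a))

/-- Register `c` records that the hyperedge contains the updated vertex, and `h` that it is
irrelevant (a vertex below `i`) or harmless (a vertex known to be zero). Register `o` is `0`, `1` or
`2` according to whether nothing unknown, only inheritable queries, or an unknown coin was seen; `q`
is the corresponding query. -/
theorem runs_posProg (k : ℕ) (S : Store) (hx : S.x = 0) (hb : S.b = 0) :
    Runs (posProg k) S.mem
      { S with
        c := (posStep S.n S.i S.a S.X S.Q (S.E ((k + 1) * S.e + (1 + S.w))) (S.c, S.h, S.o, S.q)).1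
        h := (posStep S.n S.i S.a S.X S.Q (S.E ((k + 1) * S.e + (1 + S.w))) (S.c, S.h, S.o, S.q)).2.1
        o := (posStep S.n S.i S.a S.X S.Q (S.E ((k + 1) * S.e + (1 + S.w)))
          (S.c, S.h, S.o, S.q)).2.2.1
        q := (posStep S.n S.i S.a S.X S.Q (S.E ((k + 1) * S.e + (1 + S.w)))
          (S.c, S.h, S.o, S.q)).2.2.2 }.mem
      (posProg k).length := by
  generalize hV : S.E ((k + 1) * S.e + (1 + S.w)) = v
  generalize hB : nextVisit S.n v S.a = b'
  have hB' : S.a + (v + (S.n - S.a % S.n)) % S.n = b' := hB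
  refine (Runs.seq (Runs.of_effect (M' := { S with x := v }.mem) (by simp) (by simp [hV])) <|
    Runs.seq (Runs.of_effect (M' := { S with x := v, b := b' }.mem)
      (by simp) (by simp [enext, hB'])) <|
    Runs.seq (Runs.of_effect (M' := { S with
      x := v, b := b', h := if S.i - v = 0 then S.h else 1 }.mem)
      (by simp) (by simp only [Program.effect, Expr.eval, Store.mem_reg, Store.reg, Nat.reduceLT]
                    split_ifs <;> simp)) <|
    Runs.seq (Runs.of_effect (M' := { S with
      x := v, b := b', h := if S.i - v = 0 then S.h else 1,
      c := if b' - S.a = 0 then 1 else S.c }.mem)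
      (by simp) (by simp only [Program.effect, Expr.eval, Store.mem_reg, Store.reg, Nat.reduceLT]
                    split_ifs <;> simp)) <|
    Runs.seq (Runs.of_effect (M' := { S with
      x := v, b := b'
      c := (posStep S.n S.i S.a S.X S.Q v (S.c, S.h, S.o, S.q)).1
      h := (posStep S.n S.i S.a S.X S.Q v (S.c, S.h, S.o, S.q)).2.1
      o := (posStep S.n S.i S.a S.X S.Q v (S.c, S.h, S.o, S.q)).2.2.1
      q := (posStep S.n S.i S.a S.X S.Q v (S.c, S.h, S.o, S.q)).2.2.2 }.mem) (by simp) ?_) <|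
    Runs.of_effect (by simp) (by simp [hx, hb])).mono ?_
  · by_cases h1 : S.X b' = 0
    · simp [posStep, hB, h1]
    by_cases h2 : S.X b' = 1
    · simp [posStep, hB, h2]
    have h2' : ¬ S.X b' - 1 = 0 := by omega
    by_cases h3 : S.X b' - 2 = 0
    · simp [posStep, hB, h1, h2, h2', h3]
    by_cases h4 : S.o - 1 = 0
    · simp [posStep, hB, h1, h2, h2', h3, h4]
    · simp [posStep, hB, h1, h2, h2', h3, h4]
  · simp only [Program.length, posProg]
    omega

end HypergraphFPTAS

/-! ### Computing a single entry of the table -/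

namespace HypergraphFPTAS

open LogRAM

/-- The registers for local use are zero. -/
structure Store.IsClean (S : Store) : Prop where
  x : S.x = 0
  a : S.a = 0
  e : S.e = 0
  w : S.w = 0
  c : S.c = 0
  h : S.h = 0
  o : S.o = 0
  q : S.q = 0
  z : S.z = 0
  qq : S.qq = 0
  b : S.b = 0
  j : S.j = 0
  bits : S.bits = 0

/-- Inspect the hyperedge number `e`. -/
def edgeProg (k : ℕ) : Program :=
  .seq (assign 14 (.lit k))
  (.seq (.countdown 14 (posProg k))
  (.seq (.ite (rg 15)
      (.ite (rg 16) .skip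
        (.ite (rg 17)
          (.ite (.sub (rg 19) (.lit 1)) (.seq (assign 19 (.lit 3)) (assign 20 (rg 18))) .skip)
          (assign 19 (.lit 1))))
      .skip)
    (.seq (assign 15 (.lit 0)) (.seq (assign 16 (.lit 0))
      (.seq (assign 17 (.lit 0)) (assign 18 (.lit 0)))))))

/-- The effect of `edgeProg`, for the hyperedge with vertices `V 0, …, V (k - 1)`, on the registers
`z` and `qq`. -/
def edgeStep (n i k a : ℕ) (X Q V : ℕ → ℕ) (y : ℕ × ℕ) : ℕ × ℕ :=
  let p := down (fun w => posStep n i a X Q (V w)) k (0, 0, 0, 0)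
  if p.1 = 0 then y else if p.2.1 ≠ 0 then y else if p.2.2.1 = 0 then (1, y.2)
    else if y.1 - 1 = 0 then y else (3, p.2.2.2)

/-- A bound on the running time of `edgeProg`. -/
def edgeTime (k : ℕ) : ℕ := k * ((posProg k).length + 3) + 30

/-- The verdict `z` starts at `2` (occupied). A hyperedge that is occupied elsewhere makes it `1`
for good; one that might be makes it `3`, unless it is already `1`. -/
theorem runs_edgeProg (k : ℕ) (S : Store) (hx : S.x = 0) (hb : S.b = 0) (hw : S.w = 0)
    (hc : S.c = 0) (hh : S.h = 0) (ho : S.o = 0) (hq : S.q = 0) :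
    Runs (edgeProg k) S.mem
      { S with
        z := (edgeStep S.n S.i k S.a S.X S.Q (fun w => S.E ((k + 1) * S.e + (1 + w)))
          (S.z, S.qq)).1
        qq := (edgeStep S.n S.i k S.a S.X S.Q (fun w => S.E ((k + 1) * S.e + (1 + w)))
          (S.z, S.qq)).2 }.mem
      (edgeTime k) := by
  have hloop := Runs.countdown (r := 14) (P := posProg k) (T := (posProg k).length)
    (fun w (y : ℕ × ℕ × ℕ × ℕ) => { S with w := w, c := y.1, h := y.2.1, o := y.2.2.1, q := y.2.2.2 }.mem)
    (fun w => posStep S.n S.i S.a S.X S.Q (S.E ((k + 1) * S.e + (1 + w)))) (fun _ _ => True)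
    (by simp) (by simp) k (0, 0, 0, 0) trivial
    fun w _ y _ => ⟨runs_posProg k
      { S with w := w, c := y.1, h := y.2.1, o := y.2.2.1, q := y.2.2.2 } hx hb, trivial⟩
  unfold edgeStep
  generalize down _ k (0, 0, 0, 0) = p at hloop ⊢
  dsimp only
  refine (Runs.seq (Runs.of_effect (M' := { S with w := k, c := 0, h := 0, o := 0, q := 0 }.mem)
      (by simp) (by simp [hc, hh, ho, hq])) <| Runs.seq hloop <|
    Runs.of_effect (by simp) ?_).mono ?_
  · by_cases h1 : p.1 = 0
    · simp [h1, hc, hh, ho, hq, hw]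
    by_cases h2 : p.2.1 = 0
    swap
    · simp [h1, h2, hc, hh, ho, hq, hw]
    by_cases h3 : p.2.2.1 = 0
    · simp [h1, h2, h3, hc, hh, ho, hq, hw]
    by_cases h4 : S.z - 1 = 0
    · simp [h1, h2, h3, h4, hc, hh, ho, hq, hw]
    · simp [h1, h2, h3, h4, hc, hh, ho, hq, hw]
  · simp only [Program.length, edgeTime]
    omega

/-- Compute the entry of age `a`. -/
def cellProg (k : ℕ) : Program :=
  .ite (.sub (.cell (entry 25 (rg 12))) (.lit 1))
    (.seq (.seq (.store (entry 26 (rg 12)) (.lit 2)) (.seq (assign 19 (.lit 2)) (assign 13 (rg 3))))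
    (.seq (.countdown 13 (edgeProg k))
      (.seq (.store (entry 26 (rg 12)) (rg 19)) (.seq (.store (entry 27 (rg 12)) (rg 20))
        (.seq (assign 19 (.lit 0)) (assign 20 (.lit 0)))))))
    (.seq (.store (entry 26 (rg 12)) (.cell (entry 25 (rg 12)))) (.store (entry 27 (rg 12)) (rg 12)))

/-- The effect of `cellProg` on the arrays `X` and `Q`. -/
def cellStep (n i k m : ℕ) (V : ℕ → ℕ → ℕ) (σ : ℕ → ℕ) (a : ℕ) (T : (ℕ → ℕ) × (ℕ → ℕ)) :
    (ℕ → ℕ) × (ℕ → ℕ) :=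
  if σ a - 1 = 0 then (Function.update T.1 a (σ a), Function.update T.2 a a) else
    let y := down (fun e => edgeStep n i k a (Function.update T.1 a 2) T.2 (V e)) m (2, 0)
    (Function.update T.1 a y.1, Function.update T.2 a y.2)

/-- A bound on the running time of `cellProg`. -/
def cellTime (k m : ℕ) : ℕ := m * (edgeTime k + 3) + 30

/-- The entry under computation is provisionally set to `2`: the updated vertex then counts as
occupied and need not be excluded when its hyperedges are inspected. For the coins `0` and `1` the
codes of coin and value coincide. -/
theorem runs_cellProg (k : ℕ) (S : Store) (hx : S.x = 0) (hb : S.b = 0) (hw : S.w = 0)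
    (hc : S.c = 0) (hh : S.h = 0) (ho : S.o = 0) (hq : S.q = 0) (he : S.e = 0) (hz : S.z = 0)
    (hqq : S.qq = 0) :
    Runs (cellProg k) S.mem
      { S with
        X := (cellStep S.n S.i k S.m (fun e w => S.E ((k + 1) * e + (1 + w))) S.sig S.a
          (S.X, S.Q)).1
        Q := (cellStep S.n S.i k S.m (fun e w => S.E ((k + 1) * e + (1 + w))) S.sig S.a
          (S.X, S.Q)).2 }.mem
      (cellTime k S.m) := by
  refine Runs.mono (Runs.ite (s := S.m * (edgeTime k + 3) + 29) (fun h => ?_) fun h => ?_) le_rfl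
  · have hloop := Runs.countdown (r := 13) (P := edgeProg k) (T := edgeTime k)
      (fun e (y : ℕ × ℕ) => { S with
        X := Function.update S.X S.a 2, e := e, z := y.1, qq := y.2 }.mem)
      (fun e => edgeStep S.n S.i k S.a (Function.update S.X S.a 2) S.Q
        fun w => S.E ((k + 1) * e + (1 + w))) (fun _ _ => True)
      (by simp) (by simp) S.m (2, 0) trivial
      fun e _ y _ => ⟨runs_edgeProg k { S with
        X := Function.update S.X S.a 2, e := e, z := y.1, qq := y.2 } hx hb hw hc hh ho hq, trivial⟩
    refine (Runs.seq (Runs.of_effect (M' := { S with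
        X := Function.update S.X S.a 2, e := S.m, z := 2, qq := 0 }.mem) (by simp)
        (by simp [hqq])) <| Runs.seq hloop <| Runs.of_effect (by simp) ?_).mono ?_
    · simp at h
      have h' : ¬ S.sig S.a - 1 = 0 := by omega
      simp [cellStep, h', hz, hqq, he]
    · simp only [Program.length]
      omega
  · simp at h
    have h' : S.sig S.a - 1 = 0 := by omega
    refine (Runs.of_effect (by simp) ?_).mono (t := S.m * (edgeTime k + 3) + 29) ?_
    · simp [cellStep, h']
    · simp only [Program.length]
      omega

end HypergraphFPTAS

/-! ### Computing the table and revealing coins -/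

namespace HypergraphFPTAS

open LogRAM

/-- The expression for the number of array entries in use. -/
def boundExpr (k : ℕ) : Expr := .add (.mul (.lit (k + 1)) (rg 3)) (.add (rg 4) (rg 2))

/-- The number of array entries in use. -/
def arrayBound (n k m N : ℕ) : ℕ := (k + 1) * m + (N + n)

/-- Compute the table of values. -/
def tableProg (k : ℕ) : Program :=
  .seq (assign 12 (boundExpr k))
  (.seq (.countdown 12 (.seq (.store (entry 26 (rg 12)) (.lit 0)) (.store (entry 27 (rg 12)) (rg 12))))
  (.seq (assign 12 (rg 4)) (.countdown 12 (cellProg k))))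

/-- The table that `tableProg` computes. -/
def table (n i k m N : ℕ) (V : ℕ → ℕ → ℕ) (σ : ℕ → ℕ) : (ℕ → ℕ) × (ℕ → ℕ) :=
  down (cellStep n i k m V σ) N
    (fun _ => 0, fun a => if a < arrayBound n k m N then a else 0)

/-- A bound on the running time of `tableProg`. -/
def tableTime (n k m N : ℕ) : ℕ := arrayBound n k m N * 6 + N * (cellTime k m + 3) + 10

theorem down_update (v : ℕ → ℕ) (B : ℕ) : ∀ f : ℕ → ℕ, (∀ a, B ≤ a → f a = 0) →
    down (fun a f => Function.update f a (v a)) B f = fun a => if a < B then v a else 0 := by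
  induction B with
  | zero =>
    intro f hf
    funext a
    simp [down, hf]
  | succ B ih =>
    intro f hf
    have key : ∀ (B : ℕ) (f : ℕ → ℕ) (a : ℕ),
        down (fun a f => Function.update f a (v a)) B f a = if a < B then v a else f a := by
      intro B
      induction B with
      | zero => simp [down]
      | succ B ih =>
        intro f a
        rw [down, ih]
        by_cases h : a = B
        · simp [h]
        · rw [Function.update_of_ne h]
          split_ifs <;> first | rfl | omega
    funext a
    rw [key]
    split_ifs with h
    · rfl
    · exact hf a (by omega)

theorem down_prod {α β : Type*} (f : ℕ → α → α) (g : ℕ → β → β) : ∀ (N : ℕ) (x : α) (y : β),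
    down (fun j p => (f j p.1, g j p.2)) N (x, y) = (down f N x, down g N y)
  | 0, _, _ => rfl
  | N + 1, _, _ => down_prod f g N _ _

theorem cellStep_of_ne (n i k m : ℕ) (V : ℕ → ℕ → ℕ) (σ : ℕ → ℕ) {a b : ℕ} (h : b ≠ a)
    (T : (ℕ → ℕ) × (ℕ → ℕ)) : (cellStep n i k m V σ a T).1 b = T.1 b ∧
      (cellStep n i k m V σ a T).2 b = T.2 b := by
  unfold cellStep
  split_ifs <;> simp [h]

theorem table_of_le (n i k m N : ℕ) (V : ℕ → ℕ → ℕ) (σ : ℕ → ℕ) {b : ℕ} (hb : N ≤ b) :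
    (table n i k m N V σ).1 b = 0 ∧
      (table n i k m N V σ).2 b = if b < arrayBound n k m N then b else 0 := by
  refine down_induction (fun _ (T : (ℕ → ℕ) × (ℕ → ℕ)) => T.1 b = 0 ∧ T.2 b = if b < arrayBound n k m N then b else 0)
    N _ ⟨rfl, rfl⟩ fun a ha T hT => ?_
  rw [(cellStep_of_ne n i k m V σ (by omega : b ≠ a) T).1,
    (cellStep_of_ne n i k m V σ (by omega : b ≠ a) T).2]
  exact hT

/-- The vertices of the hyperedges, as stored in the memory. -/
def Store.vertex (S : Store) (k e w : ℕ) : ℕ := S.E ((k + 1) * e + (1 + w))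

/-- The table for the store. -/
abbrev Store.table (S : Store) (k : ℕ) (σ : ℕ → ℕ) : (ℕ → ℕ) × (ℕ → ℕ) :=
  HypergraphFPTAS.table S.n S.i k S.m S.N (S.vertex k) σ

/-- The clearing range covers the ages below `N + n` that are ever inspected and also the places
where the input used to lie. The arrays vanish beyond it, so their contents after clearing are known
exactly. -/
theorem runs_tableProg (k : ℕ) (S : Store) (ha : S.a = 0) (hx : S.x = 0) (hb : S.b = 0)
    (hw : S.w = 0) (hc : S.c = 0) (hh : S.h = 0) (ho : S.o = 0) (hq : S.q = 0) (he : S.e = 0)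
    (hz : S.z = 0) (hqq : S.qq = 0) (hX : ∀ a, arrayBound S.n k S.m S.N ≤ a → S.X a = 0)
    (hQ : ∀ a, arrayBound S.n k S.m S.N ≤ a → S.Q a = 0) :
    Runs (tableProg k) S.mem
      { S with X := (S.table k S.sig).1, Q := (S.table k S.sig).2 }.mem
      (tableTime S.n k S.m S.N) := by
  have hclear := Runs.countdown (r := 12)
    (P := .seq (.store (entry 26 (rg 12)) (.lit 0)) (.store (entry 27 (rg 12)) (rg 12))) (T := 3)
    (fun a (T : (ℕ → ℕ) × (ℕ → ℕ)) => { S with a := a, X := T.1, Q := T.2 }.mem)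
    (fun a T => (Function.update T.1 a 0, Function.update T.2 a a)) (fun _ _ => True)
    (by simp) (by simp) (arrayBound S.n k S.m S.N) (S.X, S.Q) trivial
    fun a _ T _ => ⟨Runs.of_effect (by simp) (by simp), trivial⟩
  rw [down_prod (fun a f => Function.update f a 0) (fun a f => Function.update f a a),
    down_update (fun _ => 0) _ _ hX, down_update (fun a => a) _ _ hQ] at hclear
  have hmain := Runs.countdown (r := 12) (P := cellProg k) (T := cellTime k S.m)
    (fun a (T : (ℕ → ℕ) × (ℕ → ℕ)) => { S with a := a, X := T.1, Q := T.2 }.mem)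
    (cellStep S.n S.i k S.m (S.vertex k) S.sig) (fun _ _ => True)
    (by simp) (by simp) S.N (fun _ => 0, fun a => if a < arrayBound S.n k S.m S.N then a else 0)
    trivial fun a _ T _ => ⟨runs_cellProg k { S with a := a, X := T.1, Q := T.2 }
      hx hb hw hc hh ho hq he hz hqq, trivial⟩
  refine (Runs.seq (Runs.of_effect (M' := { S with a := arrayBound S.n k S.m S.N }.mem) (by simp)
    (by simp [boundExpr, arrayBound])) <| Runs.seq hclear <|
    Runs.seq (Runs.of_effect (M' := { S with
      a := S.N, X := fun _ => 0, Q := fun a => if a < arrayBound S.n k S.m S.N then a else 0 }.mem)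
      (by simp) (by simp)) <| ?_).mono (s := _ + (_ + (_ + (S.N * (cellTime k S.m + 3) + 1) + 1) + 1) + 1) ?_
  · simpa only [ha, Store.table, table] using hmain
  · simp only [Program.length, tableTime]
    omega

/-- Reveal the next coin, if the value at `i` is not determined. -/
def revealProg : Program :=
  .seq
    (.ite (.cell (entry 26 (rg 8)))
      (.ite (.add (.sub (.cell (entry 26 (rg 8))) (.lit 3)) (.sub (.lit 3) (.cell (entry 26 (rg 8)))))
        .skip
        (.store (entry 25 (.cell (entry 27 (rg 8)))) (.add (.lit 1) (emod (rg 11) (.lit 2)))))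
      (.store (entry 25 (.cell (entry 27 (rg 8)))) (.add (.lit 1) (emod (rg 11) (.lit 2)))))
    (assign 11 (.div (rg 11) (.lit 2)))

/-- The last update of the vertex `i < n` has age `i`, so the entry `i` is the one to test. Equality
with `3` is expressed by two truncated differences. The bits are shifted in every case, as in
`revealBits`. -/
theorem runs_revealProg (S : Store) (T : (ℕ → ℕ) → (ℕ → ℕ) × (ℕ → ℕ)) (hX : S.X = (T S.sig).1)
    (hQ : S.Q = (T S.sig).2) :
    Runs revealProg S.mem
      { S with sig := reveal T S.i (S.bits % 2) S.sig, bits := S.bits / 2 }.mem 20 := by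
  refine (Runs.of_effect (by simp [revealProg]) ?_).mono (s := revealProg.length)
    (by simp [revealProg, Program.length])
  by_cases h0 : S.X S.i = 0
  · have h' : Undetermined T S.i S.sig := Or.inl (by rw [← hX, h0])
    simp [revealProg, h0, reveal, h', ← hQ]
  by_cases h3 : S.X S.i = 3
  · have h' : Undetermined T S.i S.sig := Or.inr (by rw [← hX, h3])
    simp [revealProg, h3, reveal, h', ← hQ]
  · have h' : ¬ Undetermined T S.i S.sig := by
      unfold Undetermined
      rw [← hX]
      tauto
    have h4 : ¬ (S.X S.i - 3 = 0 ∧ 3 - S.X S.i = 0) := by omega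
    simp [revealProg, h0, reveal, h', h4]

/-- Evaluate the value at `i` with the bits of `s` for coins, and update the counters. -/
def runProg (k : ℕ) : Program :=
  .seq (assign 12 (boundExpr k))
  (.seq (.countdown 12 (.store (entry 25 (rg 12)) (.lit 0)))
  (.seq (.seq (assign 11 (rg 9)) (assign 10 (rg 5)))
  (.seq (.countdown 10 (.seq (tableProg k) revealProg))
  (.seq (tableProg k)
  (.seq (.ite (.add (.sub (.cell (entry 26 (rg 8))) (.lit 1)) (.sub (.lit 1) (.cell (entry 26 (rg 8)))))
      .skip (assign 21 (.add (rg 21) (rg 1))))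
    (.seq (assign 22 (.add (rg 22) (rg 0))) (assign 11 (.lit 0))))))))

/-- A bound on the running time of `runProg`. -/
def runTime (n k m N L : ℕ) : ℕ :=
  arrayBound n k m N * 4 + L * (tableTime n k m N + 24) + tableTime n k m N + 30

theorem down_reveal (T : (ℕ → ℕ) → (ℕ → ℕ) × (ℕ → ℕ)) (v : ℕ) : ∀ (L s : ℕ) (σ X Q : ℕ → ℕ),
    (down (fun _ (y : (ℕ → ℕ) × (ℕ → ℕ) × (ℕ → ℕ) × ℕ) =>
      (reveal T v (y.2.2.2 % 2) y.1, (T y.1).1, (T y.1).2, y.2.2.2 / 2)) L (σ, X, Q, s)).1 =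
      revealBits T v L s σ
  | 0, _, _, _, _ => rfl
  | L + 1, s, _, _, _ => down_reveal T v L (s / 2) _ _ _

/-- The table is recomputed after every revealed coin. Adding `den` only on the value zero and `num`
always accumulates the two products needed in a stage. -/
theorem runs_runProg (k : ℕ) (S : Store) (hS : S.IsClean)
    (hsig : ∀ a, arrayBound S.n k S.m S.N ≤ a → S.sig a = 0)
    (hX : ∀ a, arrayBound S.n k S.m S.N ≤ a → S.X a = 0)
    (hQ : ∀ a, arrayBound S.n k S.m S.N ≤ a → S.Q a = 0) :
    Runs (runProg k) S.mem
      { S with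
        sig := revealBits (S.table k) S.i S.L S.s fun _ => 0
        X := (S.table k (revealBits (S.table k) S.i S.L S.s fun _ => 0)).1
        Q := (S.table k (revealBits (S.table k) S.i S.L S.s fun _ => 0)).2
        t := S.t +
          if (S.table k (revealBits (S.table k) S.i S.L S.s fun _ => 0)).1 S.i = 1 then S.den else 0
        u := S.u + S.num }.mem
      (runTime S.n k S.m S.N S.L) := by
  obtain ⟨hx, ha, he, hw, hc, hh, ho, hq, hz, hqq, hb, hj, hbits⟩ := hS
  have hNB : S.N ≤ arrayBound S.n k S.m S.N := by
    unfold arrayBound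
    omega
  have htab : ∀ σ a, arrayBound S.n k S.m S.N ≤ a → (S.table k σ).1 a = 0 ∧ (S.table k σ).2 a = 0 := by
    intro σ a ha
    have := table_of_le S.n S.i k S.m S.N (S.vertex k) σ (hNB.trans ha)
    rwa [if_neg (by omega)] at this
  have hclear := Runs.countdown (r := 12) (P := .store (entry 25 (rg 12)) (.lit 0)) (T := 1)
    (fun a (σ : ℕ → ℕ) => { S with a := a, sig := σ }.mem)
    (fun a σ => Function.update σ a 0) (fun _ _ => True)
    (by simp) (by simp) (arrayBound S.n k S.m S.N) S.sig trivial
    fun a _ T _ => ⟨Runs.of_effect (by simp) (by simp), trivial⟩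
  rw [down_update (fun _ => 0) _ _ hsig] at hclear
  simp only [ite_self] at hclear
  let step : ℕ → (ℕ → ℕ) × (ℕ → ℕ) × (ℕ → ℕ) × ℕ → (ℕ → ℕ) × (ℕ → ℕ) × (ℕ → ℕ) × ℕ :=
    fun _ y => (reveal (S.table k) S.i (y.2.2.2 % 2) y.1, (S.table k y.1).1, (S.table k y.1).2,
      y.2.2.2 / 2)
  let I : ℕ → (ℕ → ℕ) × (ℕ → ℕ) × (ℕ → ℕ) × ℕ → Prop := fun _ y =>
    (∀ a, arrayBound S.n k S.m S.N ≤ a → y.2.1 a = 0) ∧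
      ∀ a, arrayBound S.n k S.m S.N ≤ a → y.2.2.1 a = 0
  have hstep : ∀ j y, I j (step j y) := fun j y => ⟨fun a ha => (htab _ a ha).1, fun a ha => (htab _ a ha).2⟩
  have hloop := Runs.countdown (r := 10) (P := .seq (tableProg k) revealProg)
    (T := tableTime S.n k S.m S.N + 21)
    (fun j (y : (ℕ → ℕ) × (ℕ → ℕ) × (ℕ → ℕ) × ℕ) =>
      { S with a := 0, j := j, sig := y.1, X := y.2.1, Q := y.2.2.1, bits := y.2.2.2 }.mem)
    step I (by simp) (by simp) S.L (fun _ => 0, S.X, S.Q, S.s) ⟨hX, hQ⟩ fun j _ y hy =>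
      ⟨Runs.mono (Runs.seq (runs_tableProg k { S with
          a := 0, j := j, sig := y.1, X := y.2.1, Q := y.2.2.1, bits := y.2.2.2 }
          rfl hx hb hw hc hh ho hq he hz hqq hy.1 hy.2)
        (runs_revealProg { S with
          a := 0, j := j, sig := y.1, X := (S.table k y.1).1, Q := (S.table k y.1).2,
          bits := y.2.2.2 } (S.table k) rfl rfl)) le_rfl, hstep j _⟩
  have hrev := down_reveal (S.table k) S.i S.L S.s (fun _ => 0) S.X S.Q
  have hI : I 0 (down step S.L (fun _ => 0, S.X, S.Q, S.s)) :=
    down_induction I S.L _ ⟨hX, hQ⟩ fun j _ y _ => hstep j y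
  change (down step S.L (fun _ => 0, S.X, S.Q, S.s)).1 = _ at hrev
  generalize down step S.L (fun _ => 0, S.X, S.Q, S.s) = y at hloop hrev hI
  rw [← hrev]
  refine (Runs.seq (Runs.of_effect (M' := { S with a := arrayBound S.n k S.m S.N }.mem) (by simp)
    (by simp [boundExpr, arrayBound])) <| Runs.seq hclear <|
    Runs.seq (Runs.of_effect (M' := { S with
      a := 0, sig := fun _ => 0, bits := S.s, j := S.L }.mem) (by simp) (by simp)) <|
    Runs.seq hloop <| Runs.seq (runs_tableProg k { S with
          a := 0, j := 0, sig := y.1, X := y.2.1, Q := y.2.2.1, bits := y.2.2.2 }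
          rfl hx hb hw hc hh ho hq he hz hqq hI.1 hI.2) <| Runs.of_effect (by simp) ?_).mono ?_
  · change Program.effect _ { S with
      a := 0, j := 0, sig := y.1, X := (S.table k y.1).1, Q := (S.table k y.1).2,
      bits := y.2.2.2 }.mem = _
    generalize S.table k y.1 = T
    by_cases h1 : T.1 S.i = 1
    · simp [h1, ha, hj, hbits]
    · have h2 : ¬ (T.1 S.i - 1 = 0 ∧ 1 - T.1 S.i = 0) := by omega
      simp [h1, h2, ha, hj, hbits]
  · simp only [Program.length, runTime, add_assoc, Nat.reduceAdd]
    omega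

end HypergraphFPTAS

/-! ### Enumerating the strings of coins and multiplying the marginals -/

namespace HypergraphFPTAS

open LogRAM Finset

theorem QueriesFresh.revealBits {N L₀ v : ℕ} {T : (ℕ → ℕ) → (ℕ → ℕ) × (ℕ → ℕ)}
    (hT : QueriesFresh N L₀ T v) : ∀ (L s : ℕ) (D : Finset ℕ) (σ : ℕ → ℕ), IsPartial N D σ →
      D.card + L ≤ L₀ → ∃ D', IsPartial N D' (revealBits T v L s σ)
  | 0, _, D, _, hσ, _ => ⟨D, hσ⟩
  | L + 1, s, D, σ, hσ, hL => by
    rw [HypergraphFPTAS.revealBits, reveal]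
    split_ifs with hu
    · refine QueriesFresh.revealBits hT L _ _ _
        (hσ.update (hT D σ hσ (by omega) hu).1 (Nat.mod_lt _ two_pos)) ?_
      have := card_insert_le ((T σ).2 v) D
      omega
    · exact QueriesFresh.revealBits hT L _ D σ hσ (by omega)

theorem QueriesFresh.revealBits_of_le {N L v s : ℕ} {T : (ℕ → ℕ) → (ℕ → ℕ) × (ℕ → ℕ)}
    (hT : QueriesFresh N L T v) {a : ℕ} (ha : N ≤ a) :
    HypergraphFPTAS.revealBits T v L s (fun _ => 0) a = 0 := by
  obtain ⟨D, hD⟩ := hT.revealBits L s ∅ _ (isPartial_zero N) (by simp)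
  by_contra h
  have := hD.lt a ((hD.mem_iff a).2 h)
  omega

/-- The auxiliary arrays are zero outside of the part that is in use. -/
def VanishFrom (B : ℕ) (σ X Q : ℕ → ℕ) : Prop := ∀ a, B ≤ a → σ a = 0 ∧ X a = 0 ∧ Q a = 0

/-- Multiply `num` and `den` with the number of all strings of coins and the number of those strings
for which the value at `i` is zero. -/
def stageProg (k : ℕ) : Program :=
  .seq (assign 9 (rg 6))
  (.seq (.countdown 9 (runProg k))
  (.seq (assign 1 (rg 21)) (.seq (assign 0 (rg 22)) (.seq (assign 21 (.lit 0)) (assign 22 (.lit 0))))))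

/-- A bound on the running time of `stageProg`. -/
def stageTime (n k m N L : ℕ) : ℕ := 2 ^ L * (runTime n k m N L + 3) + 20

/-- The loop over all `2 ^ L` strings doubles as multiplication by repeated addition, since a
product of two registers would not be tame. The final arrays matter only through their vanishing. -/
theorem runs_stageProg (k : ℕ) (S : Store) (hS : S.IsClean) (hs : S.s = 0) (ht : S.t = 0)
    (hu : S.u = 0) (hpw : S.pw = 2 ^ S.L) (hT : QueriesFresh S.N S.L (S.table k) S.i)
    (hv : VanishFrom (arrayBound S.n k S.m S.N) S.sig S.X S.Q) :
    ∃ σ X Q, VanishFrom (arrayBound S.n k S.m S.N) σ X Q ∧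
      Runs (stageProg k) S.mem
        { S with
          sig := σ, X := X, Q := Q, num := S.num * 2 ^ S.L
          den := S.den * zeroCount (S.table k) S.i S.L }.mem
        (stageTime S.n k S.m S.N S.L) := by
  have hNB : S.N ≤ arrayBound S.n k S.m S.N := by
    unfold arrayBound
    omega
  let f : ℕ → Prop := fun s => (S.table k (revealBits (S.table k) S.i S.L s fun _ => 0)).1 S.i = 1
  obtain ⟨M, hloop, σ, X, Q, hv', rfl⟩ := Runs.countdown_exists (r := 9) (P := runProg k)
    (T := runTime S.n k S.m S.N S.L)
    (fun j M => ∃ σ X Q, VanishFrom (arrayBound S.n k S.m S.N) σ X Q ∧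
      M = { S with
        sig := σ, X := X, Q := Q, s := j
        t := S.den * ((Ico j (2 ^ S.L)).filter f).card
        u := S.num * (2 ^ S.L - j) }.mem) (by rintro j M ⟨σ, X, Q, -, rfl⟩; simp) (2 ^ S.L)
    { S with s := 2 ^ S.L }.mem ⟨S.sig, S.X, S.Q, hv, by simp [ht, hu]⟩ (by
      rintro j hj M ⟨σ, X, Q, hv, rfl⟩
      obtain ⟨hx, ha, he, hw, hc, hh, ho, hq, hz, hqq, hb, hjj, hbits⟩ := hS
      refine ⟨_, ?_, revealBits (S.table k) S.i S.L j fun _ => 0,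
        (S.table k (revealBits (S.table k) S.i S.L j fun _ => 0)).1,
        (S.table k (revealBits (S.table k) S.i S.L j fun _ => 0)).2, ?_, rfl⟩
      swap
      · intro a ha
        have := table_of_le S.n S.i k S.m S.N (S.vertex k)
          (revealBits (S.table k) S.i S.L j fun _ => 0) (hNB.trans ha)
        rw [if_neg (by omega)] at this
        exact ⟨hT.revealBits_of_le (hNB.trans ha), this⟩
      have := runs_runProg k { S with
        sig := σ, X := X, Q := Q, s := j
        t := S.den * ((Ico (j + 1) (2 ^ S.L)).filter f).card
        u := S.num * (2 ^ S.L - (j + 1)) } ⟨hx, ha, he, hw, hc, hh, ho, hq, hz, hqq, hb, hjj, hbits⟩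
        (fun a ha => (hv a ha).1) (fun a ha => (hv a ha).2.1) (fun a ha => (hv a ha).2.2)
      have h1 : S.den * ((Ico j (2 ^ S.L)).filter f).card =
          S.den * ((Ico (j + 1) (2 ^ S.L)).filter f).card + if f j then S.den else 0 := by
        rw [← Finset.insert_Ico_add_one_left_eq_Ico hj, filter_insert]
        split_ifs with h
        · rw [card_insert_of_notMem (by simp), mul_add_one]
        · rfl
      have h2 : S.num * (2 ^ S.L - j) = S.num * (2 ^ S.L - (j + 1)) + S.num := by
        rw [← Nat.mul_succ]
        congr 1
        omega
      rw [Store.update_reg _ (by norm_num), h1, h2]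
      exact this)
  refine ⟨σ, X, Q, hv', (Runs.seq (Runs.of_effect (M' := { S with s := 2 ^ S.L }.mem) (by simp)
    (by simp [hpw])) <| Runs.seq hloop <| Runs.of_effect (by simp) ?_).mono ?_⟩
  · have : ((Ico 0 (2 ^ S.L)).filter f).card = zeroCount (S.table k) S.i S.L := by
      rw [Nat.Ico_zero_eq_range]
      rfl
    rw [this]
    simp [hs, ht, hu]
  · simp only [Program.length, stageTime]
    omega

/-- Run through all stages. -/
def stagesProg (k : ℕ) : Program := .seq (assign 8 (rg 2)) (.countdown 8 (stageProg k))

/-- Stage `i` ignores the hyperedges with a vertex below `i`. As the program only reads `i` for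
this, the hyperedges never have to be rearranged. -/
theorem runs_stagesProg (k : ℕ) (S : Store) (hS : S.IsClean) (hs : S.s = 0) (ht : S.t = 0)
    (hu : S.u = 0) (hnum : S.num = 1) (hden : S.den = 1) (hpw : S.pw = 2 ^ S.L)
    (hT : ∀ i < S.n, QueriesFresh S.N S.L (table S.n i k S.m S.N (S.vertex k)) i)
    (hv : VanishFrom (arrayBound S.n k S.m S.N) S.sig S.X S.Q) :
    ∃ M, Runs (stagesProg k) S.mem M (S.n * (stageTime S.n k S.m S.N S.L + 3) + 3) ∧
      M 0 = 2 ^ (S.L * S.n) ∧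
      M 1 = ∏ i ∈ range S.n, zeroCount (table S.n i k S.m S.N (S.vertex k)) i S.L := by
  obtain ⟨M, hloop, σ, X, Q, hv', rfl⟩ := Runs.countdown_exists (r := 8) (P := stageProg k)
    (T := stageTime S.n k S.m S.N S.L)
    (fun j M => ∃ σ X Q, VanishFrom (arrayBound S.n k S.m S.N) σ X Q ∧
      M = { S with
        sig := σ, X := X, Q := Q, i := j, num := 2 ^ (S.L * (S.n - j))
        den := ∏ i ∈ Ico j S.n, zeroCount (table S.n i k S.m S.N (S.vertex k)) i S.L }.mem)
      (by rintro j M ⟨σ, X, Q, -, rfl⟩; simp) S.n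
    { S with i := S.n }.mem ⟨S.sig, S.X, S.Q, hv, by simp [hnum, hden]⟩ (by
      rintro j hj M ⟨σ, X, Q, hv, rfl⟩
      obtain ⟨hx, ha, he, hw, hc, hh, ho, hq, hz, hqq, hb, hjj, hbits⟩ := hS
      obtain ⟨σ', X', Q', hv', h⟩ := runs_stageProg k { S with
        sig := σ, X := X, Q := Q, i := j, num := 2 ^ (S.L * (S.n - (j + 1)))
        den := ∏ i ∈ Ico (j + 1) S.n, zeroCount (table S.n i k S.m S.N (S.vertex k)) i S.L }
        ⟨hx, ha, he, hw, hc, hh, ho, hq, hz, hqq, hb, hjj, hbits⟩ hs ht hu hpw (hT j hj) hv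
      refine ⟨_, ?_, σ', X', Q', hv', rfl⟩
      have h1 : 2 ^ (S.L * (S.n - j)) = 2 ^ (S.L * (S.n - (j + 1))) * 2 ^ S.L := by
        rw [← pow_add, ← Nat.mul_succ]
        congr 2
        omega
      rw [Store.update_reg _ (by norm_num), h1, ← Finset.insert_Ico_add_one_left_eq_Ico hj,
        prod_insert (by simp), mul_comm (zeroCount _ _ _)]
      exact h)
  refine ⟨_, (Runs.seq (Runs.of_effect (M' := { S with i := S.n }.mem) (by simp)
    (by simp)) hloop).mono ?_, by simp, by simp⟩
  simp only [Program.length]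
  omega

end HypergraphFPTAS

/-! ### The computed table meets its specification -/

namespace HypergraphFPTAS

open Finset

/-- The set of the hyperedges with the numbers less than `m`. -/
def edgeFinset (k m : ℕ) (V : ℕ → ℕ → ℕ) : Finset (Finset ℕ) :=
  (range m).image fun e => (range k).image (V e)

section

variable {n i k a : ℕ} {X Q : ℕ → ℕ}

/-- What `q` is, in terms of `o`, after an inspection of the vertices `V j, …, V (k - 1)`. -/
def QuerySpec (n a : ℕ) (X Q V : ℕ → ℕ) (j k o q : ℕ) : Prop :=
  (o = 0 ∧ ∀ w, j ≤ w → w < k → X (nextVisit n (V w) a) = 1 ∨ X (nextVisit n (V w) a) = 2) ∨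
  (o = 1 ∧ (∀ w, j ≤ w → w < k → X (nextVisit n (V w) a) ≠ 0) ∧
    ∃ w, j ≤ w ∧ w < k ∧ X (nextVisit n (V w) a) = 3 ∧ q = Q (nextVisit n (V w) a)) ∨
  (o = 2 ∧ ∃ w, j ≤ w ∧ w < k ∧ X (nextVisit n (V w) a) = 0 ∧ q = nextVisit n (V w) a)

theorem exists_le_lt_iff {p : ℕ → Prop} {j k : ℕ} (hj : j < k) :
    (∃ w, j ≤ w ∧ w < k ∧ p w) ↔ p j ∨ ∃ w, j + 1 ≤ w ∧ w < k ∧ p w := by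
  constructor
  · rintro ⟨w, h1, h2, h3⟩
    rcases eq_or_lt_of_le h1 with rfl | h
    exacts [Or.inl h3, Or.inr ⟨w, h, h2, h3⟩]
  · rintro (h | ⟨w, h1, h2, h3⟩)
    exacts [⟨j, le_rfl, hj, h⟩, ⟨w, by omega, h2, h3⟩]

theorem forall_le_lt_iff {p : ℕ → Prop} {j k : ℕ} (hj : j < k) :
    (∀ w, j ≤ w → w < k → p w) ↔ p j ∧ ∀ w, j + 1 ≤ w → w < k → p w := by
  constructor
  · exact fun h => ⟨h j le_rfl hj, fun w h1 h2 => h w (by omega) h2⟩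
  · rintro ⟨h, h'⟩ w h1 h2
    rcases eq_or_lt_of_le h1 with rfl | h3
    exacts [h, h' w h3 h2]

/-- The bound on the entries makes the truncated tests of the program exact: an entry other than
`0`, `1`, `2` is `3`. -/
theorem posStep_spec {V : ℕ → ℕ} (hV : ∀ w < k, V w < n) (hX : ∀ x < n, X (nextVisit n x a) ≤ 3) :
    let p := down (fun w => posStep n i a X Q (V w)) k (0, 0, 0, 0)
    (p.1 ≠ 0 ↔ ∃ w, 0 ≤ w ∧ w < k ∧ V w = a % n) ∧
    (p.2.1 ≠ 0 ↔ ∃ w, 0 ≤ w ∧ w < k ∧ (X (nextVisit n (V w) a) = 1 ∨ V w < i)) ∧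
    QuerySpec n a X Q V 0 k p.2.2.1 p.2.2.2 := by
  refine down_induction (fun j (p : ℕ × ℕ × ℕ × ℕ) =>
    (p.1 ≠ 0 ↔ ∃ w, j ≤ w ∧ w < k ∧ V w = a % n) ∧
    (p.2.1 ≠ 0 ↔ ∃ w, j ≤ w ∧ w < k ∧ (X (nextVisit n (V w) a) = 1 ∨ V w < i)) ∧
    QuerySpec n a X Q V j k p.2.2.1 p.2.2.2) k _ ⟨?_, ?_, ?_⟩ ?_
  · simp only [ne_eq, not_true_eq_false, false_iff]
    rintro ⟨w, h1, h2, -⟩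
    omega
  · simp only [ne_eq, not_true_eq_false, false_iff]
    rintro ⟨w, h1, h2, -⟩
    omega
  · exact Or.inl ⟨rfl, fun w h1 h2 => by omega⟩
  · rintro j hj ⟨c, h, o, q⟩ ⟨h1, h2, h3⟩
    have hlt := hV j hj
    have hle := le_nextVisit n (V j) a
    have heq := nextVisit_eq_self_iff hlt a
    have h3' := hX _ hlt
    dsimp only at h1 h2 h3 ⊢
    refine ⟨?_, ?_, ?_⟩
    · rw [exists_le_lt_iff hj, ← h1, ← heq]
      simp only [posStep]
      split_ifs with h
      · simpa using Or.inl (by omega)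
      · have : nextVisit n (V j) a ≠ a := by omega
        simp [this]
    · rw [exists_le_lt_iff hj, ← h2]
      simp only [posStep]
      split_ifs with h h'
      · simp [h]
      · have : ¬ V j < i := by omega
        simp [h, this]
      · have : V j < i := by omega
        simp [this]
    · simp only [posStep]
      unfold QuerySpec at h3 ⊢
      rw [exists_le_lt_iff hj, exists_le_lt_iff hj, forall_le_lt_iff hj, forall_le_lt_iff hj]
      generalize nextVisit n (V j) a = b at *
      split_ifs with h4 h5
      · exact Or.inr (Or.inr ⟨rfl, Or.inl ⟨h4, rfl⟩⟩)
      · rcases h3 with ⟨rfl, h⟩ | ⟨rfl, h, h'⟩ | ⟨rfl, h⟩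
        · exact Or.inl ⟨rfl, by omega, h⟩
        · exact Or.inr (Or.inl ⟨rfl, ⟨h4, h⟩, Or.inr h'⟩)
        · exact Or.inr (Or.inr ⟨rfl, Or.inr h⟩)
      · push Not at h5
        rcases h3 with ⟨rfl, h⟩ | ⟨rfl, h, -⟩ | ⟨rfl, -⟩
        · exact Or.inr (Or.inl ⟨rfl, ⟨h4, fun w hw hw' => by have := h w hw hw'; omega⟩,
            Or.inl ⟨by omega, rfl⟩⟩)
        · exact Or.inr (Or.inl ⟨rfl, ⟨h4, h⟩, Or.inl ⟨by omega, rfl⟩⟩)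
        · omega

/-- What `z` and `qq` are after an inspection of the hyperedges number `j, …, m - 1`. -/
def ValueSpec (n i k a : ℕ) (X Q : ℕ → ℕ) (V : ℕ → ℕ → ℕ) (j m z qq : ℕ) : Prop :=
  (z = 1 ∧ ∃ e, j ≤ e ∧ e < m ∧ (∃ w < k, V e w = a % n) ∧ (∀ w < k, i ≤ V e w) ∧
    ∀ w < k, X (nextVisit n (V e w) a) = 2) ∨
  (z = 2 ∧ ∀ e, j ≤ e → e < m → (∃ w < k, V e w = a % n) → (∀ w < k, i ≤ V e w) →
    ∃ w < k, X (nextVisit n (V e w) a) = 1) ∨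
  (z = 3 ∧ ∃ e, j ≤ e ∧ e < m ∧ (∃ w < k, V e w = a % n) ∧ (∀ w < k, i ≤ V e w) ∧
    (∀ w < k, X (nextVisit n (V e w) a) ≠ 1) ∧
    ((∃ w < k, X (nextVisit n (V e w) a) = 0 ∧ qq = nextVisit n (V e w) a) ∨
      ((∀ w < k, X (nextVisit n (V e w) a) ≠ 0) ∧
        ∃ w < k, X (nextVisit n (V e w) a) = 3 ∧ qq = Q (nextVisit n (V e w) a))))

theorem edgeStep_spec {m : ℕ} {V : ℕ → ℕ → ℕ} (hV : ∀ e < m, ∀ w < k, V e w < n)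
    (hX : ∀ x < n, X (nextVisit n x a) ≤ 3) :
    ValueSpec n i k a X Q V 0 m (down (fun e => edgeStep n i k a X Q (V e)) m (2, 0)).1
      (down (fun e => edgeStep n i k a X Q (V e)) m (2, 0)).2 := by
  refine down_induction (fun j (y : ℕ × ℕ) => ValueSpec n i k a X Q V j m y.1 y.2) m _ ?_ ?_
  · exact Or.inr (Or.inl ⟨rfl, fun e h1 h2 => by omega⟩)
  · rintro j hj ⟨z, qq⟩ hz
    obtain ⟨h1, h2, h3⟩ := posStep_spec (i := i) (Q := Q) (hV j hj) hX
    unfold edgeStep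
    unfold QuerySpec at h3
    generalize down _ k (0, 0, 0, 0) = p at h1 h2 h3
    simp only [zero_le, true_and, forall_const] at h1 h2 h3
    dsimp only at hz ⊢
    -- A hyperedge leaves the verdict alone if it misses the updated vertex, has a vertex below `i`,
    -- has a vertex known to be zero, or if the verdict is already `1`.
    have hkeep : ((∃ w < k, V j w = a % n) → (∀ w < k, i ≤ V j w) →
        (∃ w < k, X (nextVisit n (V j w) a) = 1) ∨ z = 1) → ValueSpec n i k a X Q V j m z qq := by
      intro h
      rcases hz with ⟨rfl, e, h4, h5⟩ | ⟨rfl, h4⟩ | ⟨rfl, e, h4, h5⟩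
      · exact Or.inl ⟨rfl, e, by omega, h5⟩
      · refine Or.inr (Or.inl ⟨rfl, fun e h5 h6 h7 h8 => ?_⟩)
        rcases eq_or_lt_of_le h5 with rfl | h9
        · exact (h h7 h8).resolve_right (by norm_num)
        · exact h4 e h9 h6 h7 h8
      · exact Or.inr (Or.inr ⟨rfl, e, by omega, h5⟩)
    split_ifs with h4 h5 h6 h7
    · exact hkeep fun h => absurd h4 (h1.2 h)
    · refine hkeep fun _ h => Or.inl ?_
      obtain ⟨w, hw, h' | h'⟩ := h2.1 h5
      · exact ⟨w, hw, h'⟩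
      · have := h w hw
        omega
    all_goals
      have hA := h1.1 h4
      have hB : ∀ w < k, X (nextVisit n (V j w) a) ≠ 1 ∧ i ≤ V j w := fun w hw =>
        not_or.1 (fun h => (h2.2 ⟨w, hw, h.imp_right not_le.1⟩) (not_not.1 h5)) |>.imp_right not_not.1
    · rcases h3 with ⟨-, h3⟩ | ⟨h3, -⟩ | ⟨h3, -⟩
      · exact Or.inl ⟨rfl, j, le_rfl, hj, hA, fun w hw => (hB w hw).2,
          fun w hw => (h3 w hw).resolve_left (hB w hw).1⟩
      all_goals omega
    · refine hkeep fun _ _ => Or.inr ?_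
      rcases hz with ⟨rfl, -⟩ | ⟨rfl, -⟩ | ⟨rfl, -⟩ <;> omega
    · refine Or.inr (Or.inr ⟨rfl, j, le_rfl, hj, hA, fun w hw => (hB w hw).2,
        fun w hw => (hB w hw).1, ?_⟩)
      rcases h3 with ⟨h3, -⟩ | ⟨-, h3⟩ | ⟨-, h3⟩
      exacts [absurd h3 h6, Or.inr h3, Or.inl h3]

/-- The condition on the entry of age `a` of a table. -/
def IsEntry (n : ℕ) (F : Finset (Finset ℕ)) (σ X Q : ℕ → ℕ) (a : ℕ) : Prop :=
  (σ a = 0 → X a = 0 ∧ Q a = a) ∧ (σ a = 1 → X a = 1) ∧ (σ a = 2 →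
    (X a = 1 ∧ ∃ e ∈ F, a % n ∈ e ∧ ∀ x ∈ e, x ≠ a % n → X (nextVisit n x a) = 2) ∨
    (X a = 2 ∧ ∀ e ∈ F, a % n ∈ e → ∃ x ∈ e, x ≠ a % n ∧ X (nextVisit n x a) = 1) ∨
    (X a = 3 ∧ ∃ e ∈ F, a % n ∈ e ∧ (∀ x ∈ e, x ≠ a % n → X (nextVisit n x a) ≠ 1) ∧
      ((∃ x ∈ e, x ≠ a % n ∧ X (nextVisit n x a) = 0 ∧ Q a = nextVisit n x a) ∨
        ((∀ x ∈ e, x ≠ a % n → X (nextVisit n x a) ≠ 0) ∧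
          ∃ x ∈ e, x ≠ a % n ∧ X (nextVisit n x a) = 3 ∧ Q a = Q (nextVisit n x a)))))

theorem IsEntry.congr {F : Finset (Finset ℕ)} {σ X Q X' Q' : ℕ → ℕ} (h : IsEntry n F σ X Q a)
    (hX : ∀ b, a ≤ b → X' b = X b) (hQ : ∀ b, a ≤ b → Q' b = Q b) : IsEntry n F σ X' Q' a := by
  unfold IsEntry at h ⊢
  simpa only [hX _ le_rfl, hQ _ le_rfl, hX _ (le_nextVisit n _ a), hQ _ (le_nextVisit n _ a)] using h

theorem IsEntry.value_le {F : Finset (Finset ℕ)} {σ X Q : ℕ → ℕ} (h : IsEntry n F σ X Q a)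
    (hσ : σ a ≤ 2) : X a ≤ 3 := by
  obtain ⟨h0, h1, h2⟩ := h
  have h : σ a = 0 ∨ σ a = 1 ∨ σ a = 2 := by omega
  rcases h with h | h | h
  · have := h0 h
    omega
  · have := h1 h
    omega
  · rcases h2 h with h | h | h <;> omega

/-- Since the entry `a` holds `2` during the inspection, any vertex with another entry differs from
the updated one. The entries at larger ages are not touched when the result is written. -/
theorem ValueSpec.isEntry {m z qq : ℕ} {V : ℕ → ℕ → ℕ} {σ X' Q' : ℕ → ℕ}
    (h : ValueSpec n i k a X Q V 0 m z qq) (hσ : σ a = 2) (hn : 0 < n)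
    (hV : ∀ e < m, ∀ w < k, V e w < n) (ha : X a = 2) (hz : X' a = z) (hqq : Q' a = qq)
    (hX : ∀ b, a < b → X' b = X b) (hQ : ∀ b, a < b → Q' b = Q b) :
    IsEntry n (above (edgeFinset k m V) i) σ X' Q' a := by
  have hself : nextVisit n (a % n) a = a := nextVisit_self hn a
  have hX' : ∀ e < m, ∀ w < k, V e w ≠ a % n →
      X' (nextVisit n (V e w) a) = X (nextVisit n (V e w) a) :=
    fun e he w hw h => hX _ (lt_nextVisit (hV e he w hw) h)
  have hQ' : ∀ e < m, ∀ w < k, V e w ≠ a % n →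
      Q' (nextVisit n (V e w) a) = Q (nextVisit n (V e w) a) :=
    fun e he w hw h => hQ _ (lt_nextVisit (hV e he w hw) h)
  have hne : ∀ x, X (nextVisit n x a) ≠ 2 → x ≠ a % n := by
    rintro x hx rfl
    exact hx (by rw [hself, ha])
  have hmem : ∀ e < m, (∀ w < k, i ≤ V e w) →
      (range k).image (V e) ∈ above (edgeFinset k m V) i := by
    intro e he hi
    refine mem_filter.2 ⟨mem_image_of_mem _ (mem_range.2 he), fun x hx => ?_⟩
    obtain ⟨w, hw, rfl⟩ := mem_image.1 hx
    exact hi w (mem_range.1 hw)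
  have hin : ∀ e, ∀ w < k, V e w ∈ (range k).image (V e) := fun e w hw =>
    mem_image_of_mem _ (mem_range.2 hw)
  refine ⟨fun h => by omega, fun h => by omega, fun _ => ?_⟩
  rw [hz, hqq]
  rcases h with ⟨rfl, e, -, he, ⟨w, hw, hwa⟩, hi, h⟩ | ⟨rfl, h⟩ |
    ⟨rfl, e, -, he, ⟨w, hw, hwa⟩, hi, h1, h⟩
  · refine Or.inl ⟨rfl, _, hmem e he hi, hwa ▸ hin e w hw, fun x hx hxa => ?_⟩
    obtain ⟨u, hu, rfl⟩ := mem_image.1 hx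
    have hu := mem_range.1 hu
    rw [hX' e he u hu hxa, h u hu]
  · refine Or.inr (Or.inl ⟨rfl, fun f hf haf => ?_⟩)
    obtain ⟨hf, hi⟩ := mem_filter.1 hf
    obtain ⟨e, he, rfl⟩ := mem_image.1 hf
    have he := mem_range.1 he
    obtain ⟨w, hw, hwa⟩ := mem_image.1 haf
    obtain ⟨u, hu, h⟩ := h e (Nat.zero_le _) he ⟨w, mem_range.1 hw, hwa⟩ fun u hu => hi _ (hin e u hu)
    have hua := hne (V e u) (by omega)
    exact ⟨_, hin e u hu, hua, by rw [hX' e he u hu hua, h]⟩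
  · refine Or.inr (Or.inr ⟨rfl, _, hmem e he hi, hwa ▸ hin e w hw, fun x hx hxa => ?_, ?_⟩)
    · obtain ⟨u, hu, rfl⟩ := mem_image.1 hx
      have hu := mem_range.1 hu
      rw [hX' e he u hu hxa]
      exact h1 u hu
    · rcases h with ⟨u, hu, h2, h3⟩ | ⟨h2, u, hu, h3, h4⟩
      · have hua := hne (V e u) (by omega)
        exact Or.inl ⟨_, hin e u hu, hua, by rw [hX' e he u hu hua, h2], h3⟩
      · have hua := hne (V e u) (by omega)
        refine Or.inr ⟨fun x hx hxa => ?_, _, hin e u hu, hua, by rw [hX' e he u hu hua, h3],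
          by rw [hQ' e he u hu hua, h4]⟩
        obtain ⟨u, hu, rfl⟩ := mem_image.1 hx
        have hu := mem_range.1 hu
        rw [hX' e he u hu hxa]
        exact h2 u hu

end

/-- The entry at age `j` refers only to larger ages, so filling downwards preserves the entries
already correct. -/
theorem tabulates_table {n i k m N : ℕ} {V : ℕ → ℕ → ℕ} (hn : 0 < n)
    (hV : ∀ e < m, ∀ w < k, V e w < n) :
    Tabulates n N (above (edgeFinset k m V) i) (table n i k m N V) := by
  intro D σ hσ
  have hσN : ∀ a, N ≤ a → σ a = 0 := by
    intro a ha
    by_contra h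
    have := hσ.lt a ((hσ.mem_iff a).2 h)
    omega
  suffices h : ∀ a, 0 ≤ a → a < N + n → IsEntry n (above (edgeFinset k m V) i) σ
      (table n i k m N V σ).1 (table n i k m N V σ).2 a from
    ⟨fun a ha => (h a (Nat.zero_le _) ha).1, fun a ha => (h a (Nat.zero_le _) ha).2.1,
      fun a ha => (h a (Nat.zero_le _) ha).2.2⟩
  refine down_induction (fun j (T : (ℕ → ℕ) × (ℕ → ℕ)) => ∀ a, j ≤ a → a < N + n →
    IsEntry n (above (edgeFinset k m V) i) σ T.1 T.2 a) N _ ?_ ?_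
  · intro a ha haN
    have h0 := hσN a ha
    refine ⟨fun _ => ⟨rfl, if_pos ?_⟩, fun h => by omega, fun h => by omega⟩
    unfold arrayBound
    omega
  · intro j hj T hT a hja ha
    have hne : ∀ b, j < b → b ≠ j := fun b hb => hb.ne'
    rcases lt_or_eq_of_le hja with hja | rfl
    · refine (hT a hja ha).congr (fun b hb => ?_) fun b hb => ?_
      · exact (cellStep_of_ne n i k m V σ (by omega : b ≠ j) T).1
      · exact (cellStep_of_ne n i k m V σ (by omega : b ≠ j) T).2
    · have h2 := hσ.le j
      by_cases hσj : σ j - 1 = 0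
      · rw [cellStep, if_pos hσj]
        exact ⟨fun h => by simp [h], fun h => by simp [h], fun h => by omega⟩
      · have hspec := edgeStep_spec (i := i) (a := j) (X := Function.update T.1 j 2) (Q := T.2) hV
          fun x hx => by
            have h3 := le_nextVisit n x j
            have h4 := nextVisit_lt hn x j
            rcases eq_or_lt_of_le h3 with h5 | h5
            · rw [← h5, Function.update_self]
              norm_num
            · rw [Function.update_of_ne (by omega)]
              exact (hT _ h5 (by omega)).value_le (hσ.le _)
        refine hspec.isEntry (by omega) hn hV (Function.update_self _ _ _) ?_ ?_ ?_ ?_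
        all_goals rw [cellStep, if_neg hσj]
        · simp
        · simp
        · intro b hb
          simp [hb.ne']
        · intro b hb
          simp [hb.ne']

end HypergraphFPTAS

/-! ### Moving the input and computing the parameters -/

namespace HypergraphFPTAS

open LogRAM Finset

/-- Lets the halving loop run exactly once per binary digit. -/
theorem size_eq_size_half {x : ℕ} (hx : x ≠ 0) : x.size = (x / 2).size + 1 := by
  have h1 : 2 ^ (x / 2).size ≤ x ↔ (x / 2).size < x.size := Nat.lt_size.symm
  have h2 : x.size ≤ (x / 2).size + 1 := Nat.size_le.2 (by
    have := Nat.lt_size_self (x / 2)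
    rw [pow_succ]
    omega)
  have h3 : (x / 2).size < x.size := by
    rw [← h1]
    rcases Nat.eq_zero_or_pos (x / 2).size with h | h
    · rw [h]
      omega
    · have := Nat.lt_size.1 (Nat.sub_lt h one_pos)
      have h4 : 2 ^ (x / 2).size = 2 ^ ((x / 2).size - 1) * 2 := by
        rw [← pow_succ]
        congr 1
        omega
      omega
  omega

/-- Move the input to the first array. -/
def relocProg (k : ℕ) : Program :=
  .seq (assign 4 (.mul (.lit (k + 1)) (rg 3)))
    (.countdown 4 (.store (entry 24 (rg 4)) (.cell (.add (.lit 4) (rg 4)))))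

/-- Word `j` moves from the cell `4 + j` up to `4 * j + 24`; proceeding downwards, no word is
overwritten before it is read. Word `0` is lost because the counter occupies the cell `4`, but it is
only the cardinality of the first hyperedge. -/
theorem runs_relocProg (k : ℕ) (M : Memory) :
    ∃ S : Store, Runs (relocProg k) M S.mem ((k + 1) * M 3 * 4 + 3) ∧ S.num = M 0 ∧ S.den = M 1 ∧
      S.n = M 2 ∧ S.m = M 3 ∧ (∀ j, 0 < j → j < (k + 1) * M 3 → S.E j = M (4 + j)) ∧
      ∀ a, S.sig a = M (4 * a + 25) ∧ S.X a = M (4 * a + 26) ∧ S.Q a = M (4 * a + 27) := by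
  obtain ⟨M', hloop, h4, h1, h2, h3⟩ := Runs.countdown_exists (r := 4)
    (P := .store (entry 24 (rg 4)) (.cell (.add (.lit 4) (rg 4)))) (T := 1)
    (fun j M' => M' 4 = j ∧ (∀ l, l ≠ 4 → l < 4 * j + 24 → M' l = M l) ∧
      (∀ l, l % 4 ≠ 0 → M' l = M l) ∧
      ∀ i, j ≤ i → 0 < i → i < (k + 1) * M 3 → M' (4 * i + 24) = M (4 + i))
    (fun j M' h => h.1) ((k + 1) * M 3) (Function.update M 4 ((k + 1) * M 3))
    ⟨by simp, fun l hl _ => Function.update_of_ne hl _ _,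
      fun l hl => Function.update_of_ne (by omega) _ _, fun i h1 _ h3 => by omega⟩ (by
      rintro j hj M' ⟨-, h1, h2, h3⟩
      refine ⟨_, Runs.of_effect (by simp) rfl, ?_⟩
      have e1 : (Expr.add (.mul (.lit 4) (rg 4)) (.lit 24)).eval (Function.update M' 4 j) =
        4 * j + 24 := by simp
      have e2 : (Expr.cell (.add (.lit 4) (rg 4))).eval (Function.update M' 4 j) =
        Function.update M' 4 j (4 + j) := by simp
      rw [Program.effect, e1, e2]
      refine ⟨?_, fun l hl hl' => ?_, fun l hl => ?_, fun i hi hi0 hiB => ?_⟩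
      · rw [Function.update_of_ne (by omega), Function.update_self]
      · rw [Function.update_of_ne (by omega), Function.update_of_ne hl]
        exact h1 l hl (by omega)
      · rw [Function.update_of_ne (by omega), Function.update_of_ne (by omega)]
        exact h2 l hl
      · rcases eq_or_lt_of_le hi with rfl | h
        · rw [Function.update_self, Function.update_of_ne (by omega)]
          exact h1 _ (by omega) (by omega)
        · rw [Function.update_of_ne (by omega), Function.update_of_ne (by omega)]
          exact h3 i h hi0 hiB)
  refine ⟨Store.ofMem M', ?_, h1 0 (by norm_num) (by norm_num), h1 1 (by norm_num) (by norm_num),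
    h1 2 (by norm_num) (by norm_num), h1 3 (by norm_num) (by norm_num),
    fun j hj hj' => h3 j (Nat.zero_le _) hj hj',
    fun a => ⟨h2 _ (by omega), h2 _ (by omega), h2 _ (by omega)⟩⟩
  rw [Store.mem_ofMem]
  refine (Runs.seq (Runs.of_effect (by simp) (by simp)) hloop).mono ?_
  simp only [Program.length]
  omega

/-- The body of the loop that computes the parameters. -/
def paramStep (c : ℕ) : Program :=
  .seq (assign 7 (.div (rg 7) (.lit 2)))
  (.seq (assign 4 (.add (rg 4) (.mul (.lit c) (rg 2))))
  (.seq (assign 5 (.add (rg 5) (.lit c))) (assign 6 (.mul (.lit (2 ^ c)) (rg 6)))))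

/-- Each halving of `x` adds `c` coins; `N` and `2 ^ L` are updated alongside, so that only
multiplications by literals occur. -/
theorem runs_paramLoop (c : ℕ) : ∀ (ℓ : ℕ) (S : Store), S.x.size = ℓ →
    Runs (.while (rg 7) (paramStep c)) S.mem
      { S with
        x := 0, N := S.N + ℓ * (c * S.n), L := S.L + ℓ * c, pw := 2 ^ (ℓ * c) * S.pw }.mem
      (ℓ * 8 + 1)
  | 0, S, h => by
    have hx : S.x = 0 := Nat.size_eq_zero.1 h
    refine ⟨1, le_rfl, ?_⟩
    have := Steps.while_false (P := paramStep c) (e := rg 7) (M := S.mem) (by simp [hx])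
    obtain ⟨num, den, n, m, N, L, pw, x⟩ := S
    dsimp only at hx
    subst hx
    simpa using this
  | ℓ + 1, S, h => by
    have hx : S.x ≠ 0 := by
      intro hx
      simp [hx] at h
    obtain ⟨n, hn, hs⟩ := runs_paramLoop c ℓ { S with
      x := S.x / 2, N := S.N + c * S.n, L := S.L + c, pw := 2 ^ c * S.pw } (by
        have := size_eq_size_half hx
        change (S.x / 2).size = ℓ
        omega)
    obtain ⟨n', hn', hs'⟩ := Runs.of_effect (P := paramStep c) (M := S.mem) (M' := { S with
      x := S.x / 2, N := S.N + c * S.n, L := S.L + c, pw := 2 ^ c * S.pw }.mem)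
      (by simp [paramStep]) (by simp [paramStep])
    refine ⟨n' + n + 1, ?_, ?_⟩
    · simp only [paramStep, Program.length] at hn'
      omega
    · refine Steps.while_true (by simp [hx]) hs' ?_
      convert hs using 3 <;> ring

/-- Reset the registers for local use. -/
def clearProg : Program :=
  .seq (assign 9 (.lit 0)) (.seq (assign 10 (.lit 0)) (.seq (assign 11 (.lit 0))
  (.seq (assign 12 (.lit 0)) (.seq (assign 13 (.lit 0)) (.seq (assign 14 (.lit 0))
  (.seq (assign 15 (.lit 0)) (.seq (assign 16 (.lit 0)) (.seq (assign 17 (.lit 0))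
  (.seq (assign 18 (.lit 0)) (.seq (assign 19 (.lit 0)) (.seq (assign 20 (.lit 0))
  (.seq (assign 21 (.lit 0)) (.seq (assign 22 (.lit 0)) (.seq (assign 23 (.lit 0))
  (.seq (assign 0 (.lit 1)) (assign 1 (.lit 1)))))))))))))))))

/-- Compute the parameters. -/
def paramProg (c₀ c₁ : ℕ) : Program :=
  .seq (.seq (assign 7 (.add (.div (rg 1) (rg 0)) (rg 2)))
    (.seq (assign 4 (.mul (.lit (c₀ + 2)) (rg 2)))
    (.seq (assign 5 (.lit c₀)) (assign 6 (.lit (2 ^ c₀))))))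
  (.seq (.while (rg 7) (paramStep c₁)) clearProg)

/-- The number of coins that are used. -/
def coins (c₀ c₁ p q n : ℕ) : ℕ := c₀ + (q / p + n).size * c₁

theorem runs_paramProg (c₀ c₁ : ℕ) (S : Store) :
    Runs (paramProg c₀ c₁) S.mem
      { S with
        num := 1, den := 1, N := S.n * (coins c₀ c₁ S.num S.den S.n + 2)
        L := coins c₀ c₁ S.num S.den S.n, pw := 2 ^ coins c₀ c₁ S.num S.den S.n
        x := 0, s := 0, j := 0, bits := 0, a := 0, e := 0, w := 0, c := 0, h := 0, o := 0, q := 0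
        z := 0, qq := 0, t := 0, u := 0, b := 0 }.mem
      ((S.den / S.num + S.n).size * 8 + 50) := by
  refine (Runs.seq (Runs.of_effect (M' := { S with
    x := S.den / S.num + S.n, N := (c₀ + 2) * S.n, L := c₀, pw := 2 ^ c₀ }.mem) (by simp) (by simp)) <|
    Runs.seq (runs_paramLoop c₁ _ _ rfl) <| Runs.of_effect (by simp [clearProg]) ?_).mono ?_
  · have h1 : (c₀ + 2) * S.n + (S.den / S.num + S.n).size * (c₁ * S.n) =
      S.n * (coins c₀ c₁ S.num S.den S.n + 2) := by
      unfold coins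
      ring
    have h2 : 2 ^ ((S.den / S.num + S.n).size * c₁) * 2 ^ c₀ =
      2 ^ coins c₀ c₁ S.num S.den S.n := by
      unfold coins
      rw [← pow_add, add_comm]
    simp [clearProg, h1, h2, coins]
  · simp only [Program.length, clearProg]
    omega

/-- The whole program. -/
def mainProg (k c₀ c₁ : ℕ) : Program :=
  .seq (relocProg k) (.seq (paramProg c₀ c₁) (stagesProg k))

/-- A bound on the number of steps of `mainProg`. -/
def mainTime (k n m x L : ℕ) : ℕ :=
  ((k + 1) * m * 4 + 3) + (x.size * 8 + 50) + (n * (stageTime n k m (n * (L + 2)) L + 3) + 3) + 2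

theorem runs_mainProg (k c₀ c₁ : ℕ) {M : Memory} {p q n m L : ℕ} (hp : M 0 = p) (hq : M 1 = q)
    (hn : M 2 = n) (hm : M 3 = m) (hM : ∀ l, 4 + (k + 1) * m ≤ l → M l = 0)
    (hV : ∀ e < m, ∀ w < k, M (4 + ((k + 1) * e + (1 + w))) < n) (hL : L = coins c₀ c₁ p q n) {Δ : ℕ}
    (hF : IsBounded n k Δ (edgeFinset k m fun e w => M (4 + ((k + 1) * e + (1 + w))))) :
    ∃ (V : ℕ → ℕ → ℕ) (M' : Memory),
      edgeFinset k m V = edgeFinset k m (fun e w => M (4 + ((k + 1) * e + (1 + w)))) ∧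
      (∀ e < m, ∀ w < k, V e w < n) ∧
      Runs (mainProg k c₀ c₁) M M' (mainTime k n m (q / p + n) L) ∧ M' 0 = 2 ^ (L * n) ∧
      M' 1 = ∏ i ∈ range n, zeroCount (table n i k m (n * (L + 2)) V) i L := by
  obtain ⟨S, h1, rfl, rfl, rfl, rfl, hE, harr⟩ : ∃ S : Store, Runs (relocProg k) M S.mem
      ((k + 1) * m * 4 + 3) ∧ S.num = p ∧ S.den = q ∧
      S.n = n ∧ S.m = m ∧ (∀ j, 0 < j → j < (k + 1) * m → S.E j = M (4 + j)) ∧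
      ∀ a, S.sig a = M (4 * a + 25) ∧ S.X a = M (4 * a + 26) ∧ S.Q a = M (4 * a + 27) := by
    subst hp hq hn hm
    exact runs_relocProg k M
  have hvert : ∀ e < S.m, ∀ w < k, S.vertex k e w = M (4 + ((k + 1) * e + (1 + w))) := by
    intro e he w hw
    refine hE _ (by omega) ?_
    have := Nat.mul_le_mul_left (k + 1) (Nat.succ_le_of_lt he)
    rw [Nat.mul_succ] at this
    omega
  have hedge : edgeFinset k S.m (S.vertex k) =
      edgeFinset k S.m (fun e w => M (4 + ((k + 1) * e + (1 + w)))) :=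
    image_congr fun e he => image_congr fun w hw => hvert e (by simpa using he) w (by simpa using hw)
  have hlt : ∀ e < S.m, ∀ w < k, S.vertex k e w < S.n := fun e he w hw =>
    (hvert e he w hw).trans_lt (hV e he w hw)
  have h2 := runs_paramProg c₀ c₁ S
  rw [← hL] at h2
  obtain ⟨M', h3, h4, h5⟩ := runs_stagesProg k { S with
    num := 1, den := 1, N := S.n * (L + 2), L := L, pw := 2 ^ L
    x := 0, s := 0, j := 0, bits := 0, a := 0, e := 0, w := 0, c := 0, h := 0, o := 0, q := 0
    z := 0, qq := 0, t := 0, u := 0, b := 0 } ⟨rfl, rfl, rfl, rfl, rfl, rfl, rfl, rfl, rfl, rfl, rfl, rfl, rfl⟩ rfl rfl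
    rfl rfl rfl rfl (fun i hi => (tabulates_table (by
      change i < S.n at hi
      omega) hlt).queriesFresh ((hedge ▸ hF).mono (filter_subset _ _)) hi le_rfl)
    -- An auxiliary entry with index at least `(k + 1) * m` lies beyond the end of the input, hence
    -- it was initially zero.
    (fun a ha => by
      have : (k + 1) * S.m ≤ a := (Nat.le_add_right _ _).trans ha
      obtain ⟨e1, e2, e3⟩ := harr a
      exact ⟨e1.trans (hM _ (by omega)), e2.trans (hM _ (by omega)), e3.trans (hM _ (by omega))⟩)
  exact ⟨S.vertex k, M', hedge, hlt, (h1.seq (h2.seq h3)).mono (by simp only [mainTime]; omega), h4, h5⟩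

end HypergraphFPTAS

namespace HypergraphFPTAS

open LogRAM Finset

attribute [local simp] Program.IsTame Expr.IsTame Program.countdown relocProg paramProg paramStep clearProg
  stagesProg stageProg runProg revealProg tableProg cellProg edgeProg posProg boundExpr enext emod in
theorem isTame_mainProg (k c₀ c₁ : ℕ) : (mainProg k c₀ c₁).IsTame := by
  simp [mainProg]

/-! ### Polynomial bounds -/

section

variable {ι : Type*} {Y : ι → ℕ} {f g : ι → ℕ}

/-- `f` is bounded by a power of `Y`. -/
def IsPolyBounded (Y f : ι → ℕ) : Prop := ∃ c, ∀ i, f i ≤ Y i ^ c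

namespace IsPolyBounded

theorem mono (hg : IsPolyBounded Y g) (h : ∀ i, f i ≤ g i) : IsPolyBounded Y f := by
  obtain ⟨c, hc⟩ := hg
  exact ⟨c, fun i => (h i).trans (hc i)⟩

theorem base : IsPolyBounded Y Y := ⟨1, fun i => by simp⟩

theorem mul (hf : IsPolyBounded Y f) (hg : IsPolyBounded Y g) :
    IsPolyBounded Y fun i => f i * g i := by
  obtain ⟨c, hc⟩ := hf
  obtain ⟨d, hd⟩ := hg
  exact ⟨c + d, fun i => (Nat.mul_le_mul (hc i) (hd i)).trans_eq (pow_add _ _ _).symm⟩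

theorem const (hY : ∀ i, 2 ≤ Y i) (a : ℕ) : IsPolyBounded Y fun _ => a :=
  ⟨a, fun i => (Nat.lt_two_pow_self (n := a)).le.trans (Nat.pow_le_pow_left (hY i) a)⟩

theorem add (hY : ∀ i, 2 ≤ Y i) (hf : IsPolyBounded Y f) (hg : IsPolyBounded Y g) :
    IsPolyBounded Y fun i => f i + g i := by
  obtain ⟨c, hc⟩ := hf
  obtain ⟨d, hd⟩ := hg
  refine ⟨c + d + 1, fun i => ?_⟩
  have h0 : 0 < Y i := two_pos.trans_le (hY i)
  have h1 : Y i ^ c ≤ Y i ^ (c + d) := Nat.pow_le_pow_right h0 (by omega)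
  have h2 : Y i ^ d ≤ Y i ^ (c + d) := Nat.pow_le_pow_right h0 (by omega)
  have h3 := Nat.mul_le_mul_left (Y i ^ (c + d)) (hY i)
  have h4 := hc i
  have h5 := hd i
  change f i + g i ≤ _
  rw [pow_succ]
  omega

theorem pow (hf : IsPolyBounded Y f) (d : ℕ) : IsPolyBounded Y fun i => f i ^ d := by
  obtain ⟨c, hc⟩ := hf
  exact ⟨c * d, fun i => (Nat.pow_le_pow_left (hc i) d).trans_eq (pow_mul _ _ _).symm⟩

variable {n m N L x : ι → ℕ}

theorem arrayBound (hY : ∀ i, 2 ≤ Y i) (k : ℕ) (hn : IsPolyBounded Y n) (hm : IsPolyBounded Y m)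
    (hN : IsPolyBounded Y N) : IsPolyBounded Y fun i => arrayBound (n i) k (m i) (N i) :=
  add hY (mul (const hY _) hm) (add hY hN hn)

theorem tableTime (hY : ∀ i, 2 ≤ Y i) (k : ℕ) (hn : IsPolyBounded Y n) (hm : IsPolyBounded Y m)
    (hN : IsPolyBounded Y N) : IsPolyBounded Y fun i => tableTime (n i) k (m i) (N i) :=
  add hY (add hY (mul (arrayBound hY k hn hm hN) (const hY _))
    (mul hN (add hY (add hY (mul hm (const hY _)) (const hY _)) (const hY _)))) (const hY _)

theorem runTime (hY : ∀ i, 2 ≤ Y i) (k : ℕ) (hn : IsPolyBounded Y n) (hm : IsPolyBounded Y m)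
    (hN : IsPolyBounded Y N) (hL : IsPolyBounded Y L) :
    IsPolyBounded Y fun i => runTime (n i) k (m i) (N i) (L i) :=
  add hY (add hY (add hY (mul (arrayBound hY k hn hm hN) (const hY _))
    (mul hL (add hY (tableTime hY k hn hm hN) (const hY _)))) (tableTime hY k hn hm hN)) (const hY _)

theorem stageTime (hY : ∀ i, 2 ≤ Y i) (k : ℕ) (hn : IsPolyBounded Y n) (hm : IsPolyBounded Y m)
    (hN : IsPolyBounded Y N) (hL : IsPolyBounded Y L) (hpw : IsPolyBounded Y fun i => 2 ^ L i) :
    IsPolyBounded Y fun i => stageTime (n i) k (m i) (N i) (L i) :=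
  add hY (mul hpw (add hY (runTime hY k hn hm hN hL) (const hY _))) (const hY _)

theorem mainTime (hY : ∀ i, 2 ≤ Y i) (k : ℕ) (hn : IsPolyBounded Y n) (hm : IsPolyBounded Y m)
    (hx : IsPolyBounded Y x) (hL : IsPolyBounded Y L) (hpw : IsPolyBounded Y fun i => 2 ^ L i) :
    IsPolyBounded Y fun i => mainTime k (n i) (m i) (x i) (L i) :=
  add hY (add hY (add hY (add hY (mul (mul (const hY _) hm) (const hY _)) (const hY _))
    (add hY (mul (hx.mono fun _ => Nat.size_le.2 Nat.lt_two_pow_self) (const hY _)) (const hY _)))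
    (add hY (mul hn (add hY (stageTime hY k hn hm (mul hn (add hY hL (const hY _))) hL hpw)
      (const hY _))) (const hY _))) (const hY _)

end IsPolyBounded

end

theorem two_pow_size_le (x : ℕ) : 2 ^ x.size ≤ 2 * x + 1 := by
  rcases Nat.eq_zero_or_pos x.size with h | h
  · rw [h]
    omega
  · have := Nat.lt_size.1 (Nat.sub_lt h one_pos)
    have h4 : 2 ^ x.size = 2 ^ (x.size - 1) * 2 := by
      rw [← pow_succ]
      congr 1
      omega
    omega

/-- The number of coins is a constant multiple of a bit length plus a constant, so its exponential
is polynomial. -/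
theorem isPolyBounded_two_pow_coins {ι : Type*} {Y p q n : ι → ℕ} (hY : ∀ i, 2 ≤ Y i) (c₀ c₁ : ℕ)
    (hx : IsPolyBounded Y fun i => q i / p i + n i) :
    IsPolyBounded Y fun i => 2 ^ coins c₀ c₁ (p i) (q i) (n i) := by
  refine (IsPolyBounded.mul (.const hY (2 ^ c₀))
    ((IsPolyBounded.add hY (.mul (.const hY 2) hx) (.const hY 1)).pow c₁)).mono fun i => ?_
  rw [coins, pow_add, pow_mul]
  exact Nat.mul_le_mul_left _ (Nat.pow_le_pow_left (two_pow_size_le _) _)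

end HypergraphFPTAS

namespace HypergraphFPTAS

open LogRAM Finset

/-! ### Reading the input -/

theorem getD_flatMap {α : Type*} (f : α → List ℕ) (c : ℕ) : ∀ (l : List α), (∀ a ∈ l, (f a).length = c) →
    ∀ (j r : ℕ) (hj : j < l.length), r < c → (l.flatMap f).getD (c * j + r) 0 = (f l[j]).getD r 0
  | a :: l, h, 0, r, _, hr => by
    have ha := h a (by simp)
    rw [List.flatMap_cons, List.getD_append _ _ _ _ (by omega)]
    simp
  | a :: l, h, j + 1, r, hj, hr => by
    have ha := h a (by simp)
    rw [List.flatMap_cons, List.getD_append_right _ _ _ _ (by rw [ha, Nat.mul_succ]; omega), ha]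
    have h1 : c * (j + 1) + r - c = c * j + r := by rw [Nat.mul_succ]; omega
    rw [h1, getD_flatMap f c l (fun b hb => h b (by simp [hb])) j r (by simpa using hj) hr]
    rfl

end HypergraphFPTAS

namespace HypergraphData

open Finset HypergraphFPTAS

variable (D : HypergraphData) {k Δ : ℕ}

/-- The hyperedges, as sets of natural numbers. -/
def edgeFinset : Finset (Finset ℕ) := (D.edges.map fun e => e.toFinset.image Fin.val).toFinset

theorem mem_edgeFinset {f : Finset ℕ} :
    f ∈ D.edgeFinset ↔ ∃ e ∈ D.edges, e.toFinset.image Fin.val = f := by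
  simp [edgeFinset]

theorem card_edgeFinset : D.edgeFinset.card = D.edges.length := by
  rw [edgeFinset, List.toFinset_card_of_nodup, List.length_map]
  exact List.Pairwise.map _ (fun e f h => (image_injective Fin.val_injective).ne h) D.distinct

theorem length_of_mem (hk : D.toHypergraph.IsUniform k) {e : List (Fin D.n)} (he : e ∈ D.edges) :
    e.length = k := by
  have h := hk {v | v ∈ e} ⟨e, he, rfl⟩
  rw [← h, ← List.toFinset_card_of_nodup (D.nodup e he), ← Set.ncard_coe_finset]
  simp

theorem isBounded_edgeFinset (hk : D.toHypergraph.IsUniform k)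
    (hΔ : ∀ v, D.toHypergraph.degree v ≤ Δ) : IsBounded D.n k Δ D.edgeFinset where
  lt f hf x hx := by
    obtain ⟨e, -, rfl⟩ := D.mem_edgeFinset.1 hf
    obtain ⟨v, -, rfl⟩ := mem_image.1 hx
    exact v.2
  card f hf := by
    obtain ⟨e, he, rfl⟩ := D.mem_edgeFinset.1 hf
    rw [card_image_of_injective _ Fin.val_injective, List.toFinset_card_of_nodup (D.nodup e he),
      D.length_of_mem hk he]
  degree x := by
    by_cases hx : x < D.n
    · refine le_trans ?_ (hΔ ⟨x, hx⟩)
      rw [← Set.ncard_coe_finset]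
      refine Set.ncard_le_ncard_of_injOn (fun f => {v : Fin D.n | v.val ∈ f}) ?_ ?_ (Set.toFinite _)
      · intro f hf
        obtain ⟨hf, hxf⟩ := mem_filter.1 hf
        obtain ⟨e, he, rfl⟩ := D.mem_edgeFinset.1 hf
        refine ⟨⟨e, he, ?_⟩, hxf⟩
        ext v
        simp [Fin.val_inj]
      · intro f hf g hg hfg
        obtain ⟨e, he, rfl⟩ := D.mem_edgeFinset.1 (mem_filter.1 hf).1
        obtain ⟨e', he', rfl⟩ := D.mem_edgeFinset.1 (mem_filter.1 hg).1
        congr 1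
        ext v
        have := Set.ext_iff.1 hfg v
        simpa [Fin.val_inj] using this
    · rw [filter_eq_empty_iff.2]
      · simp
      · intro f hf hxf
        obtain ⟨e, -, rfl⟩ := D.mem_edgeFinset.1 hf
        obtain ⟨v, -, rfl⟩ := mem_image.1 hxf
        exact hx v.2

/-- Every hyperedge is nonempty, and each vertex lies in at most `Δ` of them. Thus the number of
hyperedges need not appear in the size of the instance. -/
theorem length_edges_le (hk : 0 < k) (hF : IsBounded D.n k Δ D.edgeFinset) :
    D.edges.length ≤ D.n * Δ := by
  rw [← card_edgeFinset]
  have : D.edgeFinset ⊆ (range D.n).biUnion fun x => D.edgeFinset.filter (x ∈ ·) := by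
    intro f hf
    obtain ⟨x, hx⟩ := card_pos.1 (hk.trans_eq (hF.card f hf).symm)
    exact mem_biUnion.2 ⟨x, mem_range.2 (hF.lt f hf x hx), mem_filter.2 ⟨hf, hx⟩⟩
  refine (card_le_card this).trans ((card_biUnion_le_card_mul _ _ _ fun x _ => hF.degree x).trans ?_)
  rw [card_range]

theorem numIndepSets_eq : D.toHypergraph.numIndepSets = (indep D.n D.edgeFinset).card := by
  classical
  rw [Hypergraph.numIndepSets, ← Set.ncard_coe_finset]
  refine Set.ncard_congr (fun S _ => (univ.filter (· ∈ S)).image Fin.val) ?_ ?_ ?_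
  · rintro S ⟨-, hS⟩
    refine mem_indep.2 ⟨fun x hx => ?_, fun f hf hfS => ?_⟩
    · obtain ⟨v, -, rfl⟩ := mem_image.1 hx
      exact mem_range.2 v.2
    · obtain ⟨e, he, rfl⟩ := D.mem_edgeFinset.1 hf
      refine hS _ ⟨e, he, rfl⟩ (Set.inter_eq_right.2 fun v hv => ?_)
      have := hfS (mem_image_of_mem _ (List.mem_toFinset.2 hv))
      simpa [Fin.val_inj] using this
  · intro S S' _ _ h
    ext v
    have := Finset.ext_iff.1 h v
    simpa [Fin.val_inj] using this
  · intro T hT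
    obtain ⟨hT, hT'⟩ := mem_indep.1 hT
    refine ⟨{v | v.val ∈ T}, ⟨Set.subset_univ _, ?_⟩, ?_⟩
    · rintro _ ⟨e, he, rfl⟩ h
      refine hT' _ (D.mem_edgeFinset.2 ⟨e, he, rfl⟩) fun x hx => ?_
      obtain ⟨v, hv, rfl⟩ := mem_image.1 hx
      exact Set.inter_eq_right.1 h (List.mem_toFinset.1 hv)
    · ext x
      simp only [Set.mem_ofPred_eq, mem_image, mem_filter, mem_univ, true_and]
      constructor
      · rintro ⟨v, hv, rfl⟩
        exact hv
      · exact fun hx => ⟨⟨x, mem_range.1 (hT hx)⟩, hx, rfl⟩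

theorem length_flatMap (hk : D.toHypergraph.IsUniform k) :
    (D.edges.flatMap fun e => e.length :: e.map Fin.val).length = (k + 1) * D.edges.length := by
  rw [List.length_flatMap, mul_comm, ← smul_eq_mul, ← List.sum_replicate, ← List.map_const']
  congr 1
  refine List.map_congr_left fun e he => ?_
  simp [D.length_of_mem hk he]

theorem initial_encode_vertex (hk : D.toHypergraph.IsUniform k) (p q : ℕ) {e w : ℕ}
    (he : e < D.edges.length) (hw : w < k) :
    LogRAM.initial (p :: q :: D.encode) (4 + ((k + 1) * e + (1 + w))) =
      (D.edges[e].map Fin.val).getD w 0 := by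
  have h1 : 4 + ((k + 1) * e + (1 + w)) = ((k + 1) * e + (1 + w)) + 1 + 1 + 1 + 1 := by ring
  rw [LogRAM.initial, encode, h1]
  simp only [List.getD_cons_succ]
  rw [getD_flatMap _ (k + 1) _ (fun a ha => by simp [D.length_of_mem hk ha]) _ _ he (by omega),
    add_comm 1 w, List.getD_cons_succ]

theorem edgeFinset_initial (hk : D.toHypergraph.IsUniform k) (p q : ℕ) :
    HypergraphFPTAS.edgeFinset k D.edges.length (fun e w =>
      LogRAM.initial (p :: q :: D.encode) (4 + ((k + 1) * e + (1 + w)))) = D.edgeFinset := by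
  ext f
  rw [mem_edgeFinset, HypergraphFPTAS.edgeFinset, mem_image]
  have key : ∀ e (he : e < D.edges.length), (range k).image (fun w =>
      LogRAM.initial (p :: q :: D.encode) (4 + ((k + 1) * e + (1 + w)))) =
      D.edges[e].toFinset.image Fin.val := by
    intro e he
    have hlen := D.length_of_mem hk (List.getElem_mem he)
    ext x
    simp only [mem_image, mem_range, List.mem_toFinset]
    constructor
    · rintro ⟨w, hw, rfl⟩
      refine ⟨D.edges[e][w], List.getElem_mem _, ?_⟩
      rw [D.initial_encode_vertex hk p q he hw, List.getD_eq_getElem _ _ (by simpa [hlen] using hw),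
        List.getElem_map]
    · rintro ⟨v, hv, rfl⟩
      obtain ⟨w, hw, rfl⟩ := List.getElem_of_mem hv
      refine ⟨w, by omega, ?_⟩
      rw [D.initial_encode_vertex hk p q he (by omega), List.getD_eq_getElem _ _ (by simpa using hw),
        List.getElem_map]
  constructor
  · rintro ⟨e, he, rfl⟩
    exact ⟨_, List.getElem_mem (mem_range.1 he), (key e (mem_range.1 he)).symm⟩
  · rintro ⟨e, he, rfl⟩
    obtain ⟨j, hj, rfl⟩ := List.getElem_of_mem he
    exact ⟨j, mem_range.2 hj, key j hj⟩

theorem initial_encode_le (hk : D.toHypergraph.IsUniform k) {p q : ℕ} (l : ℕ) :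
    LogRAM.initial (p :: q :: D.encode) l ≤ max p q + (D.n + D.edges.length + k) := by
  match l with
  | 0 => exact (le_max_left p q).trans (Nat.le_add_right _ _)
  | 1 => exact (le_max_right p q).trans (Nat.le_add_right _ _)
  | 2 =>
    change D.n ≤ _
    omega
  | 3 =>
    change D.edges.length ≤ _
    omega
  | l + 4 =>
    change (D.edges.flatMap fun e => e.length :: e.map Fin.val).getD l 0 ≤ _
    by_cases hl : l < (D.edges.flatMap fun e => e.length :: e.map Fin.val).length
    · rw [List.getD_eq_getElem _ _ hl]
      have := List.getElem_mem hl
      obtain ⟨e, he, h⟩ := List.mem_flatMap.1 this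
      rcases List.mem_cons.1 h with h | h
      · rw [h, D.length_of_mem hk he]
        omega
      · obtain ⟨v, -, h⟩ := List.mem_map.1 h
        have := v.2
        omega
    · rw [List.getD_eq_default _ _ (by omega)]
      omega

end HypergraphData

namespace HypergraphFPTAS

open LogRAM Finset

/-! ### The approximation scheme -/

/-- Squaring the assumption gives `8 * e * k ^ 4 * Δ ^ 2 ≤ 2 ^ k`, which exceeds the need by a
factor `4 * k`. -/
theorem two_mul_exp_le {k Δ : ℕ} (hk : 2 ≤ k)
    (hkΔ : (Δ : ℝ) ≤ 1 / (Real.sqrt (8 * Real.exp 1) * (k : ℝ) ^ 2) * (2 : ℝ) ^ ((k : ℝ) / 2)) :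
    2 * ((k ^ 3 * Δ ^ 2 : ℕ) : ℝ) * Real.exp 1 ≤ 2 ^ k := by
  have hk' : (2 : ℝ) ≤ k := by exact_mod_cast hk
  have he : 0 < Real.exp 1 := Real.exp_pos 1
  have hs : 0 < Real.sqrt (8 * Real.exp 1) * (k : ℝ) ^ 2 := by positivity
  rw [one_div, inv_mul_eq_div, le_div_iff₀ hs] at hkΔ
  have h1 : (Δ * (Real.sqrt (8 * Real.exp 1) * (k : ℝ) ^ 2)) ^ 2 ≤ ((2 : ℝ) ^ ((k : ℝ) / 2)) ^ 2 :=
    pow_le_pow_left₀ (by positivity) hkΔ 2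
  have h2 : ((2 : ℝ) ^ ((k : ℝ) / 2)) ^ 2 = 2 ^ k := by
    rw [← Real.rpow_natCast, ← Real.rpow_mul two_pos.le, ← Real.rpow_natCast]
    congr 1
    push_cast
    ring
  have h3 : (Δ * (Real.sqrt (8 * Real.exp 1) * (k : ℝ) ^ 2)) ^ 2 =
      (Δ : ℝ) ^ 2 * (8 * Real.exp 1) * (k : ℝ) ^ 4 := by
    rw [mul_pow, mul_pow, Real.sq_sqrt (by positivity)]
    ring
  rw [h2, h3] at h1
  refine le_trans ?_ h1
  push_cast
  have h4 : (k : ℝ) ^ 3 * 2 ≤ k ^ 3 * (4 * k) := by gcongr; linarith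
  have h5 : 0 ≤ (Δ : ℝ) ^ 2 * (2 * Real.exp 1) := by positivity
  nlinarith [mul_le_mul_of_nonneg_left h4 h5, pow_nonneg (show (0 : ℝ) ≤ k by linarith) 3,
    mul_nonneg h5 (pow_nonneg (show (0 : ℝ) ≤ k by linarith) 3)]

/-- The estimate never falls below `Z`. The upper bound rests on `(1 - ε / 2) * (1 + ε) ≥ 1` for `0
≤ ε ≤ 1`. -/
theorem approx_of_prod {Z A P p q : ℕ} (hpq : p < q) (hP : 0 < P) (h1 : P * Z ≤ A)
    (h2 : (A : ℝ) * (1 - p / (2 * q)) ≤ P * Z) :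
    (1 - (p : ℚ) / q) * Z ≤ (A : ℚ) / P ∧ (A : ℚ) / P ≤ (1 + (p : ℚ) / q) * Z := by
  have h2' : (A : ℚ) * (1 - p / (2 * q)) ≤ P * Z := by
    rw [← Rat.cast_le (K := ℝ)]
    push_cast
    exact h2
  have h1' : (P : ℚ) * Z ≤ A := by exact_mod_cast h1
  have hP' : (0 : ℚ) < P := by exact_mod_cast hP
  have hq : (0 : ℚ) < q := by exact_mod_cast (Nat.zero_le p).trans_lt hpq
  have hε : (p : ℚ) / (2 * q) = p / q / 2 := by rw [mul_comm, div_div]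
  have hε1 : (p : ℚ) / q < 1 := (div_lt_one hq).2 (by exact_mod_cast hpq)
  have hε0 : 0 ≤ (p : ℚ) / q := by positivity
  rw [hε] at h2'
  generalize (p : ℚ) / q = ε at *
  have hZ : (0 : ℚ) ≤ Z := Nat.cast_nonneg _
  have hA : (0 : ℚ) ≤ A := Nat.cast_nonneg _
  constructor
  · rw [le_div_iff₀ hP']
    nlinarith [mul_nonneg hε0 (mul_nonneg hP'.le hZ)]
  · rw [div_le_iff₀ hP']
    have h3 : (A : ℚ) ≤ A * (1 - ε / 2) * (1 + ε) := by
      nlinarith [mul_nonneg hA (mul_nonneg hε0 (sub_nonneg.2 hε1.le))]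
    have h4 := mul_le_mul_of_nonneg_right h2' (by linarith : 0 ≤ 1 + ε)
    linarith

/-- The constant part of the number of coins. -/
def baseCoins (k Δ : ℕ) : ℕ := 2 + Δ * k + 4 * k ^ 4 * Δ ^ 2

/-- The factor of the logarithm in the number of coins. -/
def rateCoins (k Δ : ℕ) : ℕ := 2 * k ^ 4 * Δ ^ 2

theorem coins_eq (k Δ p q n : ℕ) : coins (baseCoins k Δ) (rateCoins k Δ) p q n =
    2 + (1 + k * (2 * (q / p + n).size + 4) * (Δ * k * k)) * (Δ * k) := by
  unfold coins baseCoins rateCoins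
  ring

/-- With `x = q / p + n`, both `n` and `q / p + 1` are at most `2 ^ x.size`, which explains the
factor two in the exponent; the `4` supplies the `16`. -/
theorem accuracy_le {p q n : ℕ} (hp : 0 < p) : 16 * n * q ≤ 2 ^ (2 * (q / p + n).size + 4) * p := by
  set x := q / p + n with hx
  have h1 : q ≤ (q / p + 1) * p := by
    rw [mul_comm]
    exact (Nat.lt_mul_div_succ q hp).le
  have h2 := Nat.lt_size_self x
  have h3 : n ≤ 2 ^ x.size := (Nat.le_add_left _ _).trans h2.le
  have h4 : q / p + 1 ≤ 2 ^ x.size := (Nat.le_add_right _ n).trans_lt h2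
  calc 16 * n * q ≤ 16 * 2 ^ x.size * (2 ^ x.size * p) :=
        Nat.mul_le_mul (Nat.mul_le_mul_left _ h3) (h1.trans (Nat.mul_le_mul_right _ h4))
    _ = _ := by ring

/-- The inputs of the approximation scheme. -/
structure Input (k Δ : ℕ) where
  D : HypergraphData
  isUniform : D.toHypergraph.IsUniform k
  degree_le : ∀ v, D.toHypergraph.degree v ≤ Δ
  p : ℕ
  q : ℕ
  pos : 0 < p
  lt : p < q

namespace Input

variable {k Δ : ℕ} (I : Input k Δ)

/-- The parameter in which the running time is polynomial. -/
def size : ℕ := I.D.n + I.q / I.p + I.q.size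

theorem two_le_size : 2 ≤ I.size := by
  have h1 : 1 ≤ I.q / I.p := (Nat.one_le_div_iff I.pos).2 I.lt.le
  have h2 : 0 < I.q.size := Nat.size_pos.2 (I.pos.trans I.lt)
  unfold size
  omega

/-- The number of coins. -/
def coins : ℕ := HypergraphFPTAS.coins (baseCoins k Δ) (rateCoins k Δ) I.p I.q I.D.n

/-- A bound on the number of steps. -/
def steps : ℕ := mainTime k I.D.n I.D.edges.length (I.q / I.p + I.D.n) I.coins

/-- A bound on the bit length of the input words. -/
def width : ℕ := I.q.size + (I.D.n + I.D.edges.length + k)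

theorem initial_lt (l : ℕ) : initial (I.p :: I.q :: I.D.encode) l < 2 ^ I.width := by
  refine (I.D.initial_encode_le I.isUniform l).trans_lt ?_
  rw [max_eq_right I.lt.le, width, pow_add]
  generalize I.D.n + I.D.edges.length + k = a
  have h1 := Nat.lt_size_self I.q
  have h2 := Nat.lt_two_pow_self (n := a)
  nlinarith

/-- The logarithmic cost is at most quadratic in the number of steps, and that number is polynomial
because `2 ^ L` is. -/
theorem isPolyBounded_time (hk : 0 < k) (g κ : ℕ) : IsPolyBounded (size (k := k) (Δ := Δ))
    fun I => I.steps * (κ * (I.width + g * I.steps + 2)) := by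
  have hY := two_le_size (k := k) (Δ := Δ)
  have hn : IsPolyBounded (size (k := k) (Δ := Δ)) fun I => I.D.n :=
    IsPolyBounded.base.mono fun _ => (Nat.le_add_right _ _).trans (Nat.le_add_right _ _)
  have hm : IsPolyBounded (size (k := k) (Δ := Δ)) fun I => I.D.edges.length :=
    (hn.mul (.const hY Δ)).mono fun I =>
      I.D.length_edges_le hk (I.D.isBounded_edgeFinset I.isUniform I.degree_le)
  have hx : IsPolyBounded (size (k := k) (Δ := Δ)) fun I => I.q / I.p + I.D.n :=
    IsPolyBounded.base.mono fun _ => (add_comm _ _).le.trans (Nat.le_add_right _ _)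
  have hpw : IsPolyBounded (size (k := k) (Δ := Δ)) fun I => 2 ^ I.coins :=
    isPolyBounded_two_pow_coins hY _ _ hx
  have hL : IsPolyBounded (size (k := k) (Δ := Δ)) coins :=
    hpw.mono fun I => (Nat.lt_two_pow_self (n := I.coins)).le
  have hT : IsPolyBounded (size (k := k) (Δ := Δ)) steps := .mainTime hY k hn hm hx hL hpw
  have hq : IsPolyBounded (size (k := k) (Δ := Δ)) fun I => I.q.size :=
    IsPolyBounded.base.mono fun _ => Nat.le_add_left _ _
  exact hT.mul (.mul (.const hY κ) (.add hY (.add hY (.add hY hq (.add hY (.add hY hn hm)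
    (.const hY k))) (.mul (.const hY g) hT)) (.const hY 2)))

theorem runs (hk : 2 ≤ k) (hΔ : 0 < Δ)
    (hkΔ : 2 * ((k ^ 3 * Δ ^ 2 : ℕ) : ℝ) * Real.exp 1 ≤ 2 ^ k) :
    ∃ M, Runs (mainProg k (baseCoins k Δ) (rateCoins k Δ)) (initial (I.p :: I.q :: I.D.encode)) M
        I.steps ∧ M 1 ≠ 0 ∧
      (1 - (I.p : ℚ) / I.q) * I.D.toHypergraph.numIndepSets ≤ (M 0 : ℚ) / M 1 ∧
      (M 0 : ℚ) / M 1 ≤ (1 + (I.p : ℚ) / I.q) * I.D.toHypergraph.numIndepSets := by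
  have hF := I.D.isBounded_edgeFinset I.isUniform I.degree_le
  have hedge := I.D.edgeFinset_initial I.isUniform I.p I.q
  obtain ⟨V, M, hV, hVlt, hruns, h0, h1⟩ := runs_mainProg k (baseCoins k Δ) (rateCoins k Δ)
    (M := initial (I.p :: I.q :: I.D.encode)) (p := I.p) (q := I.q) (n := I.D.n)
    (m := I.D.edges.length) (L := I.coins) (Δ := Δ) rfl rfl rfl rfl (fun l hl => by
      refine List.getD_eq_default _ _ ?_
      have := I.D.length_flatMap I.isUniform
      simp only [HypergraphData.encode, List.length_cons]
      omega)
    (fun e he w hw => (hedge.symm ▸ hF).lt _ (mem_image.2 ⟨e, mem_range.2 he, rfl⟩) _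
      (mem_image.2 ⟨w, mem_range.2 hw, rfl⟩)) rfl (hedge.symm ▸ hF)
  rw [hedge] at hV
  have hT : ∀ i < I.D.n, Tabulates I.D.n (I.D.n * (I.coins + 2)) (above I.D.edgeFinset i)
      (table I.D.n i k I.D.edges.length (I.D.n * (I.coins + 2)) V) := fun i hi =>
    hV ▸ tabulates_table (by omega) hVlt
  have hspec := fun i (hi : i < I.D.n) => (hT i hi).zeroCount_spec
    (M := 2 * (I.q / I.p + I.D.n).size + 4) (L := I.coins)
    (hF.mono (filter_subset _ _)) (by omega) hΔ hkΔ hi le_rfl (coins_eq k Δ I.p I.q I.D.n).ge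
  obtain ⟨h2, h3, h4⟩ := prod_approx I.pos I.lt hF.lt (fun h => by
    have := hF.card _ h
    rw [card_empty] at this
    omega) (accuracy_le I.pos) (fun i hi => (hspec i hi).1) fun i hi => (hspec i hi).2
  rw [← h1] at h2 h3 h4
  rw [← h0] at h3
  have h5 := approx_of_prod I.lt h2 h3 (by
    rw [h0]
    push_cast
    exact h4)
  rw [HypergraphData.numIndepSets_eq]
  exact ⟨M, hruns, h2.ne', h5⟩

end Input

end HypergraphFPTAS

open HypergraphFPTAS LogRAM in
theorem theorem1p1 (k Δ : ℕ) (hk : 2 ≤ k) (hΔ : 2 ≤ Δ)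
    (hkΔ : (Δ : ℝ) ≤ 1 / (Real.sqrt (8 * Real.exp 1) * (k : ℝ) ^ 2) * (2 : ℝ) ^ ((k : ℝ) / 2)) :
    HasFPTAS
      (fun D : HypergraphData =>
        D.toHypergraph.IsUniform k ∧ ∀ v : Fin D.n, D.toHypergraph.degree v ≤ Δ)
      (fun D => D.n) HypergraphData.encode (fun D => D.toHypergraph.numIndepSets) := by
  set P := mainProg k (baseCoins k Δ) (rateCoins k Δ) with hP
  obtain ⟨c, hc⟩ := Input.isPolyBounded_time (Δ := Δ) (show 0 < k by omega) P.growth P.weight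
  refine ⟨P, c + 1, fun D hD p q hp hpq => ?_⟩
  let I : Input k Δ := ⟨D, hD.1, hD.2, p, q, hp, hpq⟩
  obtain ⟨M, ⟨s, hs, hsteps⟩, h1, h2, h3⟩ := I.runs hk (by omega) (two_mul_exp_le hk hkΔ)
  obtain ⟨-, t, hexec, ht⟩ := hsteps.exec (isTame_mainProg _ _ _) le_rfl le_rfl I.initial_lt
  refine ⟨M, t, hexec, h1, h2, h3, ?_⟩
  have h4 : t ≤ I.size ^ c :=
    (ht.trans (Nat.mul_le_mul hs (Nat.mul_le_mul_left _ (Nat.add_le_add_right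
      (Nat.add_le_add_left (Nat.mul_le_mul_left _ hs) _) _)))).trans (hc I)
  have h5 : (1 : ℚ) ≤ I.size := by exact_mod_cast one_le_two.trans I.two_le_size
  -- The program uses the rounded quotient `q / p`, which is at most `1 / ε`.
  have h6 : (I.size : ℚ) ≤ (D.n : ℚ) + (q : ℚ) / p + (q.size : ℚ) := by
    change ((D.n + q / p + q.size : ℕ) : ℚ) ≤ _
    push_cast
    gcongr
    exact Nat.cast_div_le
  calc (t : ℚ) ≤ (I.size : ℚ) ^ c := by exact_mod_cast h4
    _ ≤ (I.size : ℚ) ^ (c + 1) := pow_le_pow_right₀ h5 (Nat.le_succ c)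
    _ ≤ ((D.n : ℚ) + (q : ℚ) / p + (q.size : ℚ)) ^ (c + 1) := by gcongr
    _ ≤ ((c + 1 : ℕ) : ℚ) * ((D.n : ℚ) + (q : ℚ) / p + (q.size : ℚ)) ^ (c + 1) :=
        le_mul_of_one_le_left (by positivity) (by simp)
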